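/- Let $\mathcal{O}\subset\mathbb{R}^2$ be open and connected, and let $Z:\mathcal{O}\to\mathbb{C}$ be real analytic and injective with $dZ\neq 0$ everywhere. Let $L=Z_x\partial_y-Z_y\partial_x$, a vector field for which $Z$ is a global first integral. Let $\Sigma=\{\operatorname{Im}(Z_x\overline{Z_y})=0\}\subset\mathcal{O}$ be its characteristic set. The *type* of $L$ at a point is the smallest $n$ for which some bracket $[X_1,[X_2,\dots,[X_{n-1},X_n]]]$ with all $X_i\in\{L,\overline L\}$ is linearly independent of $L$ at that point. Assume that $L$ has finite type at every point of $\Sigma$. Let $\Sigma^1_R$ be the regular part of $\Sigma$: the set of $p\in\Sigma$ near which $\operatorname{Im}(Z_x\overline{Z_y})=u\,y^l$, where $l\ge 1$, $u$ is a nowhere vanishing real analytic function and $y$ is a real analytic function with $y(p)=0$ and $dy(p)\ne0$. For $\epsilon,\delta>0$ let $R_{\epsilon,\delta}=(-1-\epsilon,1+\epsilon)\times(-\delta,\delta)$. (1) Let $\Gamma$ be a connected component of $\Sigma^1_R$, let $\Gamma_{p,q}\subset\Gamma$ be an arc connecting two distinct points $p,q$, and assume that $L$ has the same type $k$ at every point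 of $\Gamma_{p,q}$. Then there are $\epsilon,\delta>0$ and a real analytic diffeomorphism $\Phi$ from $R_{\epsilon,\delta}$ onto an open set $U\subset\mathcal{O}$ with $\Phi(-1,0)=p$, $\Phi(1,0)=q$ and $\Phi([-1,1]\times\{0\})=\Gamma_{p,q}$ (so $U$ is a neighborhood of $\Gamma_{p,q}$), such that the function $Z_{p,q}(s,t)=s+it^k$ satisfies $d(Z\circ\Phi)\wedge dZ_{p,q}=0$ in $R_{\epsilon,\delta}$; that is, $Z_{p,q}$ is a first integral of $(\Phi^{-1})_*L$: $L(Z_{p,q}\circ\Phi^{-1})=0$ in $U$. (2) Let $\Gamma\subset\Sigma^1_R$ be a simple closed curve and assume that $L$ has the same type $k$ at every point of $\Gamma$. Then there are $\delta>0$ and a real analytic diffeomorphism $\Phi$ from $\mathbb{S}^1\times(-\delta,\delta)$ onto an open set $U\subset\mathcal{O}$ with $\Phi(\mathbb{S}^1\times\{0\})=\Gamma$, such that, with $\theta$ the angular variable on $\mathbb{S}^1$, the function $Z_\Gamma(\theta,t)=\exp(t^k+i\theta)$ satisfies $d(Z\circ\Phi)\wedge dZ_\Gamma=0$ in $\mathbb{S}^1\times(-\delta,\delta)$;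 that is, $Z_\Gamma$ is a first integral of $(\Phi^{-1})_*L$: $L(Z_\Gamma\circ\Phi^{-1})=0$ in $U$. -/

import Mathlib

open scoped Manifold ContDiff ComplexConjugate

noncomputable section

namespace PlanarStructure

/-- The partial derivative with respect to the first coordinate of the plane. -/
def pdx (f : ℝ × ℝ → ℂ) (x : ℝ × ℝ) : ℂ := fderiv ℝ f x (1, 0)

/-- The partial derivative with respect to the second coordinate of the plane. -/
def pdy (f : ℝ × ℝ → ℂ) (x : ℝ × ℝ) : ℂ := fderiv ℝ f x (0, 1)

/-- The coefficient of `dx ∧ dy` in the two-form `df ∧ dg`. -/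
def wedge (f g : ℝ × ℝ → ℂ) (x : ℝ × ℝ) : ℂ := pdx f x * pdy g x - pdy f x * pdx g x

/-- A complex vector field `A ∂/∂x + B ∂/∂y` on the plane, given by its coefficients `(A, B)`. -/
abbrev CVectorField := ℝ × ℝ → ℂ × ℂ

namespace CVectorField

/-- The derivative `X f = A f_x + B f_y` of the function `f` along `X = A ∂/∂x + B ∂/∂y`. -/
def apply (X : CVectorField) (f : ℝ × ℝ → ℂ) (x : ℝ × ℝ) : ℂ :=
  (X x).1 * pdx f x + (X x).2 * pdy f x

/-- The conjugate vector field, whose coefficients are the complex conjugates. -/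
def bar (X : CVectorField) : CVectorField := fun x => (conj (X x).1, conj (X x).2)

/-- The Lie bracket `[X, Y] = XY - YX`. -/
def bracket (X Y : CVectorField) : CVectorField := fun x =>
  (X.apply (fun z => (Y z).1) x - Y.apply (fun z => (X z).1) x,
   X.apply (fun z => (Y z).2) x - Y.apply (fun z => (X z).2) x)

/-- `IsIteratedBracket L n X`: the vector field `X` is a bracket
`[X₁, [X₂, … [Xₙ₋₁, Xₙ]]]` in which every `Xᵢ` is `L` or its conjugate
(for `n = 1` this is `X₁` itself). -/
inductive IsIteratedBracket (L : CVectorField) : ℕ → CVectorField → Prop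
  | self : IsIteratedBracket L 1 L
  | bar : IsIteratedBracket L 1 L.bar
  | bracket_self {n : ℕ} {X : CVectorField} :
      IsIteratedBracket L n X → IsIteratedBracket L (n + 1) (L.bracket X)
  | bracket_bar {n : ℕ} {X : CVectorField} :
      IsIteratedBracket L n X → IsIteratedBracket L (n + 1) (L.bar.bracket X)

/-- `L` has (finite) type `k` at `p`: `k` is the smallest length of an iterated bracket of `L` and
its conjugate that is linearly independent of `L` at `p`. -/
def HasTypeAt (L : CVectorField) (p : ℝ × ℝ) (k : ℕ) : Prop :=
  IsLeast {n | ∃ X, L.IsIteratedBracket n X ∧ LinearIndependent ℂ ![X p, L p]} k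

/-- The function `Im (A * conj B)`, which vanishes exactly where `L` is not elliptic. -/
def charFun (L : CVectorField) (x : ℝ × ℝ) : ℝ := ((L x).1 * conj (L x).2).im

/-- The characteristic set `Σ` of `L` in `O`. -/
def charSet (L : CVectorField) (O : Set (ℝ × ℝ)) : Set (ℝ × ℝ) := {x ∈ O | L.charFun x = 0}

/-- The regular one-dimensional part of the characteristic set: the points of `Σ` near which
`Σ` is given, as an analytic set with multiplicity, by `y ^ l = 0`, where `y` is one of two
local analytic coordinates (an analytic function with `y p = 0` and `dy ≠ 0` at `p`) and `l ≥ 1`.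
That is, `Im (A * conj B) = u * y ^ l` with a nowhere vanishing analytic `u`. -/
def regularCharSet (L : CVectorField) (O : Set (ℝ × ℝ)) : Set (ℝ × ℝ) :=
  {p ∈ L.charSet O | ∃ (U : Set (ℝ × ℝ)) (u y : ℝ × ℝ → ℝ) (l : ℕ),
    IsOpen U ∧ p ∈ U ∧ U ⊆ O ∧ AnalyticOnNhd ℝ u U ∧ AnalyticOnNhd ℝ y U ∧
    y p = 0 ∧ fderiv ℝ y p ≠ 0 ∧ 1 ≤ l ∧ ∀ x ∈ U, u x ≠ 0 ∧ L.charFun x = u x * y x ^ l}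

end CVectorField

/-- The vector field `L = Z_x ∂/∂y - Z_y ∂/∂x` defined by a function `Z`. -/
def vectorFieldOf (Z : ℝ × ℝ → ℂ) : CVectorField := fun x => (-pdy Z x, pdx Z x)

/-- `Z` defines an analytic hypocomplex structure of finite type on the domain `O`: it is an
injective analytic function with `dZ ≠ 0` everywhere, and `L = Z_x ∂/∂y - Z_y ∂/∂x` (for which it
is a global first integral) is of finite type at each point of the characteristic set. -/
structure IsHypocomplex (O : Set (ℝ × ℝ)) (Z : ℝ × ℝ → ℂ) : Prop where
  isOpen : IsOpen O
  isConnected : IsConnected O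
  analytic : AnalyticOnNhd ℝ Z O
  injOn : Set.InjOn Z O
  fderiv_ne_zero : ∀ x ∈ O, fderiv ℝ Z x ≠ 0
  finiteType : ∀ x ∈ (vectorFieldOf Z).charSet O, ∃ k, (vectorFieldOf Z).HasTypeAt x k

/-- `G` is an arc with the end points `p` and `q`. -/
def IsArc (G : Set (ℝ × ℝ)) (p q : ℝ × ℝ) : Prop :=
  ∃ c : ℝ → ℝ × ℝ, ContinuousOn c (Set.Icc 0 1) ∧ Set.InjOn c (Set.Icc 0 1) ∧
    c '' Set.Icc 0 1 = G ∧ c 0 = p ∧ c 1 = q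

/-- `G` is a (simple) closed curve. -/
def IsClosedCurve (G : Set (ℝ × ℝ)) : Prop :=
  ∃ c : Circle → ℝ × ℝ, Continuous c ∧ Function.Injective c ∧ Set.range c = G

/-- The rectangle `R_{ε,δ}`. -/
def rectangle (ε δ : ℝ) : Set (ℝ × ℝ) := Set.Ioo (-1 - ε) (1 + ε) ×ˢ Set.Ioo (-δ) δ

/-- The normal form `s + i t ^ k` along an arc. -/
def arcNormalForm (k : ℕ) (x : ℝ × ℝ) : ℂ := (x.1 : ℂ) + Complex.I * (x.2 : ℂ) ^ k

/-- The normal form `exp (t ^ k + i θ)` along a closed curve, as a function of a point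
`e ^ {iθ}` of the circle and of `t`. -/
def closedNormalForm (k : ℕ) (x : Circle × ℝ) : ℂ := Complex.exp ((x.2 : ℂ) ^ k) * (x.1 : ℂ)

/-- The covering `(θ, t) ↦ (e ^ {iθ}, t)`, through which a function on the cylinder is written in
the angular variable `θ` and in `t`. -/
def angular (x : ℝ × ℝ) : Circle × ℝ := (Circle.exp x.1, x.2)

end PlanarStructure

end

/-! The proof studies the image under `Z` of the characteristic curve.

Since `L Z = 0` and `L̄ Z` is `-2i` times the characteristic function, the type at a regular point
is governed by the order to which `X Z` vanishes along `y = 0`, for `X` an iterated bracket of `L`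
and `L̄`. This order starts at the multiplicity `l`, and each bracketing lowers it by at most one,
so the type is `l + 1` when `L y ≠ 0` and larger otherwise (`hasTypeAt_regular`). If a constant type
were larger than `l + 1`, analyticity would make `L` tangent along a whole piece of the curve; then
`dZ` would kill the tangent vectors and `Z` would be constant there, against injectivity. Hence `L`
is transversal and `l = k - 1` (`isTransversalAt_of_hasTypeAt`).

Under transversality the image of the curve is a regular analytic curve in ℂ, and its arc length
parametrization extends to a local biholomorphism `H`. The function `W = H⁻¹ ∘ Z = S + iT` is real
on the curve, and `dS ∧ dT` is `y ^ (k - 1)` up to a nonvanishing factor, so `T = y ^ k V` with `V ≠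
0`. A `k`-th root of `±V` gives a coordinate `t` with `T = ±t ^ k`; injectivity of `Z` excludes even
`k`, and for odd `k` the sign is absorbed in `t` (`exists_local_normalForm`).

Arc length makes the local pictures fit: unit speed parametrizations of the same oriented curve
differ by a translation (`unitSpeed_unique`), so the local `H` glue to one function, holomorphic
near a real interval (`exists_global_straightening`). The formula `Z ∘ Φ = H (α (s + i t ^ k) + β)`
then determines `Φ`, because `Z` is injective; the local charts agree automatically, and compactness
yields a neighborhood on which `Φ` is injective (`exists_chart_near_compact`). Along a closed curve
the straightening, rescaled, has period `2π` and descends through the exponential to a function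
holomorphic near the unit circle. In both cases `Z ∘ Φ` is a holomorphic function of the normal
form, so the two differentials are proportional. -/

noncomputable section
open Filter Topology Set

namespace PlanarStructure

/-! ### Analytic inverse functions, complexification, integrals with parameters, primitives -/

section Analysis

/-- The inverse function theorem, for charts that are analytic with their inverses. -/
theorem exists_analytic_chart {𝕜 E : Type*} [RCLike 𝕜] [NormedAddCommGroup E] [NormedSpace 𝕜 E]
    [CompleteSpace E] {F : E → E} {a : E} {F' : E ≃L[𝕜] E} (hF : AnalyticAt 𝕜 F a)
    (hF' : HasFDerivAt F (F' : E →L[𝕜] E) a) {U : Set E} (hU : U ∈ 𝓝 a) :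
    ∃ e : OpenPartialHomeomorph E E, a ∈ e.source ∧ e.source ⊆ U ∧ (∀ x, e x = F x) ∧
      AnalyticOnNhd 𝕜 e e.source ∧ AnalyticOnNhd 𝕜 e.symm e.target := by
  have hc : ContDiffAt 𝕜 ω F a := hF.contDiffAt
  let e0 := hc.toOpenPartialHomeomorph F hF' (by simp)
  have ha0 : a ∈ e0.source := hc.mem_toOpenPartialHomeomorph_source hF' (by simp)
  have he0 : ∀ x, e0 x = F x := fun x => rfl
  have hs : AnalyticAt 𝕜 e0.symm (F a) := by
    have h1 : e0.symm (F a) = a := by rw [← he0]; exact e0.left_inv ha0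
    have : ContDiffAt 𝕜 ω e0.symm (F a) := by
      apply e0.contDiffAt_symm (f₀' := F') (e0.map_source ha0)
      · rw [e0.left_inv ha0]; exact hF'
      · rw [e0.left_inv ha0]; exact hc
    exact this.analyticAt
  -- The inverse is known to be analytic only at `F a`; shrinking the source makes this hold on the
  -- whole target.
  have hs' : ∀ᶠ x in 𝓝 a, AnalyticAt 𝕜 e0.symm (F x) :=
    hF.continuousAt.eventually hs.eventually_analyticAt
  obtain ⟨W, hW, hWo, haW⟩ := eventually_nhds_iff.1
    ((hs'.and hF.eventually_analyticAt).and hU)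
  refine ⟨e0.restrOpen W hWo, ⟨ha0, haW⟩, fun x hx => (hW x hx.2).2, fun x => rfl,
    fun x hx => (hW x hx.2).1.2, ?_⟩
  intro z hz
  have h1 : e0.symm z ∈ W := by
    have := (e0.restrOpen W hWo).map_target hz
    exact this.2
  have h2 := (hW _ h1).1.1
  have h3 : F (e0.symm z) = z := (e0.restrOpen W hWo).right_inv hz
  rw [h3] at h2
  exact h2

/-- A function of a real variable that is analytic extends holomorphically. -/
theorem exists_complexification {g : ℝ → ℂ} {x₀ : ℝ} (hg : AnalyticAt ℝ g x₀) :
    ∃ h : ℂ → ℂ, AnalyticAt ℂ h x₀ ∧ ∀ᶠ x : ℝ in 𝓝 x₀, h x = g x := by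
  obtain ⟨p, r, hp⟩ := hg
  -- The same coefficients define a complex power series. In one variable the norm of each term is
  -- that of its coefficient, so the radius does not decrease.
  let q : FormalMultilinearSeries ℂ ℂ ℂ := fun n =>
    ContinuousMultilinearMap.mkPiRing ℂ (Fin n) (p.coeff n)
  have hqc : ∀ n, q.coeff n = p.coeff n := fun n => by
    change ContinuousMultilinearMap.mkPiRing ℂ (Fin n) (p.coeff n) 1 = _
    simp
  have hrad : p.radius ≤ q.radius := by
    apply FormalMultilinearSeries.radius_le_of_le
    intro n
    rw [FormalMultilinearSeries.norm_apply_eq_norm_coef, hqc,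
      FormalMultilinearSeries.norm_apply_eq_norm_coef]
  have hq := q.hasFPowerSeriesOnBall (lt_of_lt_of_le hp.r_pos (hp.r_le.trans hrad))
  refine ⟨fun z => q.sum (z - x₀), ?_, ?_⟩
  · have h1 : AnalyticAt ℂ q.sum ((x₀ : ℂ) - x₀) := by rw [sub_self]; exact hq.analyticAt
    exact h1.comp (f := fun z : ℂ => z - x₀) (analyticAt_id.sub analyticAt_const)
  · have : Metric.eball x₀ r ∈ 𝓝 x₀ := Metric.eball_mem_nhds x₀ hp.r_pos
    filter_upwards [this] with x hx
    have h1 := hp.hasSum_sub hx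
    have h2 : ((x : ℂ) - x₀) ∈ Metric.eball (0 : ℂ) q.radius := by
      have h3 : edist x x₀ < q.radius := lt_of_lt_of_le hx (hp.r_le.trans hrad)
      rw [← Complex.ofReal_sub, Metric.mem_eball, edist_zero_right]
      rw [edist_eq_enorm_sub] at h3
      rwa [← enorm_norm, Complex.norm_real, enorm_norm]
    have h3 := hq.hasSum h2
    rw [zero_add] at h3
    refine h3.unique ?_
    convert h1 using 2 with n
    simp [q]

/-- The power series of `f` can be integrated term by term: since `‖A t‖ ≤ 1` and `‖a t‖ ≤ 1`, every
term stays dominated by that of `f`. It serves the division by a power of `y`, with `A τ (s, y) =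
(s, τ y)`. -/
theorem analyticAt_intervalIntegral_comp {E G : Type*} [NormedAddCommGroup E] [NormedSpace ℝ E]
    [NormedAddCommGroup G] [NormedSpace ℝ G] [CompleteSpace G] {f : E → G} (hf : AnalyticAt ℝ f 0)
    {A : ℝ → E →L[ℝ] E} (hA : Continuous A) (hA1 : ∀ t ∈ Icc (0 : ℝ) 1, ‖A t‖ ≤ 1)
    {a : ℝ → ℝ} (ha : Continuous a) (ha1 : ∀ t ∈ Icc (0 : ℝ) 1, ‖a t‖ ≤ 1) :
    AnalyticAt ℝ (fun v => ∫ t in (0 : ℝ)..1, a t • f (A t v)) 0 := by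
  obtain ⟨p, r, hp⟩ := hf
  have hIcc : ∀ t ∈ uIoc (0 : ℝ) 1, t ∈ Icc (0 : ℝ) 1 := fun t ht => by
    rw [uIoc_of_le zero_le_one] at ht; exact ⟨ht.1.le, ht.2⟩
  let Q : (n : ℕ) → ℝ → ContinuousMultilinearMap ℝ (fun _ : Fin n => E) G := fun n t =>
    a t • (p n).compContinuousLinearMap (fun _ => A t)
  have hQc : ∀ n, Continuous (Q n) := by
    intro n
    refine ha.smul ?_
    have h := (ContinuousMultilinearMap.compContinuousLinearMapContinuousMultilinear ℝ
      (fun _ : Fin n => E) (fun _ : Fin n => E) G).cont.comp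
      (continuous_pi fun _ : Fin n => hA)
    exact h.clm_apply continuous_const
  have hQn : ∀ n, ∀ t ∈ uIoc (0 : ℝ) 1, ‖Q n t‖ ≤ ‖p n‖ := by
    intro n t ht
    have h1 := ContinuousMultilinearMap.norm_compContinuousLinearMap_le (p n) (fun _ => A t)
    have h2 : ∏ _i : Fin n, ‖A t‖ ≤ 1 :=
      Finset.prod_le_one (fun _ _ => norm_nonneg _) fun _ _ => hA1 t (hIcc t ht)
    calc ‖Q n t‖ ≤ 1 * ‖(p n).compContinuousLinearMap (fun _ => A t)‖ := by
          rw [norm_smul]; gcongr; exact ha1 t (hIcc t ht)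
      _ ≤ ‖p n‖ * 1 := by rw [one_mul]; exact h1.trans (by gcongr)
      _ = ‖p n‖ := mul_one _
  let q : FormalMultilinearSeries ℝ E G := fun n => ∫ t in (0 : ℝ)..1, Q n t
  have hqn : ∀ n, ‖q n‖ ≤ ‖p n‖ := fun n => by
    simpa using intervalIntegral.norm_integral_le_of_norm_le_const (hQn n)
  have hq : ∀ n (v : E), q n (fun _ => v) = ∫ t in (0 : ℝ)..1, a t • p n (fun _ => A t v) := by
    intro n v
    have h := (ContinuousMultilinearMap.apply ℝ (fun _ : Fin n => E) G
      (fun _ => v)).intervalIntegral_comp_comm ((hQc n).intervalIntegrable (μ := MeasureTheory.volume) 0 1)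
    rw [ContinuousMultilinearMap.apply_apply] at h
    rw [← h]
    rfl
  refine ⟨q, r, hp.r_le.trans (FormalMultilinearSeries.radius_le_of_le hqn), hp.r_pos, ?_⟩
  intro v hv
  simp only [hq, zero_add]
  have hAv : ∀ t ∈ Icc (0 : ℝ) 1, ‖A t v‖ ≤ ‖v‖ := fun t ht =>
    ((A t).le_opNorm v).trans (by simpa using mul_le_mul_of_nonneg_right (hA1 t ht) (norm_nonneg v))
  have hvr : (‖v‖₊ : ENNReal) < p.radius := by
    have := hp.r_le
    rw [Metric.mem_eball, edist_zero_right, enorm_eq_nnnorm] at hv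
    exact lt_of_lt_of_le hv this
  refine intervalIntegral.hasSum_integral_of_dominated_convergence
    (fun n _ => ‖p n‖ * ‖v‖ ^ n) ?_ ?_ ?_ ?_ ?_
  · intro n
    apply Continuous.aestronglyMeasurable
    refine ha.smul ((p n).cont.comp (continuous_pi fun _ => hA.clm_apply continuous_const))
  · intro n
    refine Eventually.of_forall fun t ht => ?_
    have ht' := hIcc t ht
    rw [norm_smul]
    calc ‖a t‖ * ‖p n fun _ => A t v‖ ≤ 1 * (‖p n‖ * ‖A t v‖ ^ n) := by
          gcongr
          · exact ha1 t ht'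
          · simpa using (p n).le_opNorm (fun _ => A t v)
      _ ≤ ‖p n‖ * ‖v‖ ^ n := by
          rw [one_mul]; gcongr; exact hAv t ht'
  · exact Eventually.of_forall fun t _ => by
      simpa using p.summable_norm_mul_pow hvr
  · exact intervalIntegrable_const
  · refine Eventually.of_forall fun t ht => ?_
    have ht' := hIcc t ht
    have h1 : A t v ∈ Metric.eball (0 : E) r := by
      rw [Metric.mem_eball, edist_zero_right] at hv ⊢
      refine lt_of_le_of_lt ?_ hv
      rw [enorm_le_iff_norm_le]
      exact hAv t ht'
    have h2 := hp.hasSum h1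
    rw [zero_add] at h2
    exact h2.const_smul (a t)

theorem exists_primitive {v : ℂ → ℂ} {z₀ : ℂ} (hv : AnalyticAt ℂ v z₀) :
    ∃ A : ℂ → ℂ, A z₀ = 0 ∧ AnalyticAt ℂ A z₀ ∧ ∀ᶠ z in 𝓝 z₀, HasDerivAt A (v z) z := by
  obtain ⟨r, hr, hb⟩ := Metric.eventually_nhds_iff_ball.1 hv.eventually_analyticAt
  have hd : DifferentiableOn ℂ v (Metric.ball z₀ r) := fun z hz =>
    (hb z hz).differentiableAt.differentiableWithinAt
  obtain ⟨A, hA⟩ := hd.isExactOn_ball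
  have hball : Metric.ball z₀ r ∈ 𝓝 z₀ := Metric.ball_mem_nhds _ hr
  have hA' : AnalyticAt ℂ A z₀ :=
    DifferentiableOn.analyticAt (s := Metric.ball z₀ r)
      (fun z hz => (hA z hz).differentiableAt.differentiableWithinAt) hball
  refine ⟨fun z => A z - A z₀, sub_self _, hA'.sub analyticAt_const, ?_⟩
  filter_upwards [hball] with z hz
  exact (hA z hz).sub_const _

end Analysis

/-! ### Analytic coordinates in the plane and division by powers of `y` -/

section Plane

theorem fderiv_plane_apply {G : Type*} [NormedAddCommGroup G] [NormedSpace ℝ G]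
    (l : ℝ × ℝ →L[ℝ] G) (v : ℝ × ℝ) : l v = v.1 • l (1, 0) + v.2 • l (0, 1) := by
  have : v = v.1 • ((1, 0) : ℝ × ℝ) + v.2 • ((0, 1) : ℝ × ℝ) := by ext <;> simp
  conv_lhs => rw [this]
  simp only [map_add, map_smul]

/-- Two functions with independent differentials at a point are analytic coordinates there. -/
theorem exists_plane_chart {S t : ℝ × ℝ → ℝ} {p : ℝ × ℝ} (hS : AnalyticAt ℝ S p)
    (ht : AnalyticAt ℝ t p)
    (hJ : fderiv ℝ S p (1, 0) * fderiv ℝ t p (0, 1) - fderiv ℝ S p (0, 1) * fderiv ℝ t p (1, 0) ≠ 0)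
    {U : Set (ℝ × ℝ)} (hU : U ∈ 𝓝 p) :
    ∃ e : OpenPartialHomeomorph (ℝ × ℝ) (ℝ × ℝ), p ∈ e.source ∧ e.source ⊆ U ∧
      (∀ x, e x = (S x, t x)) ∧ AnalyticOnNhd ℝ e e.source ∧ AnalyticOnNhd ℝ e.symm e.target := by
  let D : ℝ × ℝ →L[ℝ] ℝ × ℝ := (fderiv ℝ S p).prod (fderiv ℝ t p)
  have hv : ∀ (l : ℝ × ℝ →L[ℝ] ℝ) (v : ℝ × ℝ), l v = v.1 * l (1, 0) + v.2 * l (0, 1) :=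
    fun l v => fderiv_plane_apply l v
  have hinj : Function.Injective D := by
    rw [injective_iff_map_eq_zero]
    intro v h
    have h1 : fderiv ℝ S p v = 0 := congrArg Prod.fst h
    have h2 : fderiv ℝ t p v = 0 := congrArg Prod.snd h
    rw [hv] at h1 h2
    have e1 : v.1 = 0 := (mul_eq_zero.1 (show v.1 * _ = 0 by
      linear_combination fderiv ℝ t p (0, 1) * h1 - fderiv ℝ S p (0, 1) * h2)).resolve_right hJ
    have e2 : v.2 = 0 := (mul_eq_zero.1 (show v.2 * _ = 0 by
      linear_combination fderiv ℝ S p (1, 0) * h2 - fderiv ℝ t p (1, 0) * h1)).resolve_right hJ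
    exact Prod.ext e1 e2
  let F' : (ℝ × ℝ) ≃L[ℝ] ℝ × ℝ :=
    (LinearEquiv.ofInjectiveEndo (D : ℝ × ℝ →ₗ[ℝ] ℝ × ℝ) hinj).toContinuousLinearEquiv
  have hF' : (F' : ℝ × ℝ →L[ℝ] ℝ × ℝ) = D := by ext <;> rfl
  refine exists_analytic_chart (F := fun x => (S x, t x)) (F' := F') (hS.prod ht) ?_ hU
  rw [hF']
  exact hS.differentiableAt.hasFDerivAt.prodMk ht.differentiableAt.hasFDerivAt

/-- The inverse function theorem for a holomorphic function. -/
theorem exists_holomorphic_inverse {H : ℂ → ℂ} {s : ℂ} (hH : AnalyticAt ℂ H s)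
    (hd : deriv H s ≠ 0) :
    ∃ G : ℂ → ℂ, AnalyticAt ℂ G (H s) ∧ G (H s) = s ∧ (∀ᶠ z in 𝓝 s, G (H z) = z) ∧
      ∀ᶠ z in 𝓝 (H s), H (G z) = z := by
  let i : ℂ ≃L[ℂ] ℂ := .unitsEquivAut ℂ (.mk0 _ hd)
  have hi : HasFDerivAt H (i : ℂ →L[ℂ] ℂ) s := by
    refine hH.differentiableAt.hasDerivAt.hasFDerivAt.congr_fderiv ?_
    ext; simp [i]
  obtain ⟨e, hs, -, he, -, hG⟩ := exists_analytic_chart hH hi univ_mem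
  have hs' : H s ∈ e.target := by rw [← he]; exact e.map_source hs
  refine ⟨e.symm, hG _ hs', ?_, ?_, ?_⟩
  · rw [← he]; exact e.left_inv hs
  · filter_upwards [e.open_source.mem_nhds hs] with z hz
    rw [← he]; exact e.left_inv hz
  · filter_upwards [e.open_target.mem_nhds hs'] with z hz
    rw [← he]; exact e.right_inv hz

/-- A function vanishing for `y = 0` whose derivative in `y` is `y ^ m * w` is divisible
by `y ^ (m + 1)`. -/
theorem exists_factor_pow {T w : ℝ × ℝ → ℝ} {s₀ : ℝ} {m : ℕ} (hT : AnalyticAt ℝ T (s₀, 0))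
    (hw : AnalyticAt ℝ w (s₀, 0)) (h0 : ∀ᶠ s in 𝓝 s₀, T (s, 0) = 0)
    (hd : ∀ᶠ x in 𝓝 (s₀, (0 : ℝ)), fderiv ℝ T x (0, 1) = w x * x.2 ^ m) :
    ∃ V : ℝ × ℝ → ℝ, AnalyticAt ℝ V (s₀, 0) ∧ V (s₀, 0) = w (s₀, 0) / (m + 1) ∧
      ∀ᶠ x in 𝓝 (s₀, (0 : ℝ)), T x = x.2 ^ (m + 1) * V x := by
  let A : ℝ → ℝ × ℝ →L[ℝ] ℝ × ℝ := fun τ =>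
    (ContinuousLinearMap.fst ℝ ℝ ℝ).prod (τ • ContinuousLinearMap.snd ℝ ℝ ℝ)
  have hAc : Continuous A := by
    have : A = fun τ => (ContinuousLinearMap.inl ℝ ℝ ℝ).comp (ContinuousLinearMap.fst ℝ ℝ ℝ) +
        τ • (ContinuousLinearMap.inr ℝ ℝ ℝ).comp (ContinuousLinearMap.snd ℝ ℝ ℝ) := by
      funext τ; ext <;> simp [A]
    rw [this]; fun_prop
  have hAv : ∀ τ (v : ℝ × ℝ), A τ v = (v.1, τ * v.2) := fun τ v => rfl
  have hA1 : ∀ τ ∈ Icc (0 : ℝ) 1, ‖A τ‖ ≤ 1 := by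
    intro τ hτ
    refine ContinuousLinearMap.opNorm_le_bound _ zero_le_one fun v => ?_
    rw [hAv, one_mul, Prod.norm_def, Prod.norm_def, norm_mul, Real.norm_of_nonneg hτ.1]
    exact max_le_max le_rfl (mul_le_of_le_one_left (norm_nonneg _) hτ.2)
  let f : ℝ × ℝ → ℝ := fun v => w ((s₀, 0) + v)
  have hf : AnalyticAt ℝ f 0 := by
    apply AnalyticAt.fun_comp (g := w) (f := fun v : ℝ × ℝ => (s₀, 0) + v)
    · simpa using hw
    · exact analyticAt_const.add analyticAt_id
  have hV0 := analyticAt_intervalIntegral_comp hf hAc hA1 (a := fun τ => τ ^ m) (by fun_prop)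
    (fun τ hτ => by
      rw [norm_pow, Real.norm_of_nonneg hτ.1]; exact pow_le_one₀ hτ.1 hτ.2)
  -- Hadamard's formula: integrating `d/dτ T (s, τ y) = y ^ (m + 1) τ ^ m w (s, τ y)` over `[0, 1]`
  -- gives `T = y ^ (m + 1) V`, and the integral of `τ ^ m` explains the value `w / (m + 1)` on the
  -- axis.
  let V : ℝ × ℝ → ℝ := fun x => ∫ τ in (0 : ℝ)..1, τ ^ m * w (x.1, τ * x.2)
  have hV : AnalyticAt ℝ V (s₀, 0) := by
    have h1 : AnalyticAt ℝ (fun v => ∫ τ in (0 : ℝ)..1, τ ^ m • f (A τ v))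
        ((s₀, (0 : ℝ)) - (s₀, 0)) := by simpa using hV0
    have h2 := AnalyticAt.fun_comp (f := fun x : ℝ × ℝ => x - (s₀, (0 : ℝ))) h1
      (analyticAt_id.sub analyticAt_const)
    refine h2.congr (Eventually.of_forall fun x => ?_)
    simp [V, f, hAv]
  refine ⟨V, hV, ?_, ?_⟩
  · simp only [V, mul_zero]
    rw [intervalIntegral.integral_mul_const, integral_pow]
    simp
    ring
  · have hfst : Tendsto (fun x : ℝ × ℝ => x.1) (𝓝 (s₀, 0)) (𝓝 s₀) := continuousAt_fst
    obtain ⟨r, hr, hb⟩ := Metric.eventually_nhds_iff_ball.1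
      (((hd.and hT.eventually_analyticAt).and hw.eventually_analyticAt).and (hfst.eventually h0))
    filter_upwards [Metric.ball_mem_nhds _ hr] with x hx
    have hin : ∀ τ ∈ uIcc (0 : ℝ) 1, (x.1, τ * x.2) ∈ Metric.ball (s₀, (0 : ℝ)) r := by
      intro τ hτ
      rw [uIcc_of_le zero_le_one] at hτ
      rw [Metric.mem_ball, dist_eq_norm] at hx ⊢
      refine lt_of_le_of_lt ?_ hx
      rw [Prod.norm_def, Prod.norm_def]
      refine max_le_max le_rfl ?_
      simp only [Prod.snd_sub, sub_zero, norm_mul, Real.norm_of_nonneg hτ.1]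
      exact mul_le_of_le_one_left (norm_nonneg _) hτ.2
    have hder : ∀ τ ∈ uIcc (0 : ℝ) 1, HasDerivAt (fun τ => T (x.1, τ * x.2))
        (x.2 ^ (m + 1) * (τ ^ m * w (x.1, τ * x.2))) τ := by
      intro τ hτ
      obtain ⟨⟨⟨h1, h2⟩, h3⟩, h4⟩ := hb _ (hin τ hτ)
      have h5 : HasDerivAt (fun τ : ℝ => (x.1, τ * x.2)) (0, x.2) τ := by
        simpa using (hasDerivAt_const τ x.1).prodMk ((hasDerivAt_id τ).mul_const x.2)
      have h6 := h2.differentiableAt.hasFDerivAt.comp_hasDerivAt τ h5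
      refine h6.congr_deriv ?_
      have : ((0 : ℝ), x.2) = x.2 • ((0 : ℝ), (1 : ℝ)) := by simp
      rw [this, map_smul, h1, smul_eq_mul]
      ring
    have hcont : ContinuousOn (fun τ => x.2 ^ (m + 1) * (τ ^ m * w (x.1, τ * x.2)))
        (uIcc 0 1) := by
      intro τ hτ
      have h3 := (hb _ (hin τ hτ)).1.2.continuousAt
      have h4 : ContinuousAt (fun τ : ℝ => w (x.1, τ * x.2)) τ :=
        ContinuousAt.comp' (g := w) (f := fun τ : ℝ => (x.1, τ * x.2)) h3
          (by fun_prop)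
      exact ((continuousAt_const.mul ((continuousAt_id.pow m).mul h4))).continuousWithinAt
    have key := intervalIntegral.integral_eq_sub_of_hasDerivAt hder hcont.intervalIntegrable
    rw [intervalIntegral.integral_const_mul] at key
    have h7 := (hb x hx).2
    simp only [one_mul, zero_mul, h7, sub_zero] at key
    exact key.symm

theorem fderiv_re_apply {f : ℝ × ℝ → ℂ} {p : ℝ × ℝ} (hf : DifferentiableAt ℝ f p) (v : ℝ × ℝ) :
    fderiv ℝ (fun x => (f x).re) p v = (fderiv ℝ f p v).re := by
  have := (Complex.reCLM.hasFDerivAt.comp p hf.hasFDerivAt).fderiv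
  exact congrArg (fun l => l v) this

theorem fderiv_im_apply {f : ℝ × ℝ → ℂ} {p : ℝ × ℝ} (hf : DifferentiableAt ℝ f p) (v : ℝ × ℝ) :
    fderiv ℝ (fun x => (f x).im) p v = (fderiv ℝ f p v).im := by
  have := (Complex.imCLM.hasFDerivAt.comp p hf.hasFDerivAt).fderiv
  exact congrArg (fun l => l v) this

theorem fderiv_ofReal_apply {f : ℝ × ℝ → ℝ} {p : ℝ × ℝ} (hf : DifferentiableAt ℝ f p)
    (v : ℝ × ℝ) : fderiv ℝ (fun x => (f x : ℂ)) p v = (fderiv ℝ f p v : ℂ) := by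
  have := (Complex.ofRealCLM.hasFDerivAt.comp p hf.hasFDerivAt).fderiv
  exact congrArg (fun l => l v) this

theorem hasFDerivAt_holomorphic_comp {E : Type*} [NormedAddCommGroup E] [NormedSpace ℝ E]
    {H : ℂ → ℂ} {f : E → ℂ} {p : E} (hH : DifferentiableAt ℂ H (f p))
    (hf : DifferentiableAt ℝ f p) :
    HasFDerivAt (fun x => H (f x)) (deriv H (f p) • fderiv ℝ f p) p := by
  have h1 := (hH.hasDerivAt.hasFDerivAt.restrictScalars ℝ).comp p hf.hasFDerivAt
  refine h1.congr_fderiv ?_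
  ext v
  simp [mul_comm]

theorem fderiv_holomorphic_comp_apply {E : Type*} [NormedAddCommGroup E] [NormedSpace ℝ E]
    {H : ℂ → ℂ} {f : E → ℂ} {p : E} (hH : DifferentiableAt ℂ H (f p))
    (hf : DifferentiableAt ℝ f p) (v : E) :
    fderiv ℝ (fun x => H (f x)) p v = deriv H (f p) * fderiv ℝ f p v := by
  rw [(hasFDerivAt_holomorphic_comp hH hf).fderiv]; rfl

end Plane

/-! ### The normal form near one transversal point -/

section LocalNormalForm

/-- The characteristic set of `Z` is near `p` the regular curve `y = 0`, taken with multiplicity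
`k - 1 ≥ 1`, and the vector field of `Z` is transversal to it. -/
def IsTransversalAt (Z : ℝ × ℝ → ℂ) (k : ℕ) (p : ℝ × ℝ) : Prop :=
  2 ≤ k ∧ ∃ y u : ℝ × ℝ → ℝ, AnalyticAt ℝ y p ∧ AnalyticAt ℝ u p ∧ y p = 0 ∧ u p ≠ 0 ∧
    (∀ᶠ x in 𝓝 p, (vectorFieldOf Z).charFun x = u x * y x ^ (k - 1)) ∧
    (vectorFieldOf Z).apply (fun x => (y x : ℂ)) p ≠ 0

theorem charFun_vectorFieldOf (Z : ℝ × ℝ → ℂ) (x : ℝ × ℝ) :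
    (vectorFieldOf Z).charFun x = (pdx Z x).im * (pdy Z x).re - (pdx Z x).re * (pdy Z x).im := by
  simp [CVectorField.charFun, vectorFieldOf]
  ring

theorem apply_vectorFieldOf_ofReal (Z : ℝ × ℝ → ℂ) {y : ℝ × ℝ → ℝ} {p : ℝ × ℝ}
    (hy : DifferentiableAt ℝ y p) :
    (vectorFieldOf Z).apply (fun x => (y x : ℂ)) p =
      pdx Z p * (fderiv ℝ y p (0, 1) : ℝ) - pdy Z p * (fderiv ℝ y p (1, 0) : ℝ) := by
  simp only [CVectorField.apply, vectorFieldOf, pdx, pdy, fderiv_ofReal_apply hy]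
  ring

theorem analyticAt_fderiv_apply {E G : Type*} [NormedAddCommGroup E] [NormedSpace ℝ E]
    [NormedAddCommGroup G] [NormedSpace ℝ G] [CompleteSpace G] {f : E → G} {p : E}
    (hf : AnalyticAt ℝ f p) (v : E) : AnalyticAt ℝ (fun x => fderiv ℝ f x v) p :=
  ((ContinuousLinearMap.apply ℝ G v).analyticAt _).comp hf.fderiv

theorem analyticAt_re {E : Type*} [NormedAddCommGroup E] [NormedSpace ℝ E] {f : E → ℂ} {p : E}
    (hf : AnalyticAt ℝ f p) : AnalyticAt ℝ (fun x => (f x).re) p :=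
  (Complex.reCLM.analyticAt _).comp hf

theorem analyticAt_im {E : Type*} [NormedAddCommGroup E] [NormedSpace ℝ E] {f : E → ℂ} {p : E}
    (hf : AnalyticAt ℝ f p) : AnalyticAt ℝ (fun x => (f x).im) p :=
  (Complex.imCLM.analyticAt _).comp hf

theorem re_ofReal_add_I_mul (a b : ℝ) : ((a : ℂ) + Complex.I * (b : ℂ)).re = a := by simp

theorem im_ofReal_add_I_mul (a b : ℝ) : ((a : ℂ) + Complex.I * (b : ℂ)).im = b := by simp

/-- A nonvanishing analytic function is, up to sign, the `k`-th power of an analytic function. -/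
theorem exists_analytic_root {E : Type*} [NormedAddCommGroup E] [NormedSpace ℝ E] {V : E → ℝ}
    {q : E} (hV : AnalyticAt ℝ V q) (h0 : V q ≠ 0) {k : ℕ} (hk : k ≠ 0) :
    ∃ (ε : ℝ) (κ : E → ℝ), (ε = 1 ∨ ε = -1) ∧ AnalyticAt ℝ κ q ∧ κ q ≠ 0 ∧
      ∀ᶠ x in 𝓝 q, V x = ε * κ x ^ k := by
  obtain ⟨ε, hε, hpos⟩ : ∃ ε : ℝ, (ε = 1 ∨ ε = -1) ∧ 0 < ε * V q := by
    rcases lt_or_gt_of_ne h0 with h | h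
    · exact ⟨-1, Or.inr rfl, by linarith⟩
    · exact ⟨1, Or.inl rfl, by linarith⟩
  have hεε : ε * ε = 1 := by rcases hε with rfl | rfl <;> norm_num
  have hεV : AnalyticAt ℝ (fun x => ε * V x) q := analyticAt_const.mul hV
  refine ⟨ε, fun x => Real.exp (Real.log (ε * V x) / k), hε, ?_, (Real.exp_pos _).ne', ?_⟩
  · exact ((((hεV.contDiffAt (n := ω)).log hpos.ne').div_const _).exp).analyticAt
  · filter_upwards [hεV.continuousAt.eventually (lt_mem_nhds hpos)] with x hx
    rw [← Real.exp_nat_mul, mul_div_cancel₀ _ (Nat.cast_ne_zero.2 hk), Real.exp_log hx, ← mul_assoc,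
      hεε, one_mul]

/-- Near a transversal point of the characteristic curve, `Z` is equivalent to `s + i t ^ k`
through a biholomorphism `H` that straightens the image of this curve. -/
theorem exists_local_normalForm {O : Set (ℝ × ℝ)} {Z : ℝ × ℝ → ℂ} {k : ℕ} {p : ℝ × ℝ}
    (hO : IsOpen O) (hZ : AnalyticOnNhd ℝ Z O) (hinj : InjOn Z O) (hp : p ∈ O)
    (htr : IsTransversalAt Z k p) {H : ℂ → ℂ} {s₀ : ℝ} (hH : AnalyticAt ℂ H s₀)
    (hd : deriv H s₀ ≠ 0) {ρ : ℝ × ℝ → ℝ} (hρ : ContinuousAt ρ p) (hρ0 : ρ p = s₀)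
    (hρZ : ∀ᶠ x in 𝓝 p, (vectorFieldOf Z).charFun x = 0 → Z x = H (ρ x)) :
    Odd k ∧ ∃ e : OpenPartialHomeomorph (ℝ × ℝ) (ℝ × ℝ), p ∈ e.source ∧ e p = (s₀, 0) ∧
      e.source ⊆ O ∧ AnalyticOnNhd ℝ e e.source ∧ AnalyticOnNhd ℝ e.symm e.target ∧
      ∀ x ∈ e.source, Z x = H (arcNormalForm k (e x)) := by
  obtain ⟨hk, y, u, hy, hu, hy0, hu0, hc, hL⟩ := htr
  have hk1 : k - 1 ≠ 0 := by omega
  have hZp := hZ p hp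
  have hcp : (vectorFieldOf Z).charFun p = 0 := by rw [hc.self_of_nhds, hy0, zero_pow hk1, mul_zero]
  have hZs : Z p = H s₀ := by rw [hρZ.self_of_nhds hcp, hρ0]
  obtain ⟨G, hG, hGs, hGH, hHG⟩ := exists_holomorphic_inverse hH hd
  rw [← hZs] at hG hGs hHG
  have hG' : deriv G (Z p) ≠ 0 := by
    have h1 : HasDerivAt (fun z => G (H z)) (deriv G (Z p) * deriv H s₀) s₀ := by
      rw [hZs] at hG ⊢
      exact hG.differentiableAt.hasDerivAt.comp (s₀ : ℂ) hH.differentiableAt.hasDerivAt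
    have h2 : HasDerivAt (fun z : ℂ => z) (deriv G (Z p) * deriv H s₀) s₀ :=
      h1.congr_of_eventuallyEq (hGH.mono fun z hz => hz.symm)
    intro h0
    rw [h0, zero_mul] at h2
    exact zero_ne_one (h2.unique (hasDerivAt_id _))
  let W : ℝ × ℝ → ℂ := fun x => G (Z x)
  have hW : AnalyticAt ℝ W p := (hG.restrictScalars (𝕜 := ℝ)).comp hZp
  let S : ℝ × ℝ → ℝ := fun x => (W x).re
  let T : ℝ × ℝ → ℝ := fun x => (W x).im
  have hS : AnalyticAt ℝ S p := analyticAt_re hW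
  have hT : AnalyticAt ℝ T p := analyticAt_im hW
  have hSp : S p = s₀ := by simp [S, W, hGs]
  have hTy : ∀ᶠ x in 𝓝 p, y x = 0 → T x = 0 := by
    have h1 : Tendsto (fun x => (ρ x : ℂ)) (𝓝 p) (𝓝 s₀) := by
      have := (Complex.continuous_ofReal.continuousAt.comp hρ).tendsto
      simpa [Function.comp_def, hρ0] using this
    filter_upwards [h1.eventually hGH, hρZ, hc] with x h2 h3 h4 h5
    have h6 : Z x = H (ρ x) := h3 (by rw [h4, h5, zero_pow hk1, mul_zero])
    simp only [T, W, h6, h2, Complex.ofReal_im]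
  have hLy := apply_vectorFieldOf_ofReal Z hy.differentiableAt
  rw [hLy] at hL
  -- `T` is constant on the level set `y = 0`, so Lagrange multipliers make `dT` a multiple of `dy`
  -- at `p`; here `dy ≠ 0` because `L y ≠ 0`.
  obtain ⟨μ, hμ⟩ : ∃ μ : ℝ, ∀ v, fderiv ℝ T p v = μ * fderiv ℝ y p v := by
    have hext : IsLocalExtrOn T {x | y x = y p} p := by
      left
      filter_upwards [hTy.filter_mono nhdsWithin_le_nhds, self_mem_nhdsWithin] with x h1 h2
      rw [hTy.self_of_nhds hy0, h1 (by rw [← hy0]; exact h2)]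
    obtain ⟨a, b, hab, h⟩ := hext.exists_multipliers_of_hasStrictFDerivAt_1d
      hy.hasStrictFDerivAt hT.hasStrictFDerivAt
    have h' : ∀ v, a * fderiv ℝ y p v + b * fderiv ℝ T p v = 0 := fun v =>
      congrArg (fun l => l v) h
    have hb : b ≠ 0 := by
      rintro rfl
      have ha : a ≠ 0 := fun ha => hab (by rw [ha]; rfl)
      have h1 : ∀ v, fderiv ℝ y p v = 0 := fun v => by
        have := h' v
        rw [zero_mul, add_zero] at this
        exact (mul_eq_zero.1 this).resolve_left ha
      apply hL
      rw [h1, h1]; simp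
    refine ⟨-a / b, fun v => ?_⟩
    field_simp
    linarith [h' v]
  have hWd : ∀ᶠ x in 𝓝 p, ∀ v, fderiv ℝ W x v = deriv G (Z x) * fderiv ℝ Z x v := by
    filter_upwards [hZp.continuousAt.eventually hG.eventually_analyticAt,
      hZp.eventually_analyticAt] with x h1 h2 v
    exact fderiv_holomorphic_comp_apply h1.differentiableAt h2.differentiableAt v
  let J : ℝ × ℝ → ℝ := fun x =>
    fderiv ℝ S x (1, 0) * fderiv ℝ y x (0, 1) - fderiv ℝ S x (0, 1) * fderiv ℝ y x (1, 0)
  -- `G' (Z) L y` is the coefficient of `dW ∧ dy = dS ∧ dy + i dT ∧ dy`. Its imaginary part vanishes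
  -- at `p` because `dT = μ dy`, so `J p = 0` would force `L y = 0`. Hence `(S, y)` are coordinates.
  have hJ : J p ≠ 0 := by
    intro h0
    apply hL
    apply (mul_eq_zero.1 (?_ : deriv G (Z p) * _ = 0)).resolve_left hG'
    have e1 := hWd.self_of_nhds (1, 0)
    have e2 := hWd.self_of_nhds (0, 1)
    have h1 : deriv G (Z p) * (pdx Z p * (fderiv ℝ y p (0, 1) : ℝ) -
        pdy Z p * (fderiv ℝ y p (1, 0) : ℝ)) = fderiv ℝ W p (1, 0) * (fderiv ℝ y p (0, 1) : ℝ) -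
        fderiv ℝ W p (0, 1) * (fderiv ℝ y p (1, 0) : ℝ) := by
      rw [e1, e2]; simp only [pdx, pdy]; ring
    rw [h1]
    apply Complex.ext
    · simp only [Complex.sub_re, Complex.mul_re, Complex.ofReal_re, Complex.ofReal_im, mul_zero,
        sub_zero, Complex.zero_re, ← fderiv_re_apply hW.differentiableAt]
      exact h0
    · simp only [Complex.sub_im, Complex.mul_im, Complex.ofReal_re, Complex.ofReal_im, mul_zero,
        zero_add, Complex.zero_im, ← fderiv_im_apply hW.differentiableAt]
      change fderiv ℝ T p (1, 0) * _ - fderiv ℝ T p (0, 1) * _ = 0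
      rw [hμ, hμ]; ring
  have hJan : AnalyticAt ℝ J p :=
    ((analyticAt_fderiv_apply hS _).mul (analyticAt_fderiv_apply hy _)).sub
      ((analyticAt_fderiv_apply hS _).mul (analyticAt_fderiv_apply hy _))
  obtain ⟨e₁, hp₁, -, he₁, han₁, han₁'⟩ := exists_plane_chart hS hy hJ univ_mem
  have he₁p : e₁ p = (s₀, 0) := by rw [he₁, hSp, hy0]
  have htgt : (s₀, (0 : ℝ)) ∈ e₁.target := by rw [← he₁p]; exact e₁.map_source hp₁
  have hsymm : e₁.symm (s₀, 0) = p := by rw [← he₁p]; exact e₁.left_inv hp₁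
  have hsan : AnalyticAt ℝ e₁.symm (s₀, 0) := han₁' _ htgt
  have hstend : Tendsto e₁.symm (𝓝 (s₀, 0)) (𝓝 p) := by
    have := hsan.continuousAt.tendsto
    rwa [hsymm] at this
  have hetend : Tendsto e₁ (𝓝 p) (𝓝 (s₀, 0)) := by
    have := (han₁ p hp₁).continuousAt.tendsto
    rwa [he₁p] at this
  let g : ℝ × ℝ → ℝ := fun x => Complex.normSq (deriv G (Z x))
  have hg : AnalyticAt ℝ g p := by
    have h1 : AnalyticAt ℝ (fun x => deriv G (Z x)) p :=
      (hG.deriv.restrictScalars (𝕜 := ℝ)).comp hZp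
    exact ((analyticAt_re h1).mul (analyticAt_re h1)).add ((analyticAt_im h1).mul (analyticAt_im h1))
  -- `G` is holomorphic, so `dS ∧ dT` has coefficient `-|G'|²` times the characteristic function. It
  -- also equals `∂T/∂y` times `J` in the coordinates `(S, y)`, whence `∂T/∂y = w y ^ (k - 1)`.
  let w : ℝ × ℝ → ℝ := fun x => -(g x * u x) / J x
  have hw : AnalyticAt ℝ w p := ((hg.mul hu).neg).div hJan hJ
  have hw0 : w p ≠ 0 :=
    div_ne_zero (neg_ne_zero.2 (mul_ne_zero (by simpa [g] using hG') hu0)) hJ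
  have hTs : AnalyticAt ℝ (fun z => T (e₁.symm z)) (s₀, 0) := by
    apply AnalyticAt.fun_comp _ hsan
    rwa [hsymm]
  have hws : AnalyticAt ℝ (fun z => w (e₁.symm z)) (s₀, 0) := by
    apply AnalyticAt.fun_comp _ hsan
    rwa [hsymm]
  have hkey : ∀ᶠ x in 𝓝 p,
      fderiv ℝ (fun z => T (e₁.symm z)) (e₁ x) (0, 1) = w x * y x ^ (k - 1) := by
    filter_upwards [hWd, hc, hS.eventually_analyticAt, hy.eventually_analyticAt,
      hetend.eventually hTs.eventually_analyticAt, e₁.open_source.mem_nhds hp₁,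
      hW.eventually_analyticAt, hJan.continuousAt.eventually_ne hJ] with
      x hWx hcx hSx hyx hTx hxs hWax hJx
    have hf : HasFDerivAt e₁ ((fderiv ℝ S x).prod (fderiv ℝ y x)) x := by
      have h1 := hSx.differentiableAt.hasFDerivAt.prodMk hyx.differentiableAt.hasFDerivAt
      exact h1.congr_of_eventuallyEq (Eventually.of_forall he₁)
    have h2 := hTx.differentiableAt.hasFDerivAt.comp x hf
    have h3 : T =ᶠ[𝓝 x] (fun z => T (e₁.symm z)) ∘ e₁ := by
      filter_upwards [e₁.open_source.mem_nhds hxs] with x' hx'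
      simp [e₁.left_inv hx']
    have h4 := (h2.congr_of_eventuallyEq h3).fderiv
    set D := fderiv ℝ (fun z => T (e₁.symm z)) (e₁ x)
    have h5 : ∀ v, fderiv ℝ T x v = fderiv ℝ S x v * D (1, 0) + fderiv ℝ y x v * D (0, 1) := by
      intro v
      rw [h4]
      exact fderiv_plane_apply D _
    have h6 : J x * D (0, 1) = fderiv ℝ S x (1, 0) * fderiv ℝ T x (0, 1) -
        fderiv ℝ S x (0, 1) * fderiv ℝ T x (1, 0) := by
      rw [h5, h5]; simp only [J]; ring
    have h7 : fderiv ℝ S x (1, 0) * fderiv ℝ T x (0, 1) -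
        fderiv ℝ S x (0, 1) * fderiv ℝ T x (1, 0) = -(g x * (vectorFieldOf Z).charFun x) := by
      simp only [S, T, fderiv_re_apply hWax.differentiableAt, fderiv_im_apply hWax.differentiableAt,
        hWx, charFun_vectorFieldOf, pdx, pdy, g, Complex.normSq_apply, Complex.mul_re,
        Complex.mul_im]
      ring
    have h8 : J x * D (0, 1) = J x * (w x * y x ^ (k - 1)) := by
      rw [h6, h7, hcx]
      simp only [w]
      field_simp
    exact mul_left_cancel₀ hJx h8
  have hsec : ∀ᶠ z in 𝓝 (s₀, (0 : ℝ)), e₁ (e₁.symm z) = z := by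
    filter_upwards [e₁.open_target.mem_nhds htgt] with z hz using e₁.right_inv hz
  obtain ⟨V, hV, hV0, hTV⟩ := exists_factor_pow (m := k - 1) hTs hws
    (by
      have h1 : Tendsto (fun s : ℝ => (s, (0 : ℝ))) (𝓝 s₀) (𝓝 (s₀, 0)) :=
        (Continuous.prodMk_left 0).continuousAt
      filter_upwards [h1.eventually (hstend.eventually hTy), h1.eventually hsec] with s h2 h3
      apply h2
      rw [he₁] at h3
      exact congrArg Prod.snd h3)
    (by
      filter_upwards [hstend.eventually hkey, hsec] with z h2 h3
      rw [h3] at h2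
      rw [h2]
      rw [he₁] at h3
      rw [show y (e₁.symm z) = z.2 from congrArg Prod.snd h3])
  have hVne : V (s₀, 0) ≠ 0 := by
    rw [hV0, hsymm]
    exact div_ne_zero hw0 (by positivity)
  obtain ⟨ε, κ, hε, hκ, hκ0, hVκ⟩ := exists_analytic_root hV hVne (k := k) (by omega)
  have hε0 : ε ≠ 0 := by rcases hε with rfl | rfl <;> norm_num
  -- With `t = y ε κ` the factorization `T = ε y ^ k κ ^ k` becomes `T ε ^ k = ε t ^ k`, which is `T
  -- = t ^ k` once `ε ^ k = ε`, that is, for odd `k`.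
  let K : ℝ × ℝ → ℝ := fun x => ε * κ (e₁ x)
  have hK : AnalyticAt ℝ K p := by
    refine analyticAt_const.mul (AnalyticAt.fun_comp ?_ (han₁ p hp₁))
    rwa [he₁p]
  have hK0 : K p ≠ 0 := by
    simp only [K, he₁p]; exact mul_ne_zero hε0 hκ0
  let t : ℝ × ℝ → ℝ := fun x => y x * K x
  have ht : AnalyticAt ℝ t p := hy.mul hK
  have htp : t p = 0 := by simp [t, hy0]
  have hTt : ∀ᶠ x in 𝓝 p, T x * ε ^ k = ε * t x ^ k := by
    filter_upwards [hetend.eventually hTV, hetend.eventually hVκ, e₁.open_source.mem_nhds hp₁]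
      with x h1 h2 h3
    rw [e₁.left_inv h3, h2, Nat.sub_add_cancel (by omega)] at h1
    rw [h1, he₁]
    simp only [t, K, he₁, mul_pow]
    ring
  have htd : ∀ v, fderiv ℝ t p v = K p * fderiv ℝ y p v := by
    intro v
    have := (hy.differentiableAt.hasFDerivAt.mul hK.differentiableAt.hasFDerivAt).fderiv
    have h2 := congrArg (fun l => l v) this
    simp only [hy0, zero_smul, zero_add] at h2
    exact h2
  have hJt : fderiv ℝ S p (1, 0) * fderiv ℝ t p (0, 1) -
      fderiv ℝ S p (0, 1) * fderiv ℝ t p (1, 0) ≠ 0 := by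
    rw [htd, htd]
    have : K p * J p ≠ 0 := mul_ne_zero hK0 hJ
    intro h; apply this; rw [← h]; simp only [J]; ring
  have hU : ∀ᶠ x in 𝓝 p, x ∈ O ∧ T x * ε ^ k = ε * t x ^ k ∧ H (W x) = Z x := by
    filter_upwards [hO.mem_nhds hp, hTt, hZp.continuousAt.eventually hHG] with x h1 h2 h3
    exact ⟨h1, h2, h3⟩
  obtain ⟨e, hpe, heU, he, han, han'⟩ := exists_plane_chart hS ht hJt hU
  have hep : e p = (s₀, 0) := by rw [he, hSp, htp]
  -- For even `k` the points with coordinates `(s₀, ± r / 2)` have the same `W`, hence the same `Z`,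
  -- which contradicts injectivity.
  have hodd : Odd k := by
    rw [← Nat.not_even_iff_odd]
    intro hev
    have hεk : ε ^ k = 1 := by rcases hε with rfl | rfl <;> simp [hev.neg_pow]
    have htg : e.target ∈ 𝓝 (s₀, (0 : ℝ)) := by
      rw [← hep]; exact e.open_target.mem_nhds (e.map_source hpe)
    obtain ⟨r, hr, hb⟩ := Metric.mem_nhds_iff.1 htg
    have h1 : ∀ η : ℝ, |η| < r → (s₀, η) ∈ e.target := fun η hη => hb (by
      rw [Metric.mem_ball, dist_eq_norm, Prod.norm_def]
      simp [hη])
    have hr2 : |r / 2| < r := by rw [abs_of_pos (by positivity)]; linarith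
    have m1 := h1 (r / 2) hr2
    have m2 := h1 (-(r / 2)) (by rwa [abs_neg])
    have key : ∀ η, (s₀, η) ∈ e.target →
        W (e.symm (s₀, η)) = s₀ + Complex.I * (ε * η ^ k : ℝ) := by
      intro η hη
      have h2 : (S (e.symm (s₀, η)), t (e.symm (s₀, η))) = (s₀, η) := by
        rw [← he]; exact e.right_inv hη
      have h3 := (heU (e.map_target hη)).2.1
      have h4 := congrArg Prod.snd h2
      have h5 := congrArg Prod.fst h2
      simp only at h4 h5
      rw [hεk, mul_one, h4] at h3
      apply Complex.ext
      · rw [re_ofReal_add_I_mul]; exact h5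
      · rw [im_ofReal_add_I_mul]; exact h3
    have hW2 : W (e.symm (s₀, r / 2)) = W (e.symm (s₀, -(r / 2))) := by
      rw [key _ m1, key _ m2, hev.neg_pow]
    have hZ2 := hinj (heU (e.map_target m1)).1 (heU (e.map_target m2)).1 (by
      rw [← (heU (e.map_target m1)).2.2, ← (heU (e.map_target m2)).2.2, hW2])
    have := congrArg Prod.snd (e.symm.injOn m1 m2 hZ2)
    simp only at this
    linarith
  refine ⟨hodd, e, hpe, hep, fun x hx => (heU hx).1, han, han', fun x hx => ?_⟩
  have hεk : ε ^ k = ε := by rcases hε with rfl | rfl <;> simp [hodd.neg_pow]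
  obtain ⟨-, h1, h2⟩ := heU hx
  rw [← h2]
  congr 1
  rw [hεk, mul_comm] at h1
  have h3 : T x = t x ^ k := mul_left_cancel₀ hε0 h1
  rw [arcNormalForm, he]
  rw [← Complex.ofReal_pow]
  apply Complex.ext
  · rw [re_ofReal_add_I_mul]
  · rw [im_ofReal_add_I_mul]; exact h3

end LocalNormalForm

/-! ### Holomorphic extension of the arc length parametrization -/

section UnitSpeed

theorem eventually_eq_of_hasDerivAt_zero {𝕜 E : Type*} [RCLike 𝕜] [NormedAddCommGroup E]
    [NormedSpace 𝕜 E] {f : 𝕜 → E} {a : 𝕜} (h : ∀ᶠ z in 𝓝 a, HasDerivAt f 0 z) :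
    ∀ᶠ z in 𝓝 a, f z = f a := by
  obtain ⟨r, hr, hb⟩ := Metric.eventually_nhds_iff_ball.1 h
  filter_upwards [Metric.ball_mem_nhds a hr] with z hz
  let : NormedSpace ℝ 𝕜 := NormedSpace.restrictScalars ℝ 𝕜 𝕜
  exact Metric.isOpen_ball.is_const_of_deriv_eq_zero (convex_ball a r).isPreconnected
    (fun x hx => (hb x hx).differentiableAt.differentiableWithinAt)
    (fun x hx => (hb x hx).deriv) hz (Metric.mem_ball_self hr)

theorem hasDerivAt_re {f : ℝ → ℂ} {f' : ℂ} {x : ℝ} (hf : HasDerivAt f f' x) :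
    HasDerivAt (fun x => (f x).re) f'.re x :=
  (Complex.reCLM.hasFDerivAt (x := f x)).comp_hasDerivAt x hf

theorem hasDerivAt_im {f : ℝ → ℂ} {f' : ℂ} {x : ℝ} (hf : HasDerivAt f f' x) :
    HasDerivAt (fun x => (f x).im) f'.im x :=
  (Complex.imCLM.hasFDerivAt (x := f x)).comp_hasDerivAt x hf

theorem tendsto_ofReal_nhds (a : ℝ) : Tendsto (fun x : ℝ => (x : ℂ)) (𝓝 a) (𝓝 (a : ℂ)) :=
  Complex.continuous_ofReal.continuousAt

/-- A regular analytic curve, extended holomorphically, parametrized by its arc length. -/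
theorem exists_unitSpeed {g : ℝ → ℂ} (hg : AnalyticAt ℝ g 0) (hd : deriv g 0 ≠ 0) :
    ∃ (h : ℂ → ℂ) (a : ℝ → ℝ), AnalyticAt ℂ h 0 ∧ (∀ᶠ x : ℝ in 𝓝 0, ‖deriv h x‖ = 1) ∧ a 0 = 0 ∧
      (∀ᶠ x in 𝓝 0, ContinuousAt a x) ∧ ∀ᶠ x in 𝓝 0, g x = h (a x) := by
  obtain ⟨h₀, hh₀, hgh₀⟩ := exists_complexification hg
  -- The speed `|g'|` is analytic because `g' ≠ 0`. A primitive `A` of its holomorphic extension is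
  -- real on the real axis and is the arc length there; the parametrization sought is `h₀ ∘ A⁻¹`.
  have hv : AnalyticAt ℝ (fun x => ((‖deriv g x‖ : ℝ) : ℂ)) 0 :=
    (Complex.ofRealCLM.analyticAt _).comp ((hg.deriv.contDiffAt (n := ω)).norm ℝ hd).analyticAt
  obtain ⟨v, hvan, hvv⟩ := exists_complexification hv
  obtain ⟨A, hA0, hAan, hAd⟩ := exists_primitive hvan
  have hreal := tendsto_ofReal_nhds 0
  have hAr : ∀ᶠ x : ℝ in 𝓝 0, HasDerivAt (fun x : ℝ => A x) (‖deriv g x‖ : ℝ) x := by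
    filter_upwards [hreal.eventually hAd, hvv] with x h1 h2
    rw [h2] at h1
    exact h1.comp_ofReal
  have him : ∀ᶠ x : ℝ in 𝓝 0, (A x).im = 0 := by
    have : ∀ᶠ x : ℝ in 𝓝 0, HasDerivAt (fun x : ℝ => (A x).im) 0 x := by
      filter_upwards [hAr] with x h1
      exact hasDerivAt_im h1
    filter_upwards [eventually_eq_of_hasDerivAt_zero this] with x hx
    rw [hx, hA0]; rfl
  let a : ℝ → ℝ := fun x => (A x).re
  have ha : ∀ᶠ x : ℝ in 𝓝 0, A x = a x := by
    filter_upwards [him] with x hx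
    exact Complex.ext rfl hx
  have ha0 : a 0 = 0 := by simp only [a]; rw [hA0]; rfl
  have hAan' : AnalyticAt ℝ a 0 := by
    have h1 : AnalyticAt ℝ (fun x : ℝ => A x) 0 :=
      AnalyticAt.fun_comp (f := fun x : ℝ => (x : ℂ)) (hAan.restrictScalars (𝕜 := ℝ))
        (Complex.ofRealCLM.analyticAt 0)
    exact analyticAt_re h1
  have hA'0 : HasDerivAt A (‖deriv g 0‖ : ℝ) 0 := by
    have h1 := hAd.self_of_nhds
    rwa [hvv.self_of_nhds] at h1
  have hne : ‖deriv g 0‖ ≠ 0 := norm_ne_zero_iff.2 hd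
  have hAd0 : deriv A (0 : ℝ) ≠ 0 := by
    rw [Complex.ofReal_zero, hA'0.deriv]; exact_mod_cast hne
  obtain ⟨B, hB, hB0, hBA, -⟩ := exists_holomorphic_inverse hAan hAd0
  rw [hA0] at hB hB0
  let h : ℂ → ℂ := fun z => h₀ (B z)
  have hh : AnalyticAt ℂ h 0 := by
    apply AnalyticAt.fun_comp _ hB
    rwa [hB0]
  have hhA : ∀ᶠ z in 𝓝 ((0 : ℝ) : ℂ), h₀ z = h (A z) := hBA.mono fun z hz => by
    simp only [h, hz]
  refine ⟨h, a, hh, ?_, ha0, ?_, ?_⟩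
  · have hda : HasDerivAt a ‖deriv g 0‖ 0 := by
      have h1 : HasDerivAt (fun x : ℝ => A x) (‖deriv g 0‖ : ℝ) 0 := hAr.self_of_nhds
      exact hasDerivAt_re h1
    have hsd : HasStrictDerivAt a ‖deriv g 0‖ 0 := by
      have := hAan'.hasStrictDerivAt
      rwa [hda.deriv] at this
    -- As `a' (0) ≠ 0`, the values `a x` fill a neighborhood of `0`, so the unit speed property need
    -- only be checked at those points.
    have hmap : map a (𝓝 0) = 𝓝 0 := by
      have := hsd.map_nhds_eq hne
      rwa [ha0] at this
    rw [← hmap, eventually_map]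
    have hAt : Tendsto (fun x : ℝ => A x) (𝓝 0) (𝓝 0) := by
      have := hAan.continuousAt.tendsto.comp hreal
      rwa [hA0] at this
    have hgne : ∀ᶠ x in 𝓝 (0 : ℝ), deriv g x ≠ 0 := hg.deriv.continuousAt.eventually_ne hd
    filter_upwards [hreal.eventually hhA.eventually_nhds, hgh₀.eventually_nhds,
      hreal.eventually hAd, hvv, ha, hAt.eventually hh.eventually_analyticAt, hgne,
      hreal.eventually hh₀.eventually_analyticAt] with x h1 h2 h3 h4 h5 h6 h7 h8
    have e1 : HasDerivAt (fun z => h (A z)) (deriv h (A x) * v x) x :=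
      h6.differentiableAt.hasDerivAt.comp (x : ℂ) h3
    have e2 : HasDerivAt h₀ (deriv h (A x) * v x) x := e1.congr_of_eventuallyEq h1
    have e3 := e2.comp_ofReal.congr_of_eventuallyEq (h2.mono fun x hx => hx.symm)
    have e4 := congrArg norm e3.deriv
    rw [h4, norm_mul, Complex.norm_real, norm_norm, h5] at e4
    exact (mul_eq_right₀ (norm_ne_zero_iff.2 h7)).1 e4.symm
  · exact hAan'.eventually_analyticAt.mono fun x hx => hx.continuousAt
  · filter_upwards [hgh₀, hreal.eventually hhA, ha] with x h1 h2 h3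
    rw [← h1, h2, h3]

/-- Two unit speed parametrizations of the same curve differ by a translation. -/
theorem unitSpeed_unique {h₀ h₁ : ℂ → ℂ} {a₀ a₁ : ℝ} (han₀ : AnalyticAt ℂ h₀ a₀)
    (han₁ : AnalyticAt ℂ h₁ a₁) (hu₀ : ∀ᶠ x : ℝ in 𝓝 a₀, ‖deriv h₀ x‖ = 1)
    (hu₁ : ∀ᶠ x : ℝ in 𝓝 a₁, ‖deriv h₁ x‖ = 1) {I : Set ℝ} {τ : ℝ} (hτ : τ ∈ I)
    (hne : (𝓝[I \ {τ}] τ).NeBot) {r₀ r₁ : ℝ → ℝ} (h₀a : r₀ τ = a₀) (h₁a : r₁ τ = a₁)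
    (hc₀ : ContinuousWithinAt r₀ I τ) (hc₁ : ContinuousWithinAt r₁ I τ)
    (hm₀ : ∃ u ∈ 𝓝[I] τ, StrictMonoOn r₀ u) (hm₁ : ∃ u ∈ 𝓝[I] τ, StrictMonoOn r₁ u)
    (heq : ∀ᶠ t in 𝓝[I] τ, h₀ (r₀ t) = h₁ (r₁ t)) :
    (∀ᶠ z in 𝓝 (a₀ : ℂ), h₀ z = h₁ (z - a₀ + a₁)) ∧ ∀ᶠ t in 𝓝[I] τ, r₁ t = r₀ t - a₀ + a₁ := by
  have hd₁ : deriv h₁ a₁ ≠ 0 := by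
    rw [← norm_ne_zero_iff, hu₁.self_of_nhds]; exact one_ne_zero
  obtain ⟨G, hG, hGs, hGh, hhG⟩ := exists_holomorphic_inverse han₁ hd₁
  have hpt : h₀ a₀ = h₁ a₁ := by
    have := heq.self_of_nhdsWithin hτ
    rwa [h₀a, h₁a] at this
  rw [← hpt] at hG hGs hhG
  -- The transition `φ = h₁⁻¹ ∘ h₀` sends `r₀ t` to `r₁ t`. It is shown to be real on the real axis
  -- with derivative of modulus one, hence `±1`; monotonicity selects `+1`, and the identity theorem
  -- makes `φ` a translation.
  let φ : ℂ → ℂ := fun z => G (h₀ z)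
  have hφ : AnalyticAt ℂ φ a₀ := hG.comp han₀
  have hφa : φ a₀ = a₁ := hGs
  have ht₀ : Tendsto r₀ (𝓝[I] τ) (𝓝 a₀) := h₀a ▸ hc₀
  have ht₁ : Tendsto r₁ (𝓝[I] τ) (𝓝 a₁) := h₁a ▸ hc₁
  have hφr : ∀ᶠ t in 𝓝[I] τ, φ (r₀ t) = r₁ t := by
    filter_upwards [heq, ((tendsto_ofReal_nhds a₁).comp ht₁).eventually hGh] with t h1 h2
    simp only [φ, h1]
    exact h2
  have hle : 𝓝[I \ {τ}] τ ≤ 𝓝[I] τ := nhdsWithin_mono _ sdiff_subset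
  obtain ⟨u₀, hu₀I, hmono₀⟩ := hm₀
  obtain ⟨u₁, hu₁I, hmono₁⟩ := hm₁
  have hτ₀ : τ ∈ u₀ := mem_of_mem_nhdsWithin hτ hu₀I
  have hτ₁ : τ ∈ u₁ := mem_of_mem_nhdsWithin hτ hu₁I
  have hr₀ne : Tendsto r₀ (𝓝[I \ {τ}] τ) (𝓝[≠] a₀) := by
    refine tendsto_nhdsWithin_iff.2 ⟨ht₀.mono_left hle, ?_⟩
    filter_upwards [hle hu₀I, self_mem_nhdsWithin] with t h1 h2 h3
    exact h2.2 (hmono₀.injOn h1 hτ₀ (by rw [h₀a]; exact h3))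
  have hrealan : AnalyticAt ℝ (fun x : ℝ => φ x) a₀ :=
    AnalyticAt.fun_comp (f := fun x : ℝ => (x : ℂ)) (hφ.restrictScalars (𝕜 := ℝ))
      (Complex.ofRealCLM.analyticAt _)
  -- The points `r₀ t` with `t ≠ τ` accumulate at `a₀`, and `φ` is real at them; a real analytic
  -- function with accumulating zeros vanishes. One-sided neighborhoods of `τ` suffice, which covers
  -- end points.
  have him : ∀ᶠ x : ℝ in 𝓝 a₀, (φ x).im = 0 := by
    rw [← (analyticAt_im hrealan).frequently_zero_iff_eventually_zero]
    refine hr₀ne.frequently (Eventually.frequently ?_)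
    filter_upwards [hle hφr] with t h1
    rw [h1, Complex.ofReal_im]
  have hφt : Tendsto (fun x : ℝ => (φ x).re) (𝓝 a₀) (𝓝 a₁) := by
    have := (analyticAt_re hrealan).continuousAt.tendsto
    rwa [hφa, Complex.ofReal_re] at this
  have hφt' : Tendsto φ (𝓝 a₀) (𝓝 a₁) := by
    have := hφ.continuousAt.tendsto
    rwa [hφa] at this
  have hφh : ∀ᶠ z in 𝓝 (a₀ : ℂ), h₁ (φ z) = h₀ z := han₀.continuousAt.eventually hhG
  have hnorm : ∀ᶠ x : ℝ in 𝓝 a₀, ‖deriv φ x‖ = 1 := by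
    filter_upwards [(tendsto_ofReal_nhds a₀).eventually hφh.eventually_nhds, him,
      hφt.eventually hu₁, hu₀, (tendsto_ofReal_nhds a₀).eventually hφ.eventually_analyticAt,
      (tendsto_ofReal_nhds a₀).eventually (hφt'.eventually han₁.eventually_analyticAt)]
      with x h1 h2 h3 h4 h5 h6
    have e1 := (h6.differentiableAt.hasDerivAt.comp (x : ℂ)
      h5.differentiableAt.hasDerivAt).congr_of_eventuallyEq (h1.mono fun z hz => hz.symm)
    have e2 := congrArg norm e1.deriv
    have e3 : φ x = ((φ x).re : ℂ) := Complex.ext rfl h2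
    rw [h4, norm_mul, e3, h3, one_mul] at e2
    exact e2.symm
  have hφd : ∀ᶠ x : ℝ in 𝓝 a₀, HasDerivAt (fun x : ℝ => φ x) (deriv φ x) x := by
    filter_upwards [(tendsto_ofReal_nhds a₀).eventually hφ.eventually_analyticAt] with x h1
    exact h1.differentiableAt.hasDerivAt.comp_ofReal
  have hdim : ∀ᶠ x : ℝ in 𝓝 a₀, (deriv φ x).im = 0 := by
    filter_upwards [him.eventually_nhds, hφd] with x h1 h2
    have h3 : HasDerivAt (fun x : ℝ => (φ x).im) (deriv φ x).im x := by
      exact hasDerivAt_im h2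
    exact h3.unique ((hasDerivAt_const x (0 : ℝ)).congr_of_eventuallyEq h1)
  -- The difference quotients of `φ` at the points `r₀ t` are quotients of increments of two
  -- increasing functions.
  have hnn : 0 ≤ (deriv φ a₀).re := by
    have h3 : HasDerivAt (fun x : ℝ => (φ x).re) (deriv φ a₀).re a₀ := by
      exact hasDerivAt_re hφd.self_of_nhds
    have h4 := (hasDerivAt_iff_tendsto_slope.1 h3).comp hr₀ne
    refine ge_of_tendsto h4 ?_
    filter_upwards [hle hu₀I, hle hu₁I, hle hφr, self_mem_nhdsWithin] with t m0 m1 m2 m3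
    simp only [Function.comp, slope_def_field, m2, hφa, Complex.ofReal_re]
    rcases lt_or_gt_of_ne (show t ≠ τ from m3.2) with hlt | hlt
    · have l0 := hmono₀ m0 hτ₀ hlt
      have l1 := hmono₁ m1 hτ₁ hlt
      rw [h₀a] at l0; rw [h₁a] at l1
      exact div_nonneg_of_nonpos (by linarith) (by linarith)
    · have l0 := hmono₀ hτ₀ m0 hlt
      have l1 := hmono₁ hτ₁ m1 hlt
      rw [h₀a] at l0; rw [h₁a] at l1
      exact div_nonneg (by linarith) (by linarith)
  have habs : ∀ᶠ x : ℝ in 𝓝 a₀, |(deriv φ x).re| = 1 := by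
    filter_upwards [hnorm, hdim] with x h1 h2
    rw [← h1]
    exact Complex.abs_re_eq_norm.2 h2
  have hpos : 0 < (deriv φ a₀).re := by
    refine lt_of_le_of_ne hnn fun h => ?_
    have := habs.self_of_nhds
    rw [← h, abs_zero] at this
    exact zero_ne_one this
  have hcont : ContinuousAt (fun x : ℝ => (deriv φ x).re) a₀ :=
    Complex.continuous_re.continuousAt.comp
      (ContinuousAt.comp' (f := fun x : ℝ => (x : ℂ)) hφ.deriv.continuousAt
        (tendsto_ofReal_nhds a₀))
  have hone : ∀ᶠ x : ℝ in 𝓝 a₀, deriv φ x - 1 = 0 := by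
    filter_upwards [habs, hdim, hcont.eventually (lt_mem_nhds hpos)] with x h1 h2 h3
    rw [abs_of_pos h3] at h1
    rw [sub_eq_zero]
    exact Complex.ext h1 h2
  have hone' : ∀ᶠ z in 𝓝 (a₀ : ℂ), deriv φ z - 1 = 0 := by
    rw [← AnalyticAt.frequently_zero_iff_eventually_zero (hφ.deriv.fun_sub analyticAt_const)]
    have h1 : Tendsto (fun x : ℝ => (x : ℂ)) (𝓝[≠] a₀) (𝓝[≠] (a₀ : ℂ)) := by
      refine tendsto_nhdsWithin_iff.2 ⟨(tendsto_ofReal_nhds a₀).mono_left nhdsWithin_le_nhds, ?_⟩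
      filter_upwards [self_mem_nhdsWithin] with x hx
      exact fun h => hx (Complex.ofReal_injective h)
    exact h1.frequently (hone.filter_mono nhdsWithin_le_nhds).frequently
  have htrans : ∀ᶠ z in 𝓝 (a₀ : ℂ), φ z = z - a₀ + a₁ := by
    have h1 : ∀ᶠ z in 𝓝 (a₀ : ℂ), HasDerivAt (fun z => φ z - z) 0 z := by
      filter_upwards [hone', hφ.eventually_analyticAt] with z e1 e2
      rw [← e1]
      exact e2.differentiableAt.hasDerivAt.sub (hasDerivAt_id z)
    filter_upwards [eventually_eq_of_hasDerivAt_zero h1] with z hz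
    rw [hφa] at hz
    linear_combination hz
  refine ⟨?_, ?_⟩
  · filter_upwards [htrans, hφh] with z h1 h2
    rw [← h2, h1]
  · filter_upwards [hφr, ((tendsto_ofReal_nhds a₀).comp ht₀).eventually htrans] with t h1 h2
    have h3 : φ (r₀ t) = r₀ t - a₀ + a₁ := h2
    rw [h1] at h3
    exact_mod_cast h3

/-- The holomorphic function `H` maps a real interval around `s` with unit speed onto the image
under `Z` of the characteristic set of `Z` near `p`. -/
structure IsStraightening (Z : ℝ × ℝ → ℂ) (H : ℂ → ℂ) (s : ℝ) (p : ℝ × ℝ) : Prop where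
  analyticAt : AnalyticAt ℂ H s
  unitSpeed : ∀ᶠ x : ℝ in 𝓝 s, ‖deriv H x‖ = 1
  exists_parameter : ∃ ρ : ℝ × ℝ → ℝ, (∀ᶠ q in 𝓝 p, ContinuousAt ρ q) ∧ ρ p = s ∧
    ∀ᶠ q in 𝓝 p, (vectorFieldOf Z).charFun q = 0 → Z q = H (ρ q)

/-- Reversing the orientation is what later allows every local parameter to be taken increasing
along the curve. -/
theorem IsStraightening.neg {Z : ℝ × ℝ → ℂ} {H : ℂ → ℂ} {s : ℝ} {p : ℝ × ℝ}
    (h : IsStraightening Z H s p) : IsStraightening Z (fun z => H (-z)) (-s) p := by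
  obtain ⟨han, hu, ρ, hρ, hρp, hρZ⟩ := h
  refine ⟨?_, ?_, fun q => -ρ q, hρ.mono fun q hq => hq.neg, congrArg _ hρp, ?_⟩
  · apply AnalyticAt.fun_comp (f := fun z : ℂ => -z) _ analyticAt_id.neg
    simpa using han
  · have : Tendsto (fun x : ℝ => -x) (𝓝 (-s)) (𝓝 s) := by
      simpa using (continuous_neg (G := ℝ)).tendsto (-s)
    filter_upwards [this.eventually hu] with x hx
    rw [deriv_comp_neg, norm_neg]
    simpa using hx
  · filter_upwards [hρZ] with q hq h
    simpa using hq h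

theorem IsStraightening.translate {Z : ℝ × ℝ → ℂ} {H : ℂ → ℂ} {p : ℝ × ℝ}
    (h : IsStraightening Z H 0 p) (s : ℝ) : IsStraightening Z (fun z => H (z - s)) s p := by
  obtain ⟨han, hu, ρ, hρ, hρp, hρZ⟩ := h
  refine ⟨?_, ?_, fun q => ρ q + s, hρ.mono fun q hq => hq.add continuousAt_const, by
    simp [hρp], ?_⟩
  · apply AnalyticAt.fun_comp (f := fun z : ℂ => z - s) _ (analyticAt_id.sub analyticAt_const)
    simpa using han
  · have : Tendsto (fun x : ℝ => x - s) (𝓝 s) (𝓝 0) := by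
      simpa using (continuous_sub_right s).tendsto s
    filter_upwards [this.eventually hu] with x hx
    rw [deriv_comp_sub_const]
    simpa using hx
  · filter_upwards [hρZ] with q hq h
    simpa using hq h

theorem IsStraightening.congr {Z : ℝ × ℝ → ℂ} {H K : ℂ → ℂ} {s : ℝ} {p : ℝ × ℝ}
    (h : IsStraightening Z H s p) (hK : K =ᶠ[𝓝 (s : ℂ)] H) : IsStraightening Z K s p := by
  obtain ⟨han, hu, ρ, hρ, hρp, hρZ⟩ := h
  refine ⟨han.congr hK.symm, ?_, ρ, hρ, hρp, ?_⟩
  · filter_upwards [hu, (tendsto_ofReal_nhds s).eventually hK.deriv] with x h1 h2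
    rw [h2, h1]
  · have : Tendsto (fun q => (ρ q : ℂ)) (𝓝 p) (𝓝 s) := by
      rw [← hρp]
      exact (tendsto_ofReal_nhds _).comp hρ.self_of_nhds
    filter_upwards [hρZ, this.eventually hK] with q h1 h2 h3
    rw [h1 h3, h2]

theorem IsStraightening.deriv_ne_zero {Z : ℝ × ℝ → ℂ} {H : ℂ → ℂ} {s : ℝ} {p : ℝ × ℝ}
    (h : IsStraightening Z H s p) : deriv H s ≠ 0 := by
  rw [← norm_ne_zero_iff, h.unitSpeed.self_of_nhds]; exact one_ne_zero

/-- An analytic parametrization of a regular analytic curve `y = 0`. -/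
theorem exists_curve_parameter {y : ℝ × ℝ → ℝ} {p : ℝ × ℝ} (hy : AnalyticAt ℝ y p) (hy0 : y p = 0)
    (hd : fderiv ℝ y p ≠ 0) :
    ∃ (S : ℝ × ℝ → ℝ) (γ : ℝ → ℝ × ℝ), AnalyticAt ℝ S p ∧ S p = 0 ∧ AnalyticAt ℝ γ 0 ∧ γ 0 = p ∧
      (∀ᶠ ξ in 𝓝 0, S (γ ξ) = ξ ∧ y (γ ξ) = 0) ∧ ∀ᶠ x in 𝓝 p, y x = 0 → γ (S x) = x := by
  set a := fderiv ℝ y p (1, 0) with ha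
  set b := fderiv ℝ y p (0, 1) with hb
  have hab : b * b + a * a ≠ 0 := by
    intro h
    have h1 : b = 0 := by nlinarith [mul_self_nonneg a, mul_self_nonneg b]
    have h2 : a = 0 := by nlinarith [mul_self_nonneg a, mul_self_nonneg b]
    apply hd
    ext
    · simpa using h2
    · simpa using h1
  -- The differential of `l` is `dy (p)` rotated by a right angle, so the Jacobian of `(S, y)` at
  -- `p` is `a² + b²`.
  let l : ℝ × ℝ →L[ℝ] ℝ := b • ContinuousLinearMap.fst ℝ ℝ ℝ - a • ContinuousLinearMap.snd ℝ ℝ ℝ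
  let S : ℝ × ℝ → ℝ := fun x => l x - l p
  have hS : AnalyticAt ℝ S p := (l.analyticAt p).sub analyticAt_const
  have hSp : S p = 0 := sub_self _
  have hSd : ∀ v, fderiv ℝ S p v = l v := fun v => by
    have : HasFDerivAt S l p := l.hasFDerivAt.sub_const _
    rw [this.fderiv]
  obtain ⟨e, hpe, -, he, -, han'⟩ := exists_plane_chart hS hy (by
    rw [hSd, hSd, ← ha, ← hb, show l (1, 0) = b by simp [l], show l (0, 1) = -a by simp [l]]
    intro h; apply hab; linarith) univ_mem
  have hep : e p = (0, 0) := by rw [he, hy0, hSp]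
  have htgt : ((0 : ℝ), (0 : ℝ)) ∈ e.target := hep ▸ e.map_source hpe
  refine ⟨S, fun ξ => e.symm (ξ, 0), hS, hSp,
    AnalyticAt.fun_comp (f := fun ξ : ℝ => (ξ, (0 : ℝ))) (han' _ htgt)
      (analyticAt_id.prod analyticAt_const), (congrArg e.symm hep).symm.trans (e.left_inv hpe), ?_, ?_⟩
  · have h1 : Tendsto (fun ξ : ℝ => (ξ, (0 : ℝ))) (𝓝 0) (𝓝 (0, 0)) :=
      (Continuous.prodMk_left 0).continuousAt
    filter_upwards [h1.eventually (e.open_target.mem_nhds htgt)] with ξ hξ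
    have := e.right_inv hξ
    rw [he] at this
    exact ⟨congrArg Prod.fst this, congrArg Prod.snd this⟩
  · filter_upwards [e.open_source.mem_nhds hpe] with x hx hyx
    rw [← hyx, ← he, e.left_inv hx]

theorem IsTransversalAt.exists_isStraightening {Z : ℝ × ℝ → ℂ} {k : ℕ} {p : ℝ × ℝ}
    (hZ : AnalyticAt ℝ Z p) (htr : IsTransversalAt Z k p) :
    ∃ H, IsStraightening Z H 0 p := by
  obtain ⟨hk, y, u, hy, hu, hy0, hu0, hc, hL⟩ := htr
  rw [apply_vectorFieldOf_ofReal Z hy.differentiableAt] at hL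
  obtain ⟨S, γ, hS, hSp, hγ, hγ0, hsec, hret⟩ := exists_curve_parameter hy hy0
    (fun h => hL (by rw [h]; simp))
  let g : ℝ → ℂ := fun ξ => Z (γ ξ)
  have hg : AnalyticAt ℝ g 0 := by
    apply AnalyticAt.fun_comp _ hγ
    rwa [hγ0]
  have hγd : HasDerivAt γ (deriv γ 0) 0 := hγ.differentiableAt.hasDerivAt
  have hd1 : fderiv ℝ S p (deriv γ 0) = 1 := by
    have h1 := (hγ0 ▸ hS.differentiableAt.hasFDerivAt : HasFDerivAt S (fderiv ℝ S p) (γ 0))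
    have h2 := (h1.comp_hasDerivAt 0 hγd).congr_of_eventuallyEq (f₁ := fun ξ => ξ)
      (hsec.mono fun ξ hξ => hξ.1.symm)
    exact h2.unique (hasDerivAt_id 0)
  have hd2 : fderiv ℝ y p (deriv γ 0) = 0 := by
    have h1 := (hγ0 ▸ hy.differentiableAt.hasFDerivAt : HasFDerivAt y (fderiv ℝ y p) (γ 0))
    have h2 := (h1.comp_hasDerivAt 0 hγd).congr_of_eventuallyEq (f₁ := fun ξ => 0)
      (hsec.mono fun ξ hξ => hξ.2.symm)
    exact h2.unique (hasDerivAt_const 0 0)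
  have hgd : deriv g 0 = fderiv ℝ Z p (deriv γ 0) := by
    have h1 := (hγ0 ▸ hZ.differentiableAt.hasFDerivAt : HasFDerivAt Z (fderiv ℝ Z p) (γ 0))
    exact (h1.comp_hasDerivAt 0 hγd).deriv
  -- If `dZ` killed the tangent vector `γ' (0)`, which `dy` kills too, then `dZ ∧ dy ≠ 0` (that is,
  -- `L y ≠ 0`) would give `γ' (0) = 0`, against `dS (γ' (0)) = 1`.
  have hgne : deriv g 0 ≠ 0 := by
    intro h0
    rw [fderiv_plane_apply] at hd2
    rw [hgd, fderiv_plane_apply] at h0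
    simp only [smul_eq_mul, Complex.real_smul] at hd2 h0
    have hd2' : ((deriv γ 0).1 : ℂ) * (fderiv ℝ y p (1, 0) : ℝ) +
        (deriv γ 0).2 * (fderiv ℝ y p (0, 1) : ℝ) = 0 := by exact_mod_cast hd2
    have e1 : ((deriv γ 0).1 : ℂ) = 0 := by
      apply (mul_eq_zero.1 (?_ : _ * (_ : ℂ) = 0)).resolve_right hL
      simp only [pdx, pdy]
      linear_combination (fderiv ℝ y p (0, 1) : ℂ) * h0 - fderiv ℝ Z p (0, 1) * hd2'
    have e2 : ((deriv γ 0).2 : ℂ) = 0 := by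
      apply (mul_eq_zero.1 (?_ : _ * (_ : ℂ) = 0)).resolve_right hL
      simp only [pdx, pdy]
      linear_combination fderiv ℝ Z p (1, 0) * hd2' - (fderiv ℝ y p (1, 0) : ℂ) * h0
    have e3 : deriv γ 0 = 0 := Prod.ext (by exact_mod_cast e1) (by exact_mod_cast e2)
    rw [e3, map_zero] at hd1
    exact zero_ne_one hd1
  obtain ⟨h, α, hh, hunit, hα0, hαc, hαg⟩ := exists_unitSpeed hg hgne
  have hSt : Tendsto S (𝓝 p) (𝓝 0) := hSp ▸ hS.continuousAt.tendsto
  refine ⟨h, by simpa using hh, hunit, fun q => α (S q), ?_, ?_, ?_⟩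
  · filter_upwards [hSt.eventually hαc, hS.eventually_analyticAt] with q h1 h2
    exact ContinuousAt.comp' (g := α) (f := S) h1 h2.continuousAt
  · simp only [hSp, hα0]
  · filter_upwards [hc, hu.continuousAt.eventually_ne hu0, hSt.eventually hαg, hret]
      with q h1 h2 h3 h4 h5
    rw [h1] at h5
    have h6 : y q = 0 := by
      have := (mul_eq_zero.1 h5).resolve_left h2
      exact pow_eq_zero_iff (by omega) |>.1 this
    rw [← h3]
    simp only [g]
    rw [h4 h6]

end UnitSpeed

/-! ### Gluing local arc length parameters and holomorphic germs along an interval -/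

section Gluing

/-- Local functions on an interval that agree up to constants are, up to constants, the
restrictions of a single function. -/
theorem exists_glued_parameter {A B : ℝ} (hAB : A ≤ B) {r : ℝ → ℝ → ℝ}
    (hmono : ∀ x ∈ Icc A B, ∃ u ∈ 𝓝[Icc A B] x, StrictMonoOn (r x) u)
    (hcoh : ∀ x ∈ Icc A B, ∀ᶠ y in 𝓝[Icc A B] x, ∃ C, ∀ᶠ t in 𝓝[Icc A B] y, r y t = r x t + C) :
    ∃ σ : ℝ → ℝ, StrictMonoOn σ (Icc A B) ∧
      ∀ x ∈ Icc A B, ∃ C, ∀ᶠ t in 𝓝[Icc A B] x, σ t = r x t + C := by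
  let Q : Set ℝ → Prop := fun s => ∃ σ : ℝ → ℝ, StrictMonoOn σ s ∧
    ∀ x ∈ s, ∃ C, ∀ᶠ t in 𝓝[Icc A B] x, σ t = r x t + C
  have hQ : ∀ {s t}, s ⊆ t → Q t → Q s := fun hst ⟨σ, h1, h2⟩ =>
    ⟨σ, h1.mono hst, fun x hx => h2 x (hst hx)⟩
  -- Near the common end point both functions equal `r b` up to a constant, so adding `C₁ - C₂` to
  -- the second makes them match.
  have hglue : ∀ {a b c : ℝ}, a ≤ b → b ≤ c → b ∈ Icc A B → Q (Icc a b) → Q (Icc b c) →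
      Q (Icc a c) := by
    rintro a b c hab hbc hb ⟨σ₁, hm₁, h₁⟩ ⟨σ₂, hm₂, h₂⟩
    obtain ⟨C₁, hC₁⟩ := h₁ b ⟨hab, le_rfl⟩
    obtain ⟨C₂, hC₂⟩ := h₂ b ⟨le_rfl, hbc⟩
    have e₁ := hC₁.self_of_nhdsWithin hb
    have e₂ := hC₂.self_of_nhdsWithin hb
    let σ : ℝ → ℝ := fun t => if t ≤ b then σ₁ t else σ₂ t + (C₁ - C₂)
    have hl : ∀ t ≤ b, σ t = σ₁ t := fun t ht => if_pos ht
    have hr : ∀ t, b ≤ t → σ t = σ₂ t + (C₁ - C₂) := fun t ht => by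
      rcases ht.eq_or_lt with rfl | h
      · rw [hl _ le_rfl, e₁, e₂]; ring
      · exact if_neg (not_le.2 h)
    refine ⟨σ, ?_, fun x hx => ?_⟩
    · rw [← Icc_union_Icc_eq_Icc hab hbc]
      refine StrictMonoOn.union (c := b) ?_ ?_ (isGreatest_Icc hab) (isLeast_Icc hbc)
      · exact hm₁.congr fun t ht => (hl t ht.2).symm
      · intro s hs t ht hst
        rw [hr s hs.1, hr t ht.1]
        linarith [hm₂ hs ht hst]
    · rcases lt_trichotomy x b with hxb | rfl | hxb
      · obtain ⟨C, hC⟩ := h₁ x ⟨hx.1, hxb.le⟩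
        refine ⟨C, ?_⟩
        filter_upwards [hC, nhdsWithin_le_nhds (Iio_mem_nhds hxb)] with t ht htb
        rw [hl t (le_of_lt htb), ht]
      · refine ⟨C₁, ?_⟩
        filter_upwards [hC₁, hC₂] with t ht₁ ht₂
        rcases le_total t x with h | h
        · rw [hl t h, ht₁]
        · rw [hr t h, ht₂]; ring
      · obtain ⟨C, hC⟩ := h₂ x ⟨hxb.le, hx.2⟩
        refine ⟨C + (C₁ - C₂), ?_⟩
        filter_upwards [hC, nhdsWithin_le_nhds (Ioi_mem_nhds hxb)] with t ht htb
        rw [hr t (le_of_lt htb), ht]; ring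
  have hall : ∀ x ∈ Icc A B, ∀ y ∈ Icc A B, Q (uIcc x y) := by
    intro x hx y hy
    refine isPreconnected_Icc.induction₂ (fun a b => Q (uIcc a b)) ?_ ?_ ?_ hx hy
    · intro a ha
      obtain ⟨u, hu, hmu⟩ := hmono a ha
      obtain ⟨ε, hε, hb⟩ := Metric.mem_nhdsWithin_iff.1 (inter_mem hu (hcoh a ha))
      have hord : OrdConnected (Metric.ball a ε ∩ Icc A B) := by
        rw [Real.ball_eq_Ioo]; infer_instance
      filter_upwards [inter_mem (nhdsWithin_le_nhds (Metric.ball_mem_nhds a hε))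
        self_mem_nhdsWithin] with b hbb
      have hsub : uIcc a b ⊆ Metric.ball a ε ∩ Icc A B :=
        hord.uIcc_subset ⟨Metric.mem_ball_self hε, ha⟩ hbb
      refine ⟨r a, hmu.mono fun t ht => (hb (hsub ht)).1, fun t ht => ?_⟩
      obtain ⟨C, hC⟩ := (hb (hsub ht)).2
      exact ⟨-C, hC.mono fun s hs => by rw [hs]; ring⟩
    · intro a b c ha hb hc h1 h2
      rcases le_total a b with hab | hab <;> rcases le_total b c with hbc | hbc
      · rw [uIcc_of_le hab] at h1
        rw [uIcc_of_le hbc] at h2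
        rw [uIcc_of_le (hab.trans hbc)]
        exact hglue hab hbc hb h1 h2
      · rcases le_total a c with hac | hac
        · exact hQ (uIcc_subset_uIcc_left (by rw [uIcc_of_le hab]; exact ⟨hac, hbc⟩)) h1
        · exact hQ (uIcc_subset_uIcc_right (by rw [uIcc_of_ge hbc]; exact ⟨hac, hab⟩)) h2
      · rcases le_total a c with hac | hac
        · exact hQ (uIcc_subset_uIcc_right (by rw [uIcc_of_le hbc]; exact ⟨hab, hac⟩)) h2
        · exact hQ (uIcc_subset_uIcc_left (by rw [uIcc_of_ge hab]; exact ⟨hbc, hac⟩)) h1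
      · rw [uIcc_of_ge hab] at h1
        rw [uIcc_of_ge hbc] at h2
        rw [uIcc_of_ge (hbc.trans hab)]
        exact hglue hbc hab hb h2 h1
    · intro a b _ _ h
      rwa [uIcc_comm]
  have := hall A (left_mem_Icc.2 hAB) B (right_mem_Icc.2 hAB)
  rwa [uIcc_of_le hAB] at this

/-- Germs of holomorphic functions at the points of a real interval, which depend on the point
in a locally consistent way, are the germs of a single function. -/
theorem exists_glued_holomorphic {ι : Type*} [TopologicalSpace ι] {σ : ι → ℝ} (hσ : IsInducing σ)
    (hord : OrdConnected (range σ)) {K : ι → ℂ → ℂ} (han : ∀ i, AnalyticAt ℂ (K i) (σ i))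
    (hcoh : ∀ i, ∀ᶠ j in 𝓝 i, K j =ᶠ[𝓝 (σ j : ℂ)] K i) :
    ∃ H : ℂ → ℂ, ∀ i, H =ᶠ[𝓝 (σ i : ℂ)] K i := by
  have hR : ∀ i, ∃ R > 0, (∀ z ∈ Metric.ball (σ i : ℂ) R, AnalyticAt ℂ (K i) z) ∧
      ∀ j, |σ j - σ i| < R → K j =ᶠ[𝓝 (σ j : ℂ)] K i := by
    intro i
    obtain ⟨R₁, hR₁, h₁⟩ := Metric.eventually_nhds_iff_ball.1 (han i).eventually_analyticAt
    have h := hcoh i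
    rw [hσ.nhds_eq_comap] at h
    obtain ⟨R₂, hR₂, h₂⟩ := (Metric.nhds_basis_ball.comap σ).eventually_iff.1 h
    refine ⟨min R₁ R₂, lt_min hR₁ hR₂, fun z hz => h₁ z (Metric.ball_subset_ball (min_le_left _ _) hz),
      fun j hj => h₂ ?_⟩
    rw [mem_preimage, Metric.mem_ball, Real.dist_eq]
    exact lt_of_lt_of_le hj (min_le_right _ _)
  choose R hRpos hRan hRcoh using hR
  have hre : ∀ i z, z ∈ Metric.ball (σ i : ℂ) (R i) → |z.re - σ i| < R i := by
    intro i z hz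
    rw [Metric.mem_ball, dist_eq_norm] at hz
    refine lt_of_le_of_lt ?_ hz
    simpa using Complex.abs_re_le_norm (z - σ i)
  have hagree : ∀ i j z, z ∈ Metric.ball (σ i : ℂ) (R i) → z ∈ Metric.ball (σ j : ℂ) (R j) →
      K i z = K j z := by
    intro i j z hi hj
    have h1 := hre i z hi
    have h2 := hre j z hj
    -- The identity theorem needs one base point `σ m` in both balls. If `Re z` lies between the
    -- centres it is such a value, because the range of `σ` is an interval; otherwise the centre
    -- nearer to `Re z` works.
    obtain ⟨m, hm1, hm2⟩ : ∃ m, |σ m - σ i| < R i ∧ |σ m - σ j| < R j := by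
      by_cases hin : z.re ∈ uIcc (σ i) (σ j)
      · obtain ⟨m, hm⟩ := hord.uIcc_subset (mem_range_self i) (mem_range_self j) hin
        exact ⟨m, by rwa [hm], by rwa [hm]⟩
      · rw [mem_uIcc] at hin
        push Not at hin
        rw [abs_lt] at h1 h2
        by_cases hij : |z.re - σ i| ≤ |z.re - σ j|
        · refine ⟨i, by simpa using hRpos i, ?_⟩
          rw [abs_lt]
          rcases le_total (σ i) (σ j) with h | h
          · rcases le_total (σ i) z.re with h' | h'
            · have := hin.1 h'
              rw [abs_of_nonneg (by linarith), abs_of_nonneg (by linarith)] at hij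
              constructor <;> linarith
            · constructor <;> linarith
          · rcases le_total (σ j) z.re with h' | h'
            · have := hin.2 h'
              constructor <;> linarith
            · rw [abs_of_nonpos (by linarith), abs_of_nonpos (by linarith)] at hij
              constructor <;> linarith
        · push Not at hij
          refine ⟨j, ?_, by simpa using hRpos j⟩
          rw [abs_lt]
          rcases le_total (σ i) (σ j) with h | h
          · rcases le_total (σ i) z.re with h' | h'
            · have := hin.1 h'
              constructor <;> linarith
            · rw [abs_of_nonpos (by linarith), abs_of_nonpos (by linarith)] at hij
              constructor <;> linarith
          · rcases le_total (σ j) z.re with h' | h'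
            · have := hin.2 h'
              rw [abs_of_nonneg (by linarith), abs_of_nonneg (by linarith)] at hij
              constructor <;> linarith
            · constructor <;> linarith
    have hmem : ∀ l, |σ m - σ l| < R l → (σ m : ℂ) ∈ Metric.ball (σ l : ℂ) (R l) := by
      intro l hl
      rw [Metric.mem_ball, dist_eq_norm, ← Complex.ofReal_sub, Complex.norm_real]
      exact hl
    have hconv : IsPreconnected (Metric.ball (σ i : ℂ) (R i) ∩ Metric.ball (σ j : ℂ) (R j)) :=
      ((convex_ball _ _).inter (convex_ball _ _)).isPreconnected
    exact AnalyticOnNhd.eqOn_of_preconnected_of_eventuallyEq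
      (fun z hz => hRan i z hz.1) (fun z hz => hRan j z hz.2) hconv
      ⟨hmem i hm1, hmem j hm2⟩ ((hRcoh i m hm1).symm.trans (hRcoh j m hm2)) ⟨hi, hj⟩
  classical
  refine ⟨fun z => if h : ∃ i, z ∈ Metric.ball (σ i : ℂ) (R i) then K h.choose z else 0,
    fun i => ?_⟩
  filter_upwards [Metric.ball_mem_nhds (σ i : ℂ) (hRpos i)] with z hz
  have h : ∃ i, z ∈ Metric.ball (σ i : ℂ) (R i) := ⟨i, hz⟩
  simp only [dif_pos h]
  exact hagree _ _ z h.choose_spec hz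

theorem exists_Icc_subset_of_mem_nhdsWithin {A B τ : ℝ} (hτ : τ ∈ Icc A B) {u : Set ℝ}
    (hu : u ∈ 𝓝[Icc A B] τ) : ∃ a b, a ≤ b ∧ Icc a b ⊆ u ∧ Icc a b ⊆ Icc A B ∧
      Icc a b ∈ 𝓝[Icc A B] τ := by
  obtain ⟨ε, hε, hb⟩ := Metric.mem_nhdsWithin_iff.1 hu
  have heq : Icc (max A (τ - ε / 2)) (min B (τ + ε / 2)) =
      Icc A B ∩ Icc (τ - ε / 2) (τ + ε / 2) := by rw [Icc_inter_Icc]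
  refine ⟨max A (τ - ε / 2), min B (τ + ε / 2), ?_, ?_, ?_, ?_⟩
  · exact (max_le hτ.1 (by linarith)).trans (le_min hτ.2 (by linarith))
  · rw [heq]
    rintro t ⟨h1, h2⟩
    refine hb ⟨?_, h1⟩
    rw [Real.ball_eq_Ioo]
    exact ⟨by linarith [h2.1], by linarith [h2.2]⟩
  · rw [heq]; exact inter_subset_left
  · rw [heq]
    exact inter_mem self_mem_nhdsWithin
      (nhdsWithin_le_nhds (Icc_mem_nhds (by linarith) (by linarith)))

/-- On a small interval the parameter `ρ ∘ c` is continuous, and it is injective because `Z ∘ c` is;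
so it is strictly monotone. In the decreasing case `H (z)` is replaced by `H (-z)`. -/
theorem exists_local_parameter {Z : ℝ × ℝ → ℂ} {A B τ : ℝ} (hτ : τ ∈ Icc A B)
    {c : ℝ → ℝ × ℝ} (hc : ContinuousOn c (Icc A B))
    (hchar : ∀ t ∈ Icc A B, (vectorFieldOf Z).charFun (c t) = 0)
    (hinj : ∃ u ∈ 𝓝[Icc A B] τ, InjOn (fun t => Z (c t)) u)
    (hst : ∃ H, IsStraightening Z H 0 (c τ)) :
    ∃ (H : ℂ → ℂ) (r : ℝ → ℝ), IsStraightening Z H 0 (c τ) ∧ r τ = 0 ∧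
      (∃ u ∈ 𝓝[Icc A B] τ, StrictMonoOn r u) ∧
      (∀ᶠ t in 𝓝[Icc A B] τ, ContinuousWithinAt r (Icc A B) t) ∧
      ∀ᶠ t in 𝓝[Icc A B] τ, Z (c t) = H (r t) := by
  obtain ⟨H, hH⟩ := hst
  have hH' := hH
  obtain ⟨han, hu, ρ, hρ, hρp, hρZ⟩ := hH'
  obtain ⟨u, huI, hu⟩ := hinj
  have hct : Tendsto c (𝓝[Icc A B] τ) (𝓝 (c τ)) := hc τ hτ
  have hev : ∀ᶠ t in 𝓝[Icc A B] τ, t ∈ Icc A B ∧ t ∈ u ∧ ContinuousAt ρ (c t) ∧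
      Z (c t) = H (ρ (c t)) := by
    filter_upwards [self_mem_nhdsWithin, huI, hct.eventually hρ, hct.eventually hρZ]
      with t h1 h2 h3 h4
    exact ⟨h1, h2, h3, h4 (hchar t h1)⟩
  obtain ⟨a, b, hab, hsub, hsubI, hmem⟩ := exists_Icc_subset_of_mem_nhdsWithin hτ hev
  have hcw : ∀ t ∈ Icc a b, ContinuousWithinAt (fun t => ρ (c t)) (Icc A B) t := fun t ht =>
    (hsub ht).2.2.1.comp_continuousWithinAt (hc t (hsubI ht))
  have hri : InjOn (fun t => ρ (c t)) (Icc a b) := by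
    intro t ht t' ht' h
    refine hu (hsub ht).2.1 (hsub ht').2.1 ?_
    simp only
    rw [(hsub ht).2.2.2, (hsub ht').2.2.2]
    simp only at h
    rw [h]
  rcases ContinuousOn.strictMonoOn_of_injOn_Icc' hab
    (fun t ht => (hcw t ht).mono hsubI) hri with hm | hm
  · refine ⟨H, fun t => ρ (c t), hH, hρp, ⟨_, hmem, hm⟩, ?_, ?_⟩
    · filter_upwards [hmem] with t ht using hcw t ht
    · filter_upwards [hmem] with t ht using (hsub ht).2.2.2
  · refine ⟨fun z => H (-z), fun t => -ρ (c t), by simpa using hH.neg, by simp [hρp],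
      ⟨_, hmem, hm.neg⟩, ?_, ?_⟩
    · filter_upwards [hmem] with t ht using (hcw t ht).neg
    · filter_upwards [hmem] with t ht
      simpa using (hsub ht).2.2.2

theorem neBot_nhdsWithin_Icc_diff {A B τ : ℝ} (hAB : A < B) (hτ : τ ∈ Icc A B) :
    (𝓝[Icc A B \ {τ}] τ).NeBot := by
  rw [← mem_closure_iff_nhdsWithin_neBot]
  rcases hτ.2.eq_or_lt with rfl | h
  · have : Ico A τ ⊆ Icc A τ \ {τ} := fun x hx => ⟨⟨hx.1, hx.2.le⟩, hx.2.ne⟩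
    apply closure_mono this
    rw [closure_Ico hAB.ne]; exact hτ
  · have : Ioc τ B ⊆ Icc A B \ {τ} := fun x hx => ⟨⟨hτ.1.trans hx.1.le, hx.2⟩, hx.1.ne'⟩
    apply closure_mono this
    rw [closure_Ioc h.ne]; exact ⟨le_rfl, h.le⟩

/-- A curve in the characteristic set is parametrized by its arc length under `Z`, and this
parametrization of the image is the restriction of a holomorphic function. -/
theorem exists_global_straightening {Z : ℝ × ℝ → ℂ} {A B : ℝ} (hAB : A < B)
    {c : ℝ → ℝ × ℝ} (hc : ContinuousOn c (Icc A B))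
    (hchar : ∀ t ∈ Icc A B, (vectorFieldOf Z).charFun (c t) = 0)
    (hinj : ∀ τ ∈ Icc A B, ∃ u ∈ 𝓝[Icc A B] τ, InjOn (fun t => Z (c t)) u)
    (hst : ∀ τ ∈ Icc A B, ∃ H, IsStraightening Z H 0 (c τ)) :
    ∃ (σ : ℝ → ℝ) (H : ℂ → ℂ), ContinuousOn σ (Icc A B) ∧ StrictMonoOn σ (Icc A B) ∧
      (∀ τ ∈ Icc A B, IsStraightening Z H (σ τ) (c τ)) ∧
      ∀ τ ∈ Icc A B, Z (c τ) = H (σ τ) := by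
  have hloc := fun τ (hτ : τ ∈ Icc A B) =>
    exists_local_parameter hτ hc hchar (hinj τ hτ) (hst τ hτ)
  choose! h r hhs hr0 hrm hrc hrZ using hloc
  -- The parametrizations based at `x` and at a nearby `y` both have unit speed and describe the
  -- same oriented curve near `c y`, so they differ by the translation by `r x y`.
  have hcoh : ∀ x ∈ Icc A B, ∀ᶠ y in 𝓝[Icc A B] x,
      (∀ᶠ z in 𝓝 (r x y : ℂ), h x z = h y (z - r x y)) ∧
        ∀ᶠ t in 𝓝[Icc A B] y, r y t = r x t - r x y := by
    intro x hx
    have hrx : Tendsto (r x) (𝓝[Icc A B] x) (𝓝 0) := by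
      have : ContinuousWithinAt (r x) (Icc A B) x := (hrc x hx).self_of_nhdsWithin hx
      rw [← hr0 x hx]; exact this
    obtain ⟨u, hu, hmu⟩ := hrm x hx
    filter_upwards [self_mem_nhdsWithin, eventually_eventually_nhdsWithin.2 hu,
      hrc x hx, eventually_eventually_nhdsWithin.2 (hrZ x hx),
      hrx.eventually ((tendsto_ofReal_nhds 0).eventually (hhs x hx).analyticAt.eventually_analyticAt),
      hrx.eventually (hhs x hx).unitSpeed.eventually_nhds] with y hy h1 h2 h3 h4 h5
    have := unitSpeed_unique h4 (hhs y hy).analyticAt h5 (hhs y hy).unitSpeed hy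
      (neBot_nhdsWithin_Icc_diff hAB hy) rfl (hr0 y hy) h2
      ((hrc y hy).self_of_nhdsWithin hy) ⟨u, h1, hmu⟩ (hrm y hy) (by
        filter_upwards [h3, hrZ y hy] with t e1 e2
        rw [← e1, ← e2])
    simpa using this
  obtain ⟨σ, hσm, hσ⟩ := exists_glued_parameter hAB.le hrm fun x hx =>
    (hcoh x hx).mono fun y hy => ⟨-r x y, hy.2.mono fun t ht => by rw [ht]; ring⟩
  have hσ' : ∀ x ∈ Icc A B, ∀ᶠ t in 𝓝[Icc A B] x, σ t = r x t + σ x := by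
    intro x hx
    obtain ⟨C, hC⟩ := hσ x hx
    have : σ x = C := by rw [hC.self_of_nhdsWithin hx, hr0 x hx, zero_add]
    rwa [this]
  have hσc : ContinuousOn σ (Icc A B) := by
    intro x hx
    exact (((hrc x hx).self_of_nhdsWithin hx).add_const (σ x)).congr_of_eventuallyEq
      (hσ' x hx) ((hσ' x hx).self_of_nhdsWithin hx)
  let σI : Icc A B → ℝ := (Icc A B).domRestrict σ
  have hσI : Continuous σI := continuousOn_iff_continuous_domRestrict.1 hσc
  have hinjI : Function.Injective σI := injOn_iff_injective.1 hσm.injOn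
  have hemb := hσI.isClosedEmbedding hinjI
  have hord : OrdConnected (range σI) := by
    have : PreconnectedSpace (Icc A B) := Subtype.preconnectedSpace isPreconnected_Icc
    exact (isPreconnected_range hσI).ordConnected
  -- Shifting each local function to the base point `σ i` cancels the translations between them, so
  -- the germs become consistent.
  obtain ⟨H, hH⟩ := exists_glued_holomorphic (K := fun (i : Icc A B) z => h i (z - σ i))
    hemb.isInducing hord
    (fun i => ((hhs i i.2).translate (σ i)).analyticAt)
    (by
      rintro ⟨x, hx⟩
      have h1 := (hcoh x hx).and (hσ' x hx)
      rw [nhdsWithin_eq_map_subtype_coe hx, eventually_map] at h1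
      filter_upwards [h1] with y hy
      have h2 : Tendsto (fun z : ℂ => z - σ x) (𝓝 (σ y : ℂ)) (𝓝 (r x y : ℂ)) := by
        have h3 := (continuous_sub_right (σ x : ℂ)).tendsto (σ y : ℂ)
        rwa [← Complex.ofReal_sub, show σ y - σ x = r x y by rw [hy.2]; ring] at h3
      filter_upwards [h2.eventually hy.1.1] with z hz
      rw [hz, hy.2]
      push_cast
      congr 1
      ring)
  have hHs : ∀ τ ∈ Icc A B, IsStraightening Z H (σ τ) (c τ) := fun τ hτ =>
    ((hhs τ hτ).translate (σ τ)).congr (hH ⟨τ, hτ⟩)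
  refine ⟨σ, H, hσc, hσm, hHs, fun τ hτ => ?_⟩
  obtain ⟨-, -, ρ, -, hρ, hρZ⟩ := hHs τ hτ
  rw [hρZ.self_of_nhds (hchar τ hτ), hρ]

end Gluing

/-! ### Type, order of vanishing and transversality -/

section FiniteType

namespace CVectorField

/-- A complex vector field with coefficients that are analytic at `p`. -/
def IsAnalyticAt (X : CVectorField) (p : ℝ × ℝ) : Prop :=
  AnalyticAt ℝ (fun x => (X x).1) p ∧ AnalyticAt ℝ (fun x => (X x).2) p

variable {X Y : CVectorField} {p : ℝ × ℝ} {f g : ℝ × ℝ → ℂ}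

theorem IsAnalyticAt.apply (hX : X.IsAnalyticAt p) (hf : AnalyticAt ℝ f p) :
    AnalyticAt ℝ (X.apply f) p :=
  (hX.1.mul (analyticAt_fderiv_apply hf _)).add (hX.2.mul (analyticAt_fderiv_apply hf _))

theorem IsAnalyticAt.bar (hX : X.IsAnalyticAt p) : X.bar.IsAnalyticAt p :=
  ⟨(Complex.conjCLE.toContinuousLinearMap.analyticAt _).comp hX.1,
    (Complex.conjCLE.toContinuousLinearMap.analyticAt _).comp hX.2⟩

theorem IsAnalyticAt.bracket (hX : X.IsAnalyticAt p) (hY : Y.IsAnalyticAt p) :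
    (X.bracket Y).IsAnalyticAt p :=
  ⟨(hX.apply hY.1).sub (hY.apply hX.1), (hX.apply hY.2).sub (hY.apply hX.2)⟩

theorem apply_congr (h : f =ᶠ[𝓝 p] g) : X.apply f p = X.apply g p := by
  simp only [apply, pdx, pdy, h.fderiv_eq]

theorem apply_mul (hf : DifferentiableAt ℝ f p) (hg : DifferentiableAt ℝ g p) :
    X.apply (fun x => f x * g x) p = f p * X.apply g p + g p * X.apply f p := by
  simp only [apply, pdx, pdy, fderiv_fun_mul hf hg, _root_.add_apply,
    _root_.smul_apply, smul_eq_mul]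
  ring

theorem apply_add (hf : DifferentiableAt ℝ f p) (hg : DifferentiableAt ℝ g p) :
    X.apply (fun x => f x + g x) p = X.apply f p + X.apply g p := by
  simp only [apply, pdx, pdy, fderiv_fun_add hf hg, _root_.add_apply]
  ring

theorem apply_pow (hf : DifferentiableAt ℝ f p) (m : ℕ) :
    X.apply (fun x => f x ^ m) p = m * f p ^ (m - 1) * X.apply f p := by
  simp only [apply, pdx, pdy, fderiv_fun_pow m hf, _root_.smul_apply, smul_eq_mul,
    nsmul_eq_mul]
  ring

theorem apply_const (c : ℂ) : X.apply (fun _ => c) p = 0 := by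
  simp [apply, pdx, pdy]

theorem apply_bracket (hX : X.IsAnalyticAt p) (hY : Y.IsAnalyticAt p) (hf : AnalyticAt ℝ f p) :
    (X.bracket Y).apply f p = X.apply (Y.apply f) p - Y.apply (X.apply f) p := by
  have hs : IsSymmSndFDerivAt ℝ f p := hf.contDiffAt.isSymmSndFDerivAt_of_omega
  have hd : ∀ v w, fderiv ℝ (fun x => fderiv ℝ f x v) p w = fderiv ℝ (fderiv ℝ f) p w v := by
    intro v w
    have h1 := ((ContinuousLinearMap.apply ℝ ℂ v).hasFDerivAt (x := fderiv ℝ f p)).comp p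
      hf.fderiv.differentiableAt.hasFDerivAt
    exact congrArg (fun l => l w) h1.fderiv
  have hxy : pdx (pdy f) p = pdy (pdx f) p := by
    change fderiv ℝ (fun x => fderiv ℝ f x (0, 1)) p (1, 0) =
      fderiv ℝ (fun x => fderiv ℝ f x (1, 0)) p (0, 1)
    rw [hd, hd, hs]
  have hfx : DifferentiableAt ℝ (pdx f) p := (analyticAt_fderiv_apply hf _).differentiableAt
  have hfy : DifferentiableAt ℝ (pdy f) p := (analyticAt_fderiv_apply hf _).differentiableAt
  have key : ∀ {V W : CVectorField}, V.IsAnalyticAt p → V.IsAnalyticAt p → W.IsAnalyticAt p →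
      V.apply (W.apply f) p = V.apply (fun x => (W x).1) p * pdx f p + (W p).1 * V.apply (pdx f) p +
        V.apply (fun x => (W x).2) p * pdy f p + (W p).2 * V.apply (pdy f) p := by
    intro V W _ hV hW
    change V.apply (fun x => (W x).1 * pdx f x + (W x).2 * pdy f x) p = _
    rw [apply_add (hW.1.differentiableAt.fun_mul hfx) (hW.2.differentiableAt.fun_mul hfy),
      apply_mul hW.1.differentiableAt hfx, apply_mul hW.2.differentiableAt hfy]
    ring
  rw [key hX hX hY, key hY hY hX]
  simp only [apply, bracket]
  rw [hxy]
  ring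

/-- Derivatives along a vector field lower the order of vanishing on a curve by at most one. -/
theorem apply_pow_mul (hX : X.IsAnalyticAt p) (hf : AnalyticAt ℝ f p) (hg : AnalyticAt ℝ g p)
    {F : ℝ × ℝ → ℂ} {m : ℕ} (hF : ∀ᶠ x in 𝓝 p, F x = f x ^ (m + 1) * g x) :
    AnalyticAt ℝ (fun x => (m + 1) * X.apply f x * g x + f x * X.apply g x) p ∧
      ∀ᶠ x in 𝓝 p, X.apply F x =
        f x ^ m * ((m + 1) * X.apply f x * g x + f x * X.apply g x) := by
  refine ⟨((analyticAt_const.mul (hX.apply hf)).mul hg).add (hf.mul (hX.apply hg)), ?_⟩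
  filter_upwards [hF.eventually_nhds, hf.eventually_analyticAt, hg.eventually_analyticAt]
    with x h1 h2 h3
  rw [apply_congr h1, apply_mul (h2.differentiableAt.fun_pow _) h3.differentiableAt,
    apply_pow h2.differentiableAt]
  rw [Nat.add_sub_cancel]
  push_cast
  ring

end CVectorField

open CVectorField

variable {Z : ℝ × ℝ → ℂ} {p : ℝ × ℝ}

theorem isAnalyticAt_vectorFieldOf (hZ : AnalyticAt ℝ Z p) : (vectorFieldOf Z).IsAnalyticAt p :=
  ⟨(analyticAt_fderiv_apply hZ _).neg, analyticAt_fderiv_apply hZ _⟩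

theorem vectorFieldOf_apply_self (Z : ℝ × ℝ → ℂ) : (vectorFieldOf Z).apply Z = fun _ => 0 := by
  funext x
  simp only [CVectorField.apply, vectorFieldOf]
  ring

/-- The starting point of the count of orders: `L̄ Z` vanishes along the characteristic curve
exactly to the multiplicity of the curve. -/
theorem bar_vectorFieldOf_apply_self (Z : ℝ × ℝ → ℂ) (x : ℝ × ℝ) :
    (vectorFieldOf Z).bar.apply Z x = -2 * Complex.I * (vectorFieldOf Z).charFun x := by
  rw [charFun_vectorFieldOf]
  simp only [CVectorField.apply, CVectorField.bar, vectorFieldOf]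
  apply Complex.ext <;> simp <;> ring

theorem bar_apply_ofReal (X : CVectorField) {y : ℝ × ℝ → ℝ} (hy : DifferentiableAt ℝ y p) :
    X.bar.apply (fun x => (y x : ℂ)) p = conj (X.apply (fun x => (y x : ℂ)) p) := by
  simp [CVectorField.apply, CVectorField.bar, pdx, pdy, fderiv_ofReal_apply hy]

/-- The complex kernel of `dZ ≠ 0` is a line, spanned by `L`. The type thus becomes a question about
the functions `X Z`. -/
theorem linearIndependent_iff_apply_ne_zero (hd : fderiv ℝ Z p ≠ 0) (X : CVectorField) :
    LinearIndependent ℂ ![X p, vectorFieldOf Z p] ↔ X.apply Z p ≠ 0 := by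
  have hne : ¬(pdx Z p = 0 ∧ pdy Z p = 0) := by
    rintro ⟨h1, h2⟩
    apply hd
    ext
    · exact h1
    · exact h2
  rw [LinearIndependent.pair_iff]
  simp only [CVectorField.apply]
  constructor
  · intro h h0
    apply hne
    constructor
    · refine (h (pdx Z p) (-(X p).2) (Prod.ext ?_ ?_)).1
      · simp only [vectorFieldOf, Prod.fst_add, Prod.smul_fst, smul_eq_mul, Prod.fst_zero]
        linear_combination h0
      · simp only [vectorFieldOf, Prod.snd_add, Prod.smul_snd, smul_eq_mul, Prod.snd_zero]
        ring
    · refine (h (pdy Z p) (X p).1 (Prod.ext ?_ ?_)).1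
      · simp only [vectorFieldOf, Prod.fst_add, Prod.smul_fst, smul_eq_mul, Prod.fst_zero]
        ring
      · simp only [vectorFieldOf, Prod.snd_add, Prod.smul_snd, smul_eq_mul, Prod.snd_zero]
        linear_combination h0
  · intro h s t hst
    have h1 := congrArg Prod.fst hst
    have h2 := congrArg Prod.snd hst
    simp only [vectorFieldOf, Prod.fst_add, Prod.smul_fst, smul_eq_mul, Prod.fst_zero,
      Prod.snd_add, Prod.smul_snd, Prod.snd_zero] at h1 h2
    have hs : s = 0 := by
      refine (mul_eq_zero.1 (?_ : s * _ = 0)).resolve_right h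
      linear_combination pdx Z p * h1 + pdy Z p * h2
    refine ⟨hs, ?_⟩
    by_contra ht
    apply hne
    constructor
    · refine (mul_eq_zero.1 (?_ : t * _ = 0)).resolve_left ht
      rw [hs] at h2; linear_combination h2
    · refine (mul_eq_zero.1 (?_ : t * _ = 0)).resolve_left ht
      rw [hs] at h1; linear_combination -h1

/-- Along the curve `y = 0`, where the characteristic function vanishes to the order `l`, a bracket
of length `n` differs from a multiple of the vector field to the order `l + 1 - n`. -/
theorem exists_factor_of_isIteratedBracket (hZ : AnalyticAt ℝ Z p) {y u : ℝ × ℝ → ℝ} {l : ℕ}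
    (hy : AnalyticAt ℝ y p) (hu : AnalyticAt ℝ u p) (hy0 : y p = 0) (hl : 1 ≤ l)
    (hc : ∀ᶠ x in 𝓝 p, (vectorFieldOf Z).charFun x = u x * y x ^ l) {n : ℕ} {X : CVectorField}
    (hX : (vectorFieldOf Z).IsIteratedBracket n X) :
    X.IsAnalyticAt p ∧ 1 ≤ n ∧ (n = 1 → (vectorFieldOf Z).apply (fun x => (y x : ℂ)) p = 0 →
        X.apply (fun x => (y x : ℂ)) p = 0) ∧
      ∀ m, m + n = l + 1 → ∃ g : ℝ × ℝ → ℂ, AnalyticAt ℝ g p ∧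
        (∀ᶠ x in 𝓝 p, X.apply Z x = (y x : ℂ) ^ m * g x) ∧
        (2 ≤ n → (vectorFieldOf Z).apply (fun x => (y x : ℂ)) p = 0 → g p = 0) := by
  have hL := isAnalyticAt_vectorFieldOf hZ
  have hyc : AnalyticAt ℝ (fun x => (y x : ℂ)) p := (Complex.ofRealCLM.analyticAt _).comp hy
  have huc : AnalyticAt ℝ (fun x => -2 * Complex.I * (u x : ℂ)) p :=
    analyticAt_const.mul ((Complex.ofRealCLM.analyticAt _).comp hu)
  have hbar : ∀ᶠ x in 𝓝 p, (vectorFieldOf Z).bar.apply Z x =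
      (y x : ℂ) ^ l * (-2 * Complex.I * (u x : ℂ)) := by
    filter_upwards [hc] with x hx
    rw [bar_vectorFieldOf_apply_self, hx]
    push_cast; ring
  induction hX with
  | self =>
    exact ⟨hL, le_rfl, fun _ h => h, fun m hm => ⟨fun _ => 0, analyticAt_const,
      Eventually.of_forall fun x => by rw [vectorFieldOf_apply_self, mul_zero], fun _ _ => rfl⟩⟩
  | bar =>
    refine ⟨hL.bar, le_rfl, fun _ h => ?_, fun m hm => ⟨_, huc, ?_, fun h => by omega⟩⟩
    · rw [bar_apply_ofReal _ hy.differentiableAt, h, map_zero]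
    · obtain rfl : m = l := by omega
      exact hbar
  | @bracket_self n X hX ih =>
    obtain ⟨hXan, hn, -, hfac⟩ := ih
    refine ⟨hL.bracket hXan, by omega, by omega, fun m hm => ?_⟩
    obtain ⟨g, hg, hgX, -⟩ := hfac (m + 1) (by omega)
    obtain ⟨h1, h2⟩ := apply_pow_mul hL hyc hg hgX
    refine ⟨_, h1, ?_, fun _ hLy => by simp [hLy, hy0]⟩
    filter_upwards [h2, hL.1.eventually_analyticAt, hL.2.eventually_analyticAt,
      hXan.1.eventually_analyticAt, hXan.2.eventually_analyticAt, hZ.eventually_analyticAt]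
      with x e1 e2 e3 e4 e5 e6
    rw [apply_bracket ⟨e2, e3⟩ ⟨e4, e5⟩ e6, e1, vectorFieldOf_apply_self, apply_const, sub_zero]
  | @bracket_bar n X hX ih =>
    obtain ⟨hXan, hn, hX1, hfac⟩ := ih
    refine ⟨hL.bar.bracket hXan, by omega, by omega, fun m hm => ?_⟩
    obtain ⟨g, hg, hgX, -⟩ := hfac (m + 1) (by omega)
    obtain ⟨h1, h2⟩ := apply_pow_mul hL.bar hyc hg hgX
    -- In `[L̄, X] Z = L̄ (X Z) - X (L̄ Z)` the second term vanishes to order `l - 1 = m + (n - 1)`,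
    -- so the factor `y ^ (n - 1)` is left after extracting `y ^ m`.
    obtain ⟨l, rfl⟩ : ∃ l', l = l' + 1 := ⟨l - 1, by omega⟩
    obtain ⟨h3, h4⟩ := apply_pow_mul hXan hyc huc hbar
    refine ⟨_, h1.sub ((hyc.pow (n - 1)).mul h3), ?_, fun _ hLy => ?_⟩
    · filter_upwards [h2, h4, hL.1.eventually_analyticAt, hL.2.eventually_analyticAt,
        hXan.1.eventually_analyticAt, hXan.2.eventually_analyticAt, hZ.eventually_analyticAt]
        with x e1 e1' e2 e3 e4 e5 e6
      rw [apply_bracket (IsAnalyticAt.bar ⟨e2, e3⟩) ⟨e4, e5⟩ e6, e1, e1',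
        show l = m + (n - 1) by omega, pow_add]
      simp only [Pi.sub_apply, Pi.mul_apply, Pi.pow_apply]
      ring
    · have hb : (vectorFieldOf Z).bar.apply (fun x => (y x : ℂ)) p = 0 := by
        rw [bar_apply_ofReal _ hy.differentiableAt, hLy, map_zero]
      rcases hn.eq_or_lt with h | h
      -- For `n = 1` the factor `y ^ (n - 1)` is `1`, and only `X y = 0` makes the term vanish at
      -- `p`; this is why the induction carries the clause on `n = 1`.
      · simp [hb, hy0, hX1 h.symm hLy]
      · have : n - 1 ≠ 0 := by omega
        simp [hb, hy0, this]

/-- The type at a point of the regular part of the characteristic set is one more than the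
multiplicity if the vector field is transversal to this set, and larger otherwise. -/
theorem hasTypeAt_regular (hZ : AnalyticAt ℝ Z p) (hd : fderiv ℝ Z p ≠ 0) {y u : ℝ × ℝ → ℝ} {l : ℕ}
    (hy : AnalyticAt ℝ y p) (hu : AnalyticAt ℝ u p) (hy0 : y p = 0) (hu0 : u p ≠ 0) (hl : 1 ≤ l)
    (hc : ∀ᶠ x in 𝓝 p, (vectorFieldOf Z).charFun x = u x * y x ^ l) {k : ℕ}
    (hk : (vectorFieldOf Z).HasTypeAt p k) :
    k = l + 1 ↔ (vectorFieldOf Z).apply (fun x => (y x : ℂ)) p ≠ 0 := by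
  obtain ⟨⟨X, hX, hXli⟩, hmin⟩ := hk
  rw [linearIndependent_iff_apply_ne_zero hd] at hXli
  have hL := isAnalyticAt_vectorFieldOf hZ
  have hyc : AnalyticAt ℝ (fun x => (y x : ℂ)) p := (Complex.ofRealCLM.analyticAt _).comp hy
  -- A bracket of length `k ≤ l + 1` has `X Z = y ^ (l + 1 - k) g`. A nonzero value at `p` forces
  -- the exponent to be `0`, and then `g p ≠ 0` excludes `L y = 0`.
  have hge : k ≤ l + 1 → k = l + 1 ∧ (vectorFieldOf Z).apply (fun x => (y x : ℂ)) p ≠ 0 := by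
    intro hkl
    obtain ⟨-, hk1, -, hfac⟩ := exists_factor_of_isIteratedBracket hZ hy hu hy0 hl hc hX
    obtain ⟨g, -, hg, hg0⟩ := hfac (l + 1 - k) (by omega)
    have h1 := hg.self_of_nhds
    rw [hy0, Complex.ofReal_zero] at h1
    have h2 : l + 1 - k = 0 := by
      by_contra h
      rw [zero_pow h, zero_mul] at h1
      exact hXli h1
    refine ⟨by omega, fun h => hXli ?_⟩
    rw [h1, hg0 (by omega) h, mul_zero]
  refine ⟨fun h => (hge h.le).2, fun hLy => (hge ?_).1⟩
  -- When `L y ≠ 0`, each bracket with `L` in `[L, [L, … [L, L̄]]]` lowers the order by exactly one,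
  -- since the new leading coefficient is a nonzero multiple of `L y` times the old one.
  have hex : ∀ n, n ≤ l → ∃ X, (vectorFieldOf Z).IsIteratedBracket (n + 1) X ∧ X.IsAnalyticAt p ∧
      ∃ g : ℝ × ℝ → ℂ, AnalyticAt ℝ g p ∧ g p ≠ 0 ∧
        ∀ᶠ x in 𝓝 p, X.apply Z x = (y x : ℂ) ^ (l - n) * g x := by
    intro n
    induction n with
    | zero =>
      intro _
      refine ⟨_, IsIteratedBracket.bar, hL.bar, fun x => -2 * Complex.I * (u x : ℂ),
        analyticAt_const.mul ((Complex.ofRealCLM.analyticAt _).comp hu), by simpa using hu0, ?_⟩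
      filter_upwards [hc] with x hx
      rw [bar_vectorFieldOf_apply_self, hx, Nat.sub_zero]
      push_cast; ring
    | succ n ih =>
      intro hn
      obtain ⟨X, hX, hXan, g, hg, hg0, hgX⟩ := ih (by omega)
      rw [show l - n = l - (n + 1) + 1 by omega] at hgX
      obtain ⟨h1, h2⟩ := apply_pow_mul hL hyc hg hgX
      refine ⟨_, hX.bracket_self, hL.bracket hXan, _, h1, ?_, ?_⟩
      · simp only [hy0, Complex.ofReal_zero, zero_mul, add_zero]
        exact mul_ne_zero (mul_ne_zero (Nat.cast_add_one_ne_zero _) hLy) hg0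
      · filter_upwards [h2, hL.1.eventually_analyticAt, hL.2.eventually_analyticAt,
          hXan.1.eventually_analyticAt, hXan.2.eventually_analyticAt, hZ.eventually_analyticAt]
          with x e1 e2 e3 e4 e5 e6
        rw [apply_bracket ⟨e2, e3⟩ ⟨e4, e5⟩ e6, e1, vectorFieldOf_apply_self, apply_const, sub_zero]
  obtain ⟨X', hX', -, g, -, hg0, hg⟩ := hex l le_rfl
  apply hmin
  refine ⟨X', hX', (linearIndependent_iff_apply_ne_zero hd X').2 ?_⟩
  rw [hg.self_of_nhds]
  simpa using hg0

/-- If the type is constant along a subset without isolated points of the regular part of the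
characteristic set, then the vector field is transversal to the characteristic set there. -/
theorem isTransversalAt_of_hasTypeAt {O G : Set (ℝ × ℝ)} (hZ : IsHypocomplex O Z) {k : ℕ}
    (hG : G ⊆ (vectorFieldOf Z).regularCharSet O) (hk : ∀ x ∈ G, (vectorFieldOf Z).HasTypeAt x k)
    (hp : p ∈ G) (hacc : ∃ᶠ x in 𝓝[≠] p, x ∈ G) : IsTransversalAt Z k p := by
  obtain ⟨⟨hpO, -⟩, U, u, y, l, hUo, hpU, hUO, hu, hy, hy0, hdy, hl, hc⟩ := hG hp
  have hcU : ∀ x ∈ U, ∀ᶠ x' in 𝓝 x, (vectorFieldOf Z).charFun x' = u x' * y x' ^ l := fun x hx =>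
    mem_of_superset (hUo.mem_nhds hx) fun x' hx' => (hc x' hx').2
  have htype : ∀ x ∈ U, x ∈ G → y x = 0 ∧
      (k = l + 1 ↔ (vectorFieldOf Z).apply (fun x => (y x : ℂ)) x ≠ 0) := by
    intro x hx hxG
    have hyx : y x = 0 := by
      have h1 := (hc x hx).2
      rw [(hG hxG).1.2] at h1
      exact pow_eq_zero_iff (by omega) |>.1 ((mul_eq_zero.1 h1.symm).resolve_left (hc x hx).1)
    exact ⟨hyx, hasTypeAt_regular (hZ.analytic x (hUO hx)) (hZ.fderiv_ne_zero x (hUO hx)) (hy x hx)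
      (hu x hx) hyx (hc x hx).1 hl (hcU x hx) (hk x hxG)⟩
  by_cases hkl : k = l + 1
  · exact ⟨by omega, y, u, hy p hpU, hu p hpU, hy0, (hc p hpU).1, by
      rw [hkl, Nat.add_sub_cancel]; exact hcU p hpU, (htype p hpU hp).2.1 hkl⟩
  exfalso
  have htan : ∀ x ∈ U, x ∈ G → (vectorFieldOf Z).apply (fun x => (y x : ℂ)) x = 0 :=
    fun x hx hxG => not_not.1 fun h => hkl ((htype x hx hxG).2.2 h)
  have hyp := hy p hpU
  have hZp := hZ.analytic p hpO
  obtain ⟨S, γ, hS, hSp, hγ, hγ0, hsec, hret⟩ := exists_curve_parameter hyp hy0 hdy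
  have hγt : Tendsto γ (𝓝 0) (𝓝 p) := hγ0 ▸ hγ.continuousAt.tendsto
  have hF : AnalyticAt ℝ (fun ξ => (vectorFieldOf Z).apply (fun x => (y x : ℂ)) (γ ξ)) 0 := by
    apply AnalyticAt.fun_comp _ hγ
    rw [hγ0]
    exact (isAnalyticAt_vectorFieldOf hZp).apply ((Complex.ofRealCLM.analyticAt _).comp hyp)
  -- Tangency holds at the points of `G`, which accumulate at `p` along the curve; by analyticity it
  -- propagates to the whole curve near `p`.
  have hF0 : ∀ᶠ ξ in 𝓝 (0 : ℝ), (vectorFieldOf Z).apply (fun x => (y x : ℂ)) (γ ξ) = 0 := by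
    rw [← hF.frequently_zero_iff_eventually_zero]
    have hSt : Tendsto S (𝓝 p) (𝓝 0) := hSp ▸ hS.continuousAt.tendsto
    have hev : ∀ᶠ x in 𝓝[≠] p, x ∈ G → S x ≠ 0 ∧
        (vectorFieldOf Z).apply (fun x => (y x : ℂ)) (γ (S x)) = 0 := by
      filter_upwards [nhdsWithin_le_nhds hret, nhdsWithin_le_nhds (hUo.mem_nhds hpU),
        self_mem_nhdsWithin] with x h1 h2 h3 h4
      have h5 := h1 (htype x h2 h4).1
      refine ⟨fun h => h3 ?_, by rw [h5]; exact htan x h2 h4⟩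
      rw [← h5, h, hγ0]; rfl
    rw [frequently_iff] at hacc ⊢
    intro W hW
    rw [mem_nhdsWithin_iff_exists_mem_nhds_inter] at hW
    obtain ⟨W', hW', hsub⟩ := hW
    obtain ⟨x, ⟨hx1, hx2⟩, hxG⟩ := hacc (inter_mem hev (nhdsWithin_le_nhds (hSt hW')))
    exact ⟨S x, hsub ⟨hx2, (hx1 hxG).1⟩, (hx1 hxG).2⟩
  -- `L y = 0` makes `dZ` a complex multiple of `dy ≠ 0`, which kills the tangent vector `γ'`. Hence
  -- `Z` is constant on the curve, contradicting injectivity.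
  have hder : ∀ᶠ ξ in 𝓝 (0 : ℝ), HasDerivAt (fun ξ => Z (γ ξ)) 0 ξ := by
    have hdy' : ∀ᶠ x in 𝓝 p, fderiv ℝ y x ≠ 0 := hyp.fderiv.continuousAt.eventually_ne hdy
    filter_upwards [hF0, hγ.eventually_analyticAt, hγt.eventually hyp.eventually_analyticAt,
      hγt.eventually hZp.eventually_analyticAt, hsec.eventually_nhds, hγt.eventually hdy']
      with ξ h1 h2 h3 h4 h5 h6
    have hγd := h2.differentiableAt.hasDerivAt
    refine (h4.differentiableAt.hasFDerivAt.comp_hasDerivAt ξ hγd).congr_deriv ?_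
    have e1 : fderiv ℝ y (γ ξ) (deriv γ ξ) = 0 :=
      ((h3.differentiableAt.hasFDerivAt.comp_hasDerivAt ξ hγd).congr_of_eventuallyEq
        (f₁ := fun _ => 0) (h5.mono fun ξ hξ => hξ.2.symm)).unique (hasDerivAt_const ξ 0)
    rw [apply_vectorFieldOf_ofReal Z h3.differentiableAt] at h1
    rw [fderiv_plane_apply] at e1 ⊢
    simp only [smul_eq_mul, Complex.real_smul] at e1 ⊢
    have e2 : ((deriv γ ξ).1 : ℂ) * (fderiv ℝ y (γ ξ) (1, 0) : ℝ) +
        (deriv γ ξ).2 * (fderiv ℝ y (γ ξ) (0, 1) : ℝ) = 0 := by exact_mod_cast e1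
    simp only [pdx, pdy] at h1
    by_cases hx : fderiv ℝ y (γ ξ) (1, 0) = 0
    · have hyy : (fderiv ℝ y (γ ξ) (0, 1) : ℂ) ≠ 0 := by
        intro h
        apply h6
        ext
        · simpa using hx
        · simpa using Complex.ofReal_eq_zero.1 h
      refine mul_left_cancel₀ hyy ?_
      linear_combination ((deriv γ ξ).1 : ℂ) * h1 + fderiv ℝ Z (γ ξ) (0, 1) * e2
    · refine mul_left_cancel₀ (Complex.ofReal_ne_zero.2 hx) ?_
      linear_combination fderiv ℝ Z (γ ξ) (1, 0) * e2 - ((deriv γ ξ).2 : ℂ) * h1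
  have hconst : ∀ᶠ ξ in 𝓝 (0 : ℝ), ξ = 0 := by
    filter_upwards [eventually_eq_of_hasDerivAt_zero hder, hsec,
      hγt.eventually (hZ.isOpen.mem_nhds hpO)] with ξ h1 h2 h3
    rw [hγ0] at h1
    have h4 := hZ.injOn h3 hpO h1
    rw [← h2.1, h4, hSp]
  obtain ⟨ξ, h1, h2⟩ := ((hconst.filter_mono nhdsWithin_le_nhds).and
    (self_mem_nhdsWithin : {(0 : ℝ)}ᶜ ∈ 𝓝[≠] 0)).exists
  exact h2 h1

end FiniteType

/-! ### From local charts to one chart; the normal form along an arc -/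

section Assembly

/-- An injective map that is locally a homeomorphism onto an open set is a homeomorphism onto
an open set. -/
theorem exists_openPartialHomeomorph {X Y : Type*} [TopologicalSpace X] [Nonempty X]
    [TopologicalSpace Y] {Ψ : X → Y} {V : Set X} (hV : IsOpen V) (hinj : InjOn Ψ V)
    (hloc : ∀ x ∈ V, ∃ e : OpenPartialHomeomorph X Y, x ∈ e.source ∧ EqOn Ψ e e.source) :
    ∃ Φ : OpenPartialHomeomorph X Y, Φ.source = V ∧ (∀ x, Φ x = Ψ x) ∧ Φ.target = Ψ '' V ∧
      ∀ e : OpenPartialHomeomorph X Y, EqOn Ψ e e.source → ∀ x ∈ V, x ∈ e.source →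
        Φ.symm =ᶠ[𝓝 (Ψ x)] e.symm := by
  -- This equality of filters contains both continuity and openness of `Ψ` at `x`.
  have hnhds : ∀ x ∈ V, map Ψ (𝓝 x) = 𝓝 (Ψ x) := by
    intro x hx
    obtain ⟨e, hxe, he⟩ := hloc x hx
    rw [he hxe, ← e.map_nhds_eq hxe]
    exact map_congr (he.eventuallyEq_of_mem (e.open_source.mem_nhds hxe))
  have hcont : ContinuousOn Ψ V := fun x hx =>
    ContinuousAt.continuousWithinAt (hnhds x hx).le
  have hopen : IsOpenMap (V.domRestrict Ψ) := by
    rw [isOpenMap_iff_nhds_le]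
    rintro ⟨x, hx⟩
    have h1 : map ((↑) : V → X) (𝓝 ⟨x, hx⟩) = 𝓝 x := by
      rw [map_nhds_subtype_coe_eq_nhds hx (hV.mem_nhds hx)]
    have h2 : map (V.domRestrict Ψ) (𝓝 ⟨x, hx⟩) = map Ψ (𝓝 x) := by
      rw [← h1, map_map]; rfl
    rw [h2, hnhds x hx]
    rfl
  let Φ := OpenPartialHomeomorph.ofContinuousOpenRestrict (hinj.bijOn_image.toPartialEquiv Ψ V _)
    hcont hopen hV
  refine ⟨Φ, rfl, fun x => rfl, rfl, fun e he x hx hxe => ?_⟩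
  have hex : e.symm (Ψ x) = x := by rw [he hxe]; exact e.left_inv hxe
  have htx : Ψ x ∈ e.target := by rw [he hxe]; exact e.map_source hxe
  have ht : Tendsto e.symm (𝓝 (Ψ x)) (𝓝 x) := by
    have := e.continuousAt_symm htx
    rw [ContinuousAt, hex] at this
    exact this
  filter_upwards [e.open_target.mem_nhds htx, ht (hV.mem_nhds hx)] with z hz hzV
  have h1 : Φ (e.symm z) = z := (he (e.map_target hz)).trans (e.right_inv hz)
  have h2 : Φ.symm (Φ (e.symm z)) = e.symm z := Φ.left_inv hzV
  rwa [h1] at h2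

/-- Local charts in which the injective function `Z` equals `F` are restrictions of one chart,
near a compact set on which this chart is injective. -/
theorem exists_chart_near_compact {X : Type*} [TopologicalSpace X] [Nonempty X] {O : Set (ℝ × ℝ)}
    {Z : ℝ × ℝ → ℂ} (hZ : InjOn Z O) {F : X → ℂ} {K : Set X} (hK : IsCompact K)
    (P : OpenPartialHomeomorph X (ℝ × ℝ) → Prop)
    (hinj : InjOn (fun x => Function.invFunOn Z O (F x)) K)
    (hloc : ∀ x ∈ K, ∃ E : OpenPartialHomeomorph X (ℝ × ℝ), x ∈ E.source ∧ E.target ⊆ O ∧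
      (∀ x ∈ E.source, Z (E x) = F x) ∧ P E) :
    ∃ V, IsOpen V ∧ K ⊆ V ∧ ∀ V' ⊆ V, IsOpen V' →
      ∃ Φ : OpenPartialHomeomorph X (ℝ × ℝ), Φ.source = V' ∧ Φ.target ⊆ O ∧
        (∀ x, Φ x = Function.invFunOn Z O (F x)) ∧ (∀ x ∈ V', Z (Φ x) = F x) ∧
        ∀ x ∈ V', ∃ E : OpenPartialHomeomorph X (ℝ × ℝ), P E ∧ x ∈ E.source ∧
          Φ =ᶠ[𝓝 x] E ∧ Φ.symm =ᶠ[𝓝 (Φ x)] E.symm := by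
  -- The only candidate is `Z⁻¹ ∘ F`. Every local chart `E` with `Z ∘ E = F` coincides with it on
  -- its source, so no compatibility of charts has to be arranged.
  let Ψ : X → ℝ × ℝ := fun x => Function.invFunOn Z O (F x)
  have hEΨ : ∀ E : OpenPartialHomeomorph X (ℝ × ℝ), E.target ⊆ O →
      (∀ x ∈ E.source, Z (E x) = F x) → EqOn Ψ E E.source := by
    intro E hEO hE x hx
    simp only [Ψ]
    rw [← hE x hx]
    exact hZ.leftInvOn_invFunOn (hEO (E.map_source hx))
  -- A map that is injective on a compact set, and continuous and locally injective at its points,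
  -- is injective on a neighborhood of this set.
  obtain ⟨V₁, hV₁, hinj₁⟩ := hinj.exists_mem_nhdsSet hK (by
      intro x hx
      obtain ⟨E, hxE, hEO, hE, -⟩ := hloc x hx
      exact (E.continuousAt hxE).congr
        ((hEΨ E hEO hE).symm.eventuallyEq_of_mem (E.open_source.mem_nhds hxE))) (by
      intro x hx
      obtain ⟨E, hxE, hEO, hE, -⟩ := hloc x hx
      exact ⟨E.source, E.open_source.mem_nhds hxE, E.injOn.congr (hEΨ E hEO hE).symm⟩)
  obtain ⟨V₂, hV₂o, hKV₂, hV₂₁⟩ := mem_nhdsSet_iff_exists.1 hV₁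
  let W : Set X := {x | ∃ E : OpenPartialHomeomorph X (ℝ × ℝ), x ∈ E.source ∧ E.target ⊆ O ∧
    (∀ x ∈ E.source, Z (E x) = F x) ∧ P E}
  have hW : IsOpen W := isOpen_iff_mem_nhds.2 fun x ⟨E, hxE, hE⟩ =>
    mem_of_superset (E.open_source.mem_nhds hxE) fun x' hx' => ⟨E, hx', hE⟩
  refine ⟨V₂ ∩ W, hV₂o.inter hW, fun x hx => ⟨hKV₂ hx, hloc x hx⟩, fun V' hV' hV'o => ?_⟩
  obtain ⟨Φ, hΦs, hΦ, hΦt, hsymm⟩ := exists_openPartialHomeomorph (Ψ := Ψ) hV'o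
    (hinj₁.mono fun x hx => hV₂₁ (hV' hx).1) (fun x hx => by
      obtain ⟨E, hxE, hEO, hE, -⟩ := (hV' hx).2
      exact ⟨E, hxE, hEΨ E hEO hE⟩)
  refine ⟨Φ, hΦs, ?_, hΦ, fun x hx => ?_, fun x hx => ?_⟩
  · rw [hΦt]
    rintro _ ⟨x, hx, rfl⟩
    obtain ⟨E, hxE, hEO, hE, -⟩ := (hV' hx).2
    rw [hEΨ E hEO hE hxE]
    exact hEO (E.map_source hxE)
  · obtain ⟨E, hxE, hEO, hE, -⟩ := (hV' hx).2
    rw [hΦ, hEΨ E hEO hE hxE]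
    exact hE x hxE
  · obtain ⟨E, hxE, hEO, hE, hPE⟩ := (hV' hx).2
    have hEq := hEΨ E hEO hE
    refine ⟨E, hPE, hxE, ?_, ?_⟩
    · filter_upwards [E.open_source.mem_nhds hxE] with x' hx'
      rw [hΦ, hEq hx']
    · rw [hΦ]
      exact hsymm E hEq x hx hxE

theorem wedge_eq_zero_of_holomorphic {h : ℂ → ℂ} {f g : ℝ × ℝ → ℂ} {x : ℝ × ℝ}
    (hh : DifferentiableAt ℂ h (g x)) (hg : DifferentiableAt ℝ g x)
    (hf : f =ᶠ[𝓝 x] fun z => h (g z)) : wedge f g x = 0 := by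
  simp only [wedge, pdx, pdy, hf.fderiv_eq, fderiv_holomorphic_comp_apply hh hg]
  ring

theorem apply_eq_zero_of_holomorphic {h : ℂ → ℂ} {Z g : ℝ × ℝ → ℂ} {x : ℝ × ℝ}
    (hh : DifferentiableAt ℂ h (g x)) (hg : DifferentiableAt ℝ g x)
    (hf : Z =ᶠ[𝓝 x] fun z => h (g z)) : (vectorFieldOf Z).apply g x = 0 := by
  simp only [CVectorField.apply, vectorFieldOf, pdx, pdy, hf.fderiv_eq,
    fderiv_holomorphic_comp_apply hh hg]
  ring

/-- The local normal form is applied to `z ↦ H (α z + β)`; the affine change lets the arc length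
interval be rescaled to a prescribed one. -/
theorem IsStraightening.exists_chart {O : Set (ℝ × ℝ)} {Z : ℝ × ℝ → ℂ} (hZ : IsHypocomplex O Z)
    {k : ℕ} {p : ℝ × ℝ} (hp : p ∈ O) (htr : IsTransversalAt Z k p) {H : ℂ → ℂ} {α β s : ℝ}
    (hα : α ≠ 0) (hH : IsStraightening Z H (α * s + β) p) :
    Odd k ∧ ∃ E : OpenPartialHomeomorph (ℝ × ℝ) (ℝ × ℝ), (s, 0) ∈ E.source ∧ E.target ⊆ O ∧
      (∀ x ∈ E.source, Z (E x) = H (α * arcNormalForm k x + β)) ∧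
      AnalyticOnNhd ℝ E E.source ∧ AnalyticOnNhd ℝ E.symm E.target := by
  have hd := hH.deriv_ne_zero
  obtain ⟨han, -, ρ, hρ, hρp, hρZ⟩ := hH
  have hl : HasDerivAt (fun z : ℂ => α * z + β) (α : ℂ) (s : ℂ) := by
    simpa using ((hasDerivAt_id (s : ℂ)).const_mul (α : ℂ)).add_const (β : ℂ)
  have hs : ((α * s + β : ℝ) : ℂ) = (α : ℂ) * s + β := by push_cast; ring
  rw [hs] at han hd
  obtain ⟨hodd, e, hpe, hep, heO, hean, hean', heZ⟩ :=
    exists_local_normalForm hZ.isOpen hZ.analytic hZ.injOn hp htr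
      (H := fun z => H (α * z + β)) (s₀ := s) (ρ := fun q => (ρ q - β) / α)
      (han.fun_comp (f := fun z : ℂ => α * z + β)
        ((analyticAt_const.mul analyticAt_id).add analyticAt_const))
      (by
        have h1 : HasDerivAt (fun z => H (α * z + β)) (deriv H (α * s + β) * α) (s : ℂ) :=
          HasDerivAt.comp (h₂ := H) (s : ℂ) han.differentiableAt.hasDerivAt hl
        rw [h1.deriv]
        exact mul_ne_zero hd (Complex.ofReal_ne_zero.2 hα))
      ((hρ.self_of_nhds.sub continuousAt_const).div_const α)
      (by rw [hρp]; field_simp; ring)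
      (by
        filter_upwards [hρZ] with q h1 h2
        rw [h1 h2]
        congr 1
        have : (α : ℂ) ≠ 0 := Complex.ofReal_ne_zero.2 hα
        push_cast
        field_simp
        ring)
  refine ⟨hodd, e.symm, hep ▸ e.map_source hpe, heO, fun x hx => ?_, hean', hean⟩
  have := heZ _ (e.map_target hx)
  rwa [e.right_inv hx] at this

theorem charFun_eq_zero_of_mem {O : Set (ℝ × ℝ)} {L : CVectorField} {x : ℝ × ℝ}
    (hx : x ∈ L.regularCharSet O) : x ∈ O ∧ L.charFun x = 0 := hx.1

theorem arcNormalForm_ofReal {k : ℕ} (hk : k ≠ 0) (s : ℝ) : arcNormalForm k (s, 0) = s := by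
  simp [arcNormalForm, hk]

theorem differentiable_arcNormalForm (k : ℕ) : Differentiable ℝ (arcNormalForm k) := by
  have h1 : Differentiable ℝ fun x : ℝ × ℝ => (x.1 : ℂ) :=
    Complex.ofRealCLM.differentiable.comp differentiable_fst
  have h2 : Differentiable ℝ fun x : ℝ × ℝ => (x.2 : ℂ) :=
    Complex.ofRealCLM.differentiable.comp differentiable_snd
  exact h1.add ((h2.pow k).const_mul Complex.I)

theorem exists_arc_normalForm {O : Set (ℝ × ℝ)} {Z : ℝ × ℝ → ℂ} (hZ : IsHypocomplex O Z)
    {G : Set (ℝ × ℝ)} {p q : ℝ × ℝ} {k : ℕ} (hG : IsArc G p q)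
    (hGr : G ⊆ (vectorFieldOf Z).regularCharSet O)
    (hk : ∀ x ∈ G, (vectorFieldOf Z).HasTypeAt x k) :
    ∃ (ε δ : ℝ) (Φ : OpenPartialHomeomorph (ℝ × ℝ) (ℝ × ℝ)),
      0 < ε ∧ 0 < δ ∧
      Φ.source = rectangle ε δ ∧ Φ.target ⊆ O ∧
      AnalyticOnNhd ℝ Φ Φ.source ∧ AnalyticOnNhd ℝ Φ.symm Φ.target ∧
      Φ (-1, 0) = p ∧ Φ (1, 0) = q ∧ Φ '' (Set.Icc (-1) 1 ×ˢ {0}) = G ∧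
      (∀ x ∈ rectangle ε δ, wedge (fun z => Z (Φ z)) (arcNormalForm k) x = 0) ∧
      (∀ x ∈ Φ.target,
        (vectorFieldOf Z).apply (fun z => arcNormalForm k (Φ.symm z)) x = 0) := by
  obtain ⟨c, hc, hcinj, hcG, hc0, hc1⟩ := hG
  have hcm : ∀ τ ∈ Icc (0 : ℝ) 1, c τ ∈ G := fun τ hτ => hcG ▸ mem_image_of_mem c hτ
  have hcO : ∀ τ ∈ Icc (0 : ℝ) 1, c τ ∈ O ∧ (vectorFieldOf Z).charFun (c τ) = 0 := fun τ hτ =>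
    charFun_eq_zero_of_mem (hGr (hcm τ hτ))
  have htr : ∀ τ ∈ Icc (0 : ℝ) 1, IsTransversalAt Z k (c τ) := by
    intro τ hτ
    refine isTransversalAt_of_hasTypeAt hZ hGr hk (hcm τ hτ) ?_
    have hne := neBot_nhdsWithin_Icc_diff zero_lt_one hτ
    have h1 : Tendsto c (𝓝[Icc 0 1 \ {τ}] τ) (𝓝[≠] (c τ)) := by
      refine tendsto_nhdsWithin_iff.2 ⟨(hc τ hτ).mono_left (nhdsWithin_mono _ sdiff_subset), ?_⟩
      filter_upwards [self_mem_nhdsWithin] with t ht h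
      exact ht.2 (hcinj ht.1 hτ h)
    refine h1.frequently (Eventually.frequently ?_)
    filter_upwards [self_mem_nhdsWithin] with t ht using hcm t ht.1
  have hZc : InjOn (fun t => Z (c t)) (Icc 0 1) := fun t ht t' ht' h =>
    hcinj ht ht' (hZ.injOn (hcO t ht).1 (hcO t' ht').1 h)
  obtain ⟨σ, H, hσc, hσm, hH, hZH⟩ := exists_global_straightening zero_lt_one hc
    (fun t ht => (hcO t ht).2) (fun τ _ => ⟨_, self_mem_nhdsWithin, hZc⟩)
    (fun τ hτ => (htr τ hτ).exists_isStraightening (hZ.analytic _ (hcO τ hτ).1))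
  have h0 : (0 : ℝ) ∈ Icc (0 : ℝ) 1 := ⟨le_rfl, zero_le_one⟩
  have h1 : (1 : ℝ) ∈ Icc (0 : ℝ) 1 := ⟨zero_le_one, le_rfl⟩
  have hσ01 : σ 0 < σ 1 := hσm h0 h1 zero_lt_one
  -- The map `s ↦ α s + β` carries `[-1, 1]` onto `[σ 0, σ 1]`, so that `p` and `q` sit at `s = -1`
  -- and `s = 1`.
  let α : ℝ := (σ 1 - σ 0) / 2
  let β : ℝ := (σ 0 + σ 1) / 2
  have hα : 0 < α := by simp only [α]; linarith
  have hk0 : k ≠ 0 := by have := (htr 0 h0).1; omega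
  let F : ℝ × ℝ → ℂ := fun x => H (α * arcNormalForm k x + β)
  have hF : ∀ s τ, τ ∈ Icc (0 : ℝ) 1 → σ τ = α * s + β →
      Function.invFunOn Z O (F (s, 0)) = c τ := by
    intro s τ hτ hs
    have : F (s, 0) = Z (c τ) := by
      rw [hZH τ hτ, hs]
      simp only [F, arcNormalForm_ofReal hk0]
      push_cast; rfl
    rw [this]
    exact hZ.injOn.leftInvOn_invFunOn (hcO τ hτ).1
  have hsurj : ∀ s ∈ Icc (-1 : ℝ) 1, ∃ τ ∈ Icc (0 : ℝ) 1, σ τ = α * s + β := by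
    intro s hs
    obtain ⟨τ, hτ, h⟩ := intermediate_value_Icc zero_le_one hσc
      (show α * s + β ∈ Icc (σ 0) (σ 1) by
        simp only [α, β]
        constructor <;> nlinarith [hs.1, hs.2])
    exact ⟨τ, hτ, h⟩
  let K : Set (ℝ × ℝ) := Icc (-1) 1 ×ˢ {0}
  have hK : IsCompact K := isCompact_Icc.prod isCompact_singleton
  obtain ⟨V, hVo, hKV, hV⟩ := exists_chart_near_compact hZ.injOn (F := F) hK
    (fun E => AnalyticOnNhd ℝ E E.source ∧ AnalyticOnNhd ℝ E.symm E.target)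
    (by
      rintro ⟨s, t⟩ ⟨hs, rfl⟩ ⟨s', t'⟩ ⟨hs', rfl⟩ h
      obtain ⟨τ, hτ, e⟩ := hsurj s hs
      obtain ⟨τ', hτ', e'⟩ := hsurj s' hs'
      simp only at h
      rw [hF s τ hτ e, hF s' τ' hτ' e'] at h
      rw [hcinj hτ hτ' h, e'] at e
      have := mul_left_cancel₀ hα.ne' (add_right_cancel e)
      rw [this])
    (by
      rintro ⟨s, t⟩ ⟨hs, rfl⟩
      obtain ⟨τ, hτ, e⟩ := hsurj s hs
      have := hH τ hτ
      rw [e] at this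
      obtain ⟨-, E, h1, h2, h3, h4⟩ := this.exists_chart hZ (hcO τ hτ).1 (htr τ hτ) hα.ne'
      exact ⟨E, h1, h2, h3, h4⟩)
  have hcontN : Continuous fun x => (α : ℂ) * arcNormalForm k x + β :=
    (continuous_const.mul (differentiable_arcNormalForm k).continuous).add continuous_const
  have hWo : IsOpen {x : ℝ × ℝ | AnalyticAt ℂ H (α * arcNormalForm k x + β)} :=
    (isOpen_analyticAt ℂ H).preimage hcontN
  obtain ⟨δ, hδ, hthick⟩ := hK.exists_thickening_subset_open (hVo.inter hWo) (by
    rintro ⟨s, t⟩ ⟨hs, rfl⟩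
    refine ⟨hKV ⟨hs, rfl⟩, ?_⟩
    obtain ⟨τ, hτ, e⟩ := hsurj s hs
    have := (hH τ hτ).analyticAt
    rw [e] at this
    simp only [mem_ofPred_eq, arcNormalForm_ofReal hk0]
    push_cast at this
    exact this)
  -- The plane carries the sup metric, so the rectangle with `ε = δ` lies within distance `δ` of the
  -- segment: clamp `s` to `[-1, 1]`.
  have hrect : rectangle δ δ ⊆ Metric.thickening δ K := by
    rintro ⟨s, t⟩ ⟨hs, ht⟩
    simp only at hs ht
    rw [Metric.mem_thickening_iff]
    refine ⟨(max (-1) (min s 1), 0), ⟨⟨le_max_left _ _, max_le (by norm_num) (min_le_right _ _)⟩,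
      rfl⟩, ?_⟩
    rw [Prod.dist_eq, max_lt_iff, Real.dist_eq, Real.dist_eq, sub_zero, abs_lt, abs_lt]
    refine ⟨?_, ht⟩
    rcases le_total s 1 with h | h
    · rw [min_eq_left h]
      rcases le_total (-1) s with h' | h'
      · rw [max_eq_right h']; constructor <;> linarith
      · rw [max_eq_left h']; constructor <;> linarith [hs.1]
    · rw [min_eq_right h, max_eq_right (by norm_num)]; constructor <;> linarith [hs.2]
  have hro : IsOpen (rectangle δ δ) := isOpen_Ioo.prod isOpen_Ioo
  obtain ⟨Φ, hΦs, hΦO, hΦ, hΦZ, hΦloc⟩ := hV _ (fun x hx => (hthick (hrect hx)).1) hro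
  have hsymman : AnalyticOnNhd ℝ Φ.symm Φ.target := by
    intro z hz
    have hz' := Φ.map_target hz
    rw [hΦs] at hz'
    obtain ⟨E, ⟨-, hE⟩, hxE, hΦE, hsE⟩ := hΦloc _ hz'
    rw [Φ.right_inv hz] at hsE
    refine (hE z ?_).congr hsE.symm
    have := E.map_source hxE
    rwa [← hΦE.self_of_nhds, Φ.right_inv hz] at this
  refine ⟨δ, δ, Φ, hδ, hδ, hΦs, hΦO, ?_, hsymman, ?_, ?_, ?_, ?_, ?_⟩
  · intro x hx
    rw [hΦs] at hx
    obtain ⟨E, ⟨hE, -⟩, hxE, hΦE, -⟩ := hΦloc x hx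
    exact (hE x hxE).congr hΦE.symm
  · rw [hΦ, hF (-1) 0 h0 (by simp only [α, β]; ring), hc0]
  · rw [hΦ, hF 1 1 h1 (by simp only [α, β]; ring), hc1]
  · apply Subset.antisymm
    · rintro _ ⟨⟨s, t⟩, ⟨hs, rfl⟩, rfl⟩
      obtain ⟨τ, hτ, e⟩ := hsurj s hs
      rw [hΦ, hF s τ hτ e]
      exact hcm τ hτ
    · rw [← hcG]
      rintro _ ⟨τ, hτ, rfl⟩
      have hl : σ 0 ≤ σ τ := hσm.monotoneOn h0 hτ hτ.1
      have hr : σ τ ≤ σ 1 := hσm.monotoneOn hτ h1 hτ.2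
      refine ⟨((σ τ - β) / α, 0), ⟨⟨?_, ?_⟩, rfl⟩, ?_⟩
      · rw [le_div_iff₀ hα]; simp only [α, β]; linarith
      · rw [div_le_iff₀ hα]; simp only [α, β]; linarith
      · rw [hΦ, hF _ τ hτ (by field_simp; ring)]
  · intro x hx
    have han : AnalyticAt ℂ H (α * arcNormalForm k x + β) := (hthick (hrect hx)).2
    refine wedge_eq_zero_of_holomorphic (h := fun z => H (α * z + β)) ?_
      (differentiable_arcNormalForm k x) ?_
    · exact (han.fun_comp (f := fun z : ℂ => α * z + β)
        ((analyticAt_const.mul analyticAt_id).add analyticAt_const)).differentiableAt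
    · filter_upwards [hro.mem_nhds hx] with z hz
      exact hΦZ z hz
  · intro x hx
    have hx' := Φ.map_target hx
    rw [hΦs] at hx'
    have han : AnalyticAt ℂ H (α * arcNormalForm k (Φ.symm x) + β) := (hthick (hrect hx')).2
    refine apply_eq_zero_of_holomorphic (h := fun z => H (α * z + β)) ?_ ?_ ?_
    · exact (han.fun_comp (f := fun z : ℂ => α * z + β)
        ((analyticAt_const.mul analyticAt_id).add analyticAt_const)).differentiableAt
    · exact (differentiable_arcNormalForm k _).comp x (hsymman x hx).differentiableAt
    · filter_upwards [Φ.open_target.mem_nhds hx] with z hz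
      have hz' := Φ.map_target hz
      rw [hΦs] at hz'
      have := hΦZ _ hz'
      rwa [Φ.right_inv hz] at this

end Assembly

/-! ### The circle, the cylinder and descent through the exponential -/

section ClosedCurve

theorem contMDiff_coe_circle :
    ContMDiff (𝓡 1) 𝓘(ℝ, ℂ) ω (fun ξ : Circle => (ξ : ℂ)) := by
  have : Fact (Module.finrank ℝ ℂ = 1 + 1) := finrank_real_complex_fact'
  exact contMDiff_coe_sphere

/-- Near `ξ₁` a local inverse of the covering is `e.symm ξ₁ + arg (ξ / ξ₁)`, and the logarithm is
only used near `1`, where it is analytic. -/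
theorem contMDiffOn_symm_of_circleExp (e : OpenPartialHomeomorph ℝ Circle)
    (he : ∀ θ ∈ e.source, e θ = Circle.exp θ) :
    ContMDiffOn (𝓡 1) 𝓘(ℝ, ℝ) ω e.symm e.target := by
  intro ξ₁ hξ₁
  refine ContMDiffAt.contMDiffWithinAt ?_
  let g : Circle → ℝ := fun ξ => e.symm ξ₁ + (Complex.log ((ξ : ℂ) * (ξ₁ : ℂ)⁻¹)).im
  have hg₁ : g ξ₁ = e.symm ξ₁ := by simp [g]
  have hg : ContMDiffAt (𝓡 1) 𝓘(ℝ, ℝ) ω g ξ₁ := by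
    have hl : ContDiffAt ℝ ω (fun z : ℂ => e.symm ξ₁ + (Complex.log (z * (ξ₁ : ℂ)⁻¹)).im) ξ₁ := by
      apply contDiffAt_const.add
      have h1 : ContDiffAt ℂ ω (fun z : ℂ => Complex.log (z * (ξ₁ : ℂ)⁻¹)) ξ₁ :=
        ((analyticAt_id.mul analyticAt_const).clog (by simp)).contDiffAt
      exact ContDiffAt.comp (g := Complex.im) (ξ₁ : ℂ) Complex.imCLM.contDiff.contDiffAt
        (h1.restrict_scalars ℝ)
    exact (hl.contMDiffAt).comp ξ₁ contMDiff_coe_circle.contMDiffAt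
  refine hg.congr_of_eventuallyEq ?_
  have hsrc : ∀ᶠ ξ in 𝓝 ξ₁, g ξ ∈ e.source :=
    hg.continuousAt (hg₁ ▸ e.open_source.mem_nhds (e.map_target hξ₁))
  filter_upwards [hsrc] with ξ hξ
  have h1 : e (g ξ) = ξ := by
    have h2 := Circle.exp_arg (ξ * ξ₁⁻¹)
    have h3 : Circle.exp (e.symm ξ₁) = ξ₁ := by
      rw [← he _ (e.map_target hξ₁), e.right_inv hξ₁]
    rw [he _ hξ]
    simp only [g, Complex.log_im]
    rw [Circle.exp_add, h3, ← Circle.coe_inv, ← Circle.coe_mul, h2, mul_comm, inv_mul_cancel_right]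
  conv_lhs => rw [← h1]
  exact e.left_inv hξ

/-- The reflection `t ↦ -t` corrects a sign: `exp (i (θ + i t ^ k))` equals `exp (-t ^ k + i θ)`,
while the normal form has `+t ^ k`, and `k` is odd. -/
theorem exists_cylinder_chart {E : OpenPartialHomeomorph (ℝ × ℝ) (ℝ × ℝ)}
    (hE : AnalyticOnNhd ℝ E E.source) (hE' : AnalyticOnNhd ℝ E.symm E.target) {θ₀ : ℝ}
    (hθ₀ : (θ₀, 0) ∈ E.source) :
    ∃ E' : OpenPartialHomeomorph (Circle × ℝ) (ℝ × ℝ), (Circle.exp θ₀, 0) ∈ E'.source ∧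
      E'.target ⊆ E.target ∧
      (∀ x ∈ E'.source, ∃ θ, Circle.exp θ = x.1 ∧ (θ, -x.2) ∈ E.source ∧ E' x = E (θ, -x.2)) ∧
      ContMDiffOn ((𝓡 1).prod 𝓘(ℝ, ℝ)) 𝓘(ℝ, ℝ × ℝ) ω E' E'.source ∧
      ContMDiffOn 𝓘(ℝ, ℝ × ℝ) ((𝓡 1).prod 𝓘(ℝ, ℝ)) ω E'.symm E'.target := by
  obtain ⟨e, hθe, he⟩ := isLocalHomeomorph_circleExp θ₀
  have heθ : ∀ θ, e θ = Circle.exp θ := fun θ => by rw [he]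
  have hes := contMDiffOn_symm_of_circleExp e fun θ _ => heθ θ
  let f := e.symm.prod (Homeomorph.neg ℝ).toOpenPartialHomeomorph
  refine ⟨f.trans E, ?_, ?_, ?_, ?_, ?_⟩
  · rw [OpenPartialHomeomorph.trans_source, ← heθ]
    refine ⟨⟨e.map_source hθe, mem_univ _⟩, ?_⟩
    simp only [mem_preimage]
    have : f (e θ₀, 0) = (θ₀, 0) := Prod.ext (e.left_inv hθe) neg_zero
    rwa [this]
  · rw [OpenPartialHomeomorph.trans_target]
    exact inter_subset_left
  · rintro ⟨ξ, t⟩ hx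
    rw [OpenPartialHomeomorph.trans_source] at hx
    exact ⟨e.symm ξ, by rw [← heθ]; exact e.right_inv hx.1.1, hx.2, rfl⟩
  · rintro ⟨ξ, t⟩ hx
    rw [OpenPartialHomeomorph.trans_source] at hx
    refine ContMDiffAt.contMDiffWithinAt ?_
    have h1 : ContMDiffAt ((𝓡 1).prod 𝓘(ℝ, ℝ)) 𝓘(ℝ, ℝ) ω
        (fun x : Circle × ℝ => e.symm x.1) (ξ, t) :=
      ContMDiffAt.comp (I' := 𝓡 1) (g := e.symm) (f := Prod.fst) (ξ, t)
        (hes.contMDiffAt (e.open_target.mem_nhds hx.1.1)) contMDiffAt_fst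
    have h2 : ContMDiffAt ((𝓡 1).prod 𝓘(ℝ, ℝ)) 𝓘(ℝ, ℝ) ω
        (fun x : Circle × ℝ => -x.2) (ξ, t) :=
      ContMDiffAt.comp (I' := 𝓘(ℝ, ℝ)) (g := fun y : ℝ => -y) (f := Prod.snd) (ξ, t)
        contDiff_neg.contMDiff.contMDiffAt contMDiffAt_snd
    exact ContMDiffAt.comp (I' := 𝓘(ℝ, ℝ × ℝ)) (g := E) (f := fun x => (e.symm x.1, -x.2)) (ξ, t)
      (hE _ hx.2).contDiffAt.contMDiffAt (h1.prodMk_space h2)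
  · intro y hy
    rw [OpenPartialHomeomorph.trans_target] at hy
    refine ContMDiffAt.contMDiffWithinAt ?_
    have h0 : ContDiffAt ℝ ω E.symm y := (hE' y hy.1).contDiffAt
    have h1 : ContMDiffAt 𝓘(ℝ, ℝ × ℝ) (𝓡 1) ω (fun y => Circle.exp (E.symm y).1) y :=
      ContMDiffAt.comp (I' := 𝓘(ℝ, ℝ)) (g := Circle.exp) (f := fun y => (E.symm y).1) y
        contMDiff_circleExp.contMDiffAt h0.fst.contMDiffAt
    have h2 : ContMDiffAt 𝓘(ℝ, ℝ × ℝ) 𝓘(ℝ, ℝ) ω (fun y => -(E.symm y).2) y :=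
      h0.snd.neg.contMDiffAt
    refine (h1.prodMk h2).congr_of_eventuallyEq (Eventually.of_forall fun z => ?_)
    exact Prod.ext (heθ _) rfl

/-- The function on the plane obtained from a periodic function of the angular variable. -/
def descend (h : ℂ → ℂ) (ζ : ℂ) : ℂ := h (-Complex.I * Complex.log ζ)

/-- The principal logarithm inverts `w ↦ exp (i w)` where `Re w` lies in `(-π, π]`. At `θ = π`, the
points with `Re w > π` are brought back by `2π`, and there the periodicity near `-π` is used. -/
theorem eventually_descend_exp {h : ℂ → ℂ}
    (hper : ∀ᶠ w in 𝓝 ((-Real.pi : ℝ) : ℂ), h w = h (w + 2 * Real.pi)) {θ : ℝ}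
    (hθ : θ ∈ Ioc (-Real.pi) Real.pi) :
    ∀ᶠ w in 𝓝 (θ : ℂ), descend h (Complex.exp (Complex.I * w)) = h w := by
  have hlt : ∀ᶠ w : ℂ in 𝓝 (θ : ℂ), -Real.pi < w.re :=
    Complex.continuous_re.continuousAt.eventually (lt_mem_nhds (by simpa using hθ.1))
  have hII : -Complex.I * Complex.I = 1 := by simp
  have hin : ∀ w : ℂ, -Real.pi < w.re → w.re ≤ Real.pi →
      descend h (Complex.exp (Complex.I * w)) = h w := by
    intro w h1 h2
    rw [descend, Complex.log_exp (by simpa using h1) (by simpa using h2), ← mul_assoc, hII, one_mul]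
  rcases hθ.2.lt_or_eq with hlt' | rfl
  · filter_upwards [hlt, Complex.continuous_re.continuousAt.eventually
      (gt_mem_nhds (show (θ : ℂ).re < Real.pi by simpa using hlt'))] with w h1 h2
    exact hin w h1 h2.le
  · have ht : Tendsto (fun w : ℂ => w - 2 * Real.pi) (𝓝 (Real.pi : ℂ))
        (𝓝 ((-Real.pi : ℝ) : ℂ)) := by
      have : ((-Real.pi : ℝ) : ℂ) = (Real.pi : ℂ) - 2 * Real.pi := by push_cast; ring
      rw [this]
      exact (continuous_id.sub continuous_const).tendsto _
    have hlt3 : ∀ᶠ w : ℂ in 𝓝 (Real.pi : ℂ), w.re < 3 * Real.pi :=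
      Complex.continuous_re.continuousAt.eventually
        (gt_mem_nhds (by simp only [Complex.ofReal_re]; linarith [Real.pi_pos]))
    filter_upwards [hlt, ht.eventually hper, hlt3] with w h1 h2 h3
    rcases le_or_gt w.re Real.pi with h4 | h4
    · exact hin w h1 h4
    · rw [sub_add_cancel] at h2
      have hre : (w - 2 * Real.pi).re = w.re - 2 * Real.pi := by simp
      rw [← h2, ← hin (w - 2 * Real.pi) (by rw [hre]; linarith) (by rw [hre]; linarith)]
      congr 1
      rw [Complex.exp_eq_exp_iff_exists_int]
      exact ⟨1, by push_cast; ring⟩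

/-- Near `ξ`, `descend h` agrees with `h` composed with the branch `θ - i log (ζ / ξ)`, which is
analytic even at `ξ = -1`, where the principal logarithm jumps. -/
theorem analyticAt_descend {h : ℂ → ℂ}
    (hper : ∀ᶠ w in 𝓝 ((-Real.pi : ℝ) : ℂ), h w = h (w + 2 * Real.pi)) {θ : ℝ}
    (hθ : θ ∈ Ioc (-Real.pi) Real.pi) (hh : AnalyticAt ℂ h θ) :
    AnalyticAt ℂ (descend h) (Circle.exp θ : ℂ) := by
  set ξ : ℂ := (Circle.exp θ : ℂ) with hξ
  have hξe : ξ = Complex.exp (Complex.I * θ) := by rw [hξ, Circle.coe_exp, mul_comm]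
  have hξ0 : ξ ≠ 0 := Circle.coe_ne_zero _
  let w : ℂ → ℂ := fun ζ => θ - Complex.I * Complex.log (ζ * ξ⁻¹)
  have hwξ : w ξ = θ := by simp [w, hξ0]
  have hw : AnalyticAt ℂ w ξ := by
    refine analyticAt_const.sub (analyticAt_const.mul ?_)
    exact (analyticAt_id.mul analyticAt_const).clog (by simp [hξ0])
  have hc : AnalyticAt ℂ (fun ζ => h (w ζ)) ξ :=
    AnalyticAt.fun_comp (g := h) (f := w) (by rwa [hwξ]) hw
  refine hc.congr ?_
  have ht : Tendsto w (𝓝 ξ) (𝓝 (θ : ℂ)) := by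
    have := hw.continuousAt.tendsto
    rwa [hwξ] at this
  filter_upwards [ht.eventually (eventually_descend_exp hper hθ),
    isOpen_ne.mem_nhds hξ0] with ζ h1 h2
  rw [← h1]
  congr 1
  simp only [w]
  rw [mul_sub, ← mul_assoc, Complex.I_mul_I, neg_one_mul, sub_neg_eq_add, Complex.exp_add, ← hξe,
    Complex.exp_log (mul_ne_zero h2 (inv_ne_zero hξ0))]
  field_simp

theorem closedNormalForm_zero {k : ℕ} (hk : k ≠ 0) (ξ : Circle) :
    closedNormalForm k (ξ, 0) = ξ := by
  simp [closedNormalForm, hk]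

theorem exp_arcNormalForm {k : ℕ} (hk : Odd k) (θ t : ℝ) :
    Complex.exp (Complex.I * arcNormalForm k (θ, -t)) = closedNormalForm k (Circle.exp θ, t) := by
  simp only [arcNormalForm, closedNormalForm, Circle.coe_exp, ← Complex.exp_add]
  congr 1
  push_cast
  rw [hk.neg_pow, mul_add, ← mul_assoc, Complex.I_mul_I]
  ring

theorem continuous_closedNormalForm (k : ℕ) : Continuous (closedNormalForm k) :=
  (Complex.continuous_exp.comp ((Complex.continuous_ofReal.comp continuous_snd).pow k)).mul
    (continuous_subtype_val.comp continuous_fst)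

theorem contMDiff_closedNormalForm (k : ℕ) :
    ContMDiff ((𝓡 1).prod 𝓘(ℝ, ℝ)) 𝓘(ℝ, ℂ) ω (closedNormalForm k) := by
  have h1 : ContMDiff ((𝓡 1).prod 𝓘(ℝ, ℝ)) 𝓘(ℝ, ℂ) ω (fun x : Circle × ℝ => (x.1 : ℂ)) :=
    ContMDiff.comp (I' := 𝓡 1) (g := fun ξ : Circle => (ξ : ℂ)) (f := Prod.fst)
      contMDiff_coe_circle contMDiff_fst
  have h2 : ContDiff ℝ ω (fun t : ℝ => Complex.exp ((t : ℂ) ^ k)) :=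
    (Complex.ofRealCLM.contDiff.pow k).cexp
  have h3 : ContMDiff ((𝓡 1).prod 𝓘(ℝ, ℝ)) 𝓘(ℝ, ℂ) ω
      (fun x : Circle × ℝ => Complex.exp ((x.2 : ℂ) ^ k)) :=
    ContMDiff.comp (I' := 𝓘(ℝ, ℝ)) (g := fun t : ℝ => Complex.exp ((t : ℂ) ^ k)) (f := Prod.snd)
      h2.contMDiff contMDiff_snd
  have h4 : ContDiff ℝ ω (fun z : ℂ × ℂ => z.1 * z.2) := contDiff_mul
  exact ContMDiff.comp (I' := 𝓘(ℝ, ℂ × ℂ)) (g := fun z : ℂ × ℂ => z.1 * z.2)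
    h4.contMDiff (h3.prodMk_space h1)

theorem differentiable_closedNormalForm_angular (k : ℕ) :
    Differentiable ℝ fun x : ℝ × ℝ => closedNormalForm k (angular x) := by
  have h : (fun x : ℝ × ℝ => closedNormalForm k (angular x)) =
      fun x => Complex.exp ((x.2 : ℂ) ^ k) * Complex.exp (x.1 * Complex.I) := by
    funext x
    simp only [closedNormalForm, angular, Circle.coe_exp]
  rw [h]
  have h1 : Differentiable ℝ fun x : ℝ × ℝ => (x.1 : ℂ) :=
    Complex.ofRealCLM.differentiable.comp differentiable_fst
  have h2 : Differentiable ℝ fun x : ℝ × ℝ => (x.2 : ℂ) :=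
    Complex.ofRealCLM.differentiable.comp differentiable_snd
  exact (h2.pow k).cexp.mul (h1.mul_const Complex.I).cexp

theorem injOn_circleExp (τ : ℝ) : InjOn Circle.exp (Metric.ball τ 1) := by
  intro x hx y hy h
  obtain ⟨m, hm⟩ := Circle.exp_eq_exp.1 h
  have hxy : |x - y| < 2 := by
    have h1 := dist_triangle_right x y τ
    rw [Real.dist_eq] at h1
    linarith [Metric.mem_ball.1 hx, Metric.mem_ball.1 hy]
  have hm0 : m = 0 := by
    by_contra hne
    have h1 : (1 : ℝ) ≤ |(m : ℝ)| := by exact_mod_cast Int.one_le_abs hne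
    rw [hm, add_sub_cancel_left, abs_mul, abs_of_pos Real.two_pi_pos] at hxy
    nlinarith [Real.pi_gt_three]
  rw [hm, hm0]
  simp

end ClosedCurve

/-! ### The normal form along a closed curve -/

section ClosedNormalForm

/-- A straightening along the closed curve `c ∘ exp`, normalised to have period `2π`. -/
theorem exists_periodic_straightening {Z : ℝ × ℝ → ℂ} {c : Circle → ℝ × ℝ} (hc : Continuous c)
    (hchar : ∀ ξ, (vectorFieldOf Z).charFun (c ξ) = 0) (hinj : Function.Injective fun ξ => Z (c ξ))
    (hst : ∀ ξ, ∃ H, IsStraightening Z H 0 (c ξ)) :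
    ∃ (α β : ℝ) (H : ℂ → ℂ) (σ : ℝ → ℝ), 0 < α ∧
      ContinuousOn σ (Icc (-Real.pi) Real.pi) ∧ StrictMonoOn σ (Icc (-Real.pi) Real.pi) ∧
      σ (-Real.pi) = α * (-Real.pi) + β ∧ σ Real.pi = α * Real.pi + β ∧
      (∀ τ ∈ Icc (-Real.pi) Real.pi, IsStraightening Z H (σ τ) (c (Circle.exp τ)) ∧
        Z (c (Circle.exp τ)) = H (σ τ)) ∧
      ∀ᶠ w in 𝓝 ((-Real.pi : ℝ) : ℂ), H (α * w + β) = H (α * (w + 2 * Real.pi) + β) := by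
  have hπ := Real.pi_pos
  -- The interval exceeds a full turn by length `1`. The curve is covered twice over `J` and `J +
  -- 2π`, and comparing the two unit speed parametrizations there yields the period.
  obtain ⟨σ, H, hσc, hσm, hH, hZH⟩ := exists_global_straightening (Z := Z)
    (A := -Real.pi) (B := Real.pi + 1) (by linarith) (c := fun τ => c (Circle.exp τ))
    (hc.comp Circle.exp.continuous).continuousOn (fun τ _ => hchar _)
    (fun τ _ => ⟨Metric.ball τ 1, mem_nhdsWithin_of_mem_nhds (Metric.ball_mem_nhds τ one_pos),
      fun x hx y hy h => injOn_circleExp τ hx hy (hinj h)⟩)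
    (fun τ _ => hst _)
  have hsub : Icc (-Real.pi) Real.pi ⊆ Icc (-Real.pi) (Real.pi + 1) :=
    Icc_subset_Icc_right (by linarith)
  have hm : -Real.pi ∈ Icc (-Real.pi) Real.pi := ⟨le_rfl, by linarith⟩
  have hp : Real.pi ∈ Icc (-Real.pi) Real.pi := ⟨by linarith, le_rfl⟩
  have hlt : σ (-Real.pi) < σ Real.pi := hσm (hsub hm) (hsub hp) (by linarith)
  let J : Set ℝ := Icc (-Real.pi) (-Real.pi + 1)
  have hJ : -Real.pi ∈ J := ⟨le_rfl, by linarith⟩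
  have hJ₀ : J ⊆ Icc (-Real.pi) (Real.pi + 1) := Icc_subset_Icc_right (by linarith)
  have hJ₁ : ∀ t ∈ J, t + 2 * Real.pi ∈ Icc (-Real.pi) (Real.pi + 1) := fun t ht =>
    ⟨by linarith [ht.1], by linarith [ht.2]⟩
  have hshift : -Real.pi + 2 * Real.pi = Real.pi := by ring
  have hper := (unitSpeed_unique (hH _ (hsub hm)).analyticAt (hH _ (hsub hp)).analyticAt
    (hH _ (hsub hm)).unitSpeed (hH _ (hsub hp)).unitSpeed hJ
    (neBot_nhdsWithin_Icc_diff (by linarith) hJ) (r₀ := σ) (r₁ := fun t => σ (t + 2 * Real.pi))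
    rfl (by simp only [hshift]) ((hσc _ (hsub hm)).mono hJ₀)
    (by
      refine ContinuousWithinAt.comp (t := Icc (-Real.pi) (Real.pi + 1)) ?_
        (continuous_id.add continuous_const).continuousWithinAt hJ₁
      exact hσc _ (hJ₁ _ hJ))
    ⟨J, self_mem_nhdsWithin, hσm.mono hJ₀⟩
    ⟨J, self_mem_nhdsWithin, fun x hx y hy h => hσm (hJ₁ x hx) (hJ₁ y hy) (by linarith)⟩
    (by
      filter_upwards [self_mem_nhdsWithin] with t ht
      rw [← hZH t (hJ₀ ht), ← hZH _ (hJ₁ t ht), Circle.exp_add, Circle.exp_two_pi, mul_one])).1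
  refine ⟨(σ Real.pi - σ (-Real.pi)) / (2 * Real.pi), (σ (-Real.pi) + σ Real.pi) / 2, H, σ,
    div_pos (by linarith) (by linarith), hσc.mono hsub, hσm.mono hsub, by field_simp; ring,
    by field_simp; ring, fun τ hτ => ⟨hH τ (hsub hτ), hZH τ (hsub hτ)⟩, ?_⟩
  set α := (σ Real.pi - σ (-Real.pi)) / (2 * Real.pi) with hα
  set β := (σ (-Real.pi) + σ Real.pi) / 2 with hβ
  have hπ' : (Real.pi : ℂ) ≠ 0 := Complex.ofReal_ne_zero.2 hπ.ne'
  have ht : Tendsto (fun w : ℂ => (α : ℂ) * w + β) (𝓝 ((-Real.pi : ℝ) : ℂ))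
      (𝓝 (σ (-Real.pi) : ℂ)) := by
    have h1 : ((σ (-Real.pi) : ℝ) : ℂ) = (α : ℂ) * ((-Real.pi : ℝ) : ℂ) + β := by
      rw [← Complex.ofReal_mul, ← Complex.ofReal_add, hα, hβ]
      congr 1
      field_simp
      ring
    rw [h1]
    exact ((continuous_const.mul continuous_id).add continuous_const).tendsto _
  filter_upwards [ht.eventually hper] with w hw
  rw [hw, hα, hβ]
  congr 1
  push_cast
  field_simp
  ring

theorem exists_closed_normalForm {O : Set (ℝ × ℝ)} {Z : ℝ × ℝ → ℂ} (hZ : IsHypocomplex O Z)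
    {Γ : Set (ℝ × ℝ)} {k : ℕ} (hΓ : IsClosedCurve Γ)
    (hΓr : Γ ⊆ (vectorFieldOf Z).regularCharSet O)
    (hk : ∀ x ∈ Γ, (vectorFieldOf Z).HasTypeAt x k) :
    ∃ (δ : ℝ) (Φ : OpenPartialHomeomorph (Circle × ℝ) (ℝ × ℝ)),
      0 < δ ∧
      Φ.source = Set.univ ×ˢ Set.Ioo (-δ) δ ∧ Φ.target ⊆ O ∧
      ContMDiffOn ((𝓡 1).prod 𝓘(ℝ, ℝ)) 𝓘(ℝ, ℝ × ℝ) ω Φ Φ.source ∧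
      ContMDiffOn 𝓘(ℝ, ℝ × ℝ) ((𝓡 1).prod 𝓘(ℝ, ℝ)) ω Φ.symm Φ.target ∧
      Φ '' (Set.univ ×ˢ {0}) = Γ ∧
      (∀ x ∈ (Set.univ ×ˢ Set.Ioo (-δ) δ : Set (ℝ × ℝ)),
        wedge (fun z => Z (Φ (angular z))) (fun z => closedNormalForm k (angular z)) x = 0) ∧
      (∀ x ∈ Φ.target,
        (vectorFieldOf Z).apply (fun z => closedNormalForm k (Φ.symm z)) x = 0) := by
  obtain ⟨c, hc, hcinj, hcΓ⟩ := hΓ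
  have hcm : ∀ ξ, c ξ ∈ Γ := fun ξ => hcΓ ▸ mem_range_self ξ
  have hcO : ∀ ξ, c ξ ∈ O ∧ (vectorFieldOf Z).charFun (c ξ) = 0 := fun ξ =>
    charFun_eq_zero_of_mem (hΓr (hcm ξ))
  have htr : ∀ ξ, IsTransversalAt Z k (c ξ) := by
    intro ξ
    refine isTransversalAt_of_hasTypeAt hZ hΓr hk (hcm ξ) ?_
    let c' : ℝ → ℝ × ℝ := fun τ => c (Circle.exp τ)
    have hc' : Continuous c' := hc.comp Circle.exp.continuous
    obtain ⟨τ, rfl⟩ := Circle.exp_surjective ξ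
    have h1 : Tendsto c' (𝓝[≠] τ) (𝓝[≠] (c' τ)) := by
      refine tendsto_nhdsWithin_iff.2 ⟨hc'.continuousAt.tendsto.mono_left nhdsWithin_le_nhds, ?_⟩
      filter_upwards [self_mem_nhdsWithin,
        mem_nhdsWithin_of_mem_nhds (Metric.ball_mem_nhds τ one_pos)] with t ht ht' h
      exact ht (injOn_circleExp τ ht' (Metric.mem_ball_self one_pos) (hcinj h))
    exact h1.frequently (Eventually.frequently (Eventually.of_forall fun t => hcm _))
  have hk0 : k ≠ 0 := by have := (htr 1).1; omega
  obtain ⟨α, β, H, σ, hα, hσc, hσm, hσ₀, hσ₁, hH, hper⟩ := exists_periodic_straightening hc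
    (fun ξ => (hcO ξ).2) (fun ξ ξ' h => hcinj (hZ.injOn (hcO ξ).1 (hcO ξ').1 h))
    (fun ξ => (htr ξ).exists_isStraightening (hZ.analytic _ (hcO ξ).1))
  have hπ := Real.pi_pos
  let h : ℂ → ℂ := fun w => H (α * w + β)
  -- The new angle `θ` is the arc length normalized to total `2π`, not the angle `τ` of the given
  -- parametrization. The half-open interval gives each point of the circle one angle.
  have hsurj : ∀ θ ∈ Ioc (-Real.pi) Real.pi, ∃ τ ∈ Ioc (-Real.pi) Real.pi, σ τ = α * θ + β := by
    intro θ hθ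
    obtain ⟨τ, hτ, e⟩ := intermediate_value_Icc (by linarith) hσc
      (show α * θ + β ∈ Icc (σ (-Real.pi)) (σ Real.pi) by
        rw [hσ₀, hσ₁]
        constructor <;> nlinarith [hθ.1, hθ.2])
    refine ⟨τ, ⟨lt_of_le_of_ne hτ.1 ?_, hτ.2⟩, e⟩
    rintro rfl
    rw [hσ₀] at e
    exact hθ.1.ne (mul_left_cancel₀ hα.ne' (add_right_cancel e))
  have harg : ∀ ξ : Circle, Complex.arg ξ ∈ Ioc (-Real.pi) Real.pi := fun ξ =>
    ⟨Complex.neg_pi_lt_arg _, Complex.arg_le_pi _⟩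
  have hhan : ∀ θ ∈ Ioc (-Real.pi) Real.pi, AnalyticAt ℂ h θ := by
    intro θ hθ
    obtain ⟨τ, hτ, e⟩ := hsurj θ hθ
    have := (hH τ (Ioc_subset_Icc_self hτ)).1.analyticAt
    rw [e] at this
    push_cast at this
    exact AnalyticAt.fun_comp (f := fun z : ℂ => α * z + β) this
      ((analyticAt_const.mul analyticAt_id).add analyticAt_const)
  have hdes := fun {θ : ℝ} => eventually_descend_exp (h := h) hper (θ := θ)
  let F : Circle × ℝ → ℂ := fun x => descend h (closedNormalForm k x)
  have hF : ∀ (ξ : Circle) (τ : ℝ), τ ∈ Ioc (-Real.pi) Real.pi → σ τ = α * Complex.arg ξ + β →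
      Function.invFunOn Z O (F (ξ, 0)) = c (Circle.exp τ) := by
    intro ξ τ hτ e
    have h1 := (hdes (harg ξ)).self_of_nhds
    rw [mul_comm, ← Circle.coe_exp, Circle.exp_arg] at h1
    have : F (ξ, 0) = Z (c (Circle.exp τ)) := by
      rw [(hH τ (Ioc_subset_Icc_self hτ)).2, e]
      simp only [F, closedNormalForm_zero hk0, h1, h]
      push_cast; rfl
    rw [this]
    exact hZ.injOn.leftInvOn_invFunOn (hcO _).1
  let K : Set (Circle × ℝ) := univ ×ˢ {0}
  have hK : IsCompact K := isCompact_univ.prod isCompact_singleton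
  obtain ⟨V, hVo, hKV, hV⟩ := exists_chart_near_compact hZ.injOn (F := F) hK
    (fun E => ContMDiffOn ((𝓡 1).prod 𝓘(ℝ, ℝ)) 𝓘(ℝ, ℝ × ℝ) ω E E.source ∧
      ContMDiffOn 𝓘(ℝ, ℝ × ℝ) ((𝓡 1).prod 𝓘(ℝ, ℝ)) ω E.symm E.target)
    (by
      rintro ⟨ξ, t⟩ ⟨-, rfl⟩ ⟨ξ', t'⟩ ⟨-, rfl⟩ heq
      obtain ⟨τ, hτ, e⟩ := hsurj _ (harg ξ)
      obtain ⟨τ', hτ', e'⟩ := hsurj _ (harg ξ')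
      simp only at heq
      rw [hF ξ τ hτ e, hF ξ' τ' hτ' e'] at heq
      have hτe := congrArg (fun ζ : Circle => Complex.arg ζ) (hcinj heq)
      simp only [Circle.arg_exp hτ.1 hτ.2, Circle.arg_exp hτ'.1 hτ'.2] at hτe
      rw [hτe, e'] at e
      rw [Circle.injective_arg (mul_left_cancel₀ hα.ne' (add_right_cancel e))])
    (by
      rintro ⟨ξ, t⟩ ⟨-, rfl⟩
      obtain ⟨τ, hτ, e⟩ := hsurj _ (harg ξ)
      have hst := (hH τ (Ioc_subset_Icc_self hτ)).1
      rw [e] at hst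
      obtain ⟨hodd, E, hsE, hEO, hEZ, hE, hE'⟩ := hst.exists_chart hZ (hcO _).1 (htr _) hα.ne'
      have hN : ContinuousAt (arcNormalForm k) (Complex.arg ξ, 0) :=
        (differentiable_arcNormalForm k).continuous.continuousAt
      rw [ContinuousAt, arcNormalForm_ofReal hk0] at hN
      -- The chart is cut down to the region where `descend h ∘ exp (i ·)` equals `h`, so that the
      -- equation for `Z` passes from the strip to the cylinder.
      obtain ⟨S, hS, hSo, hsS⟩ := mem_nhds_iff.1 (hN.eventually (hdes (harg ξ)))
      have hEr : AnalyticOnNhd ℝ (E.restrOpen S hSo) (E.restrOpen S hSo).source := fun x hx =>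
        hE x hx.1
      have hEr' : AnalyticOnNhd ℝ (E.restrOpen S hSo).symm (E.restrOpen S hSo).target :=
        fun x hx => hE' x hx.1
      obtain ⟨E', h1, h2, h3, h4⟩ := exists_cylinder_chart hEr hEr'
        (θ₀ := Complex.arg ξ) ⟨hsE, hsS⟩
      rw [Circle.exp_arg] at h1
      refine ⟨E', h1, h2.trans fun x hx => hEO hx.1, fun x hx => ?_, h4⟩
      obtain ⟨θ, hθ, hθs, hθE⟩ := h3 x hx
      obtain ⟨ξ', t⟩ := x
      simp only at hθ
      subst hθ
      have h5 : descend h (Complex.exp (Complex.I * arcNormalForm k (θ, -t))) =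
        h (arcNormalForm k (θ, -t)) := hS hθs.2
      rw [hθE]
      simp only [F]
      rw [← exp_arcNormalForm hodd, h5]
      exact hEZ _ hθs.1)
  have hWo : IsOpen {x : Circle × ℝ | AnalyticAt ℂ (descend h) (closedNormalForm k x)} :=
    (isOpen_analyticAt ℂ (descend h)).preimage (continuous_closedNormalForm k)
  have hKW : (univ : Set Circle) ×ˢ {(0 : ℝ)} ⊆
      V ∩ {x : Circle × ℝ | AnalyticAt ℂ (descend h) (closedNormalForm k x)} := by
    rintro ⟨ξ, t⟩ ⟨-, rfl⟩
    refine ⟨hKV ⟨mem_univ _, rfl⟩, ?_⟩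
    have := analyticAt_descend (h := h) hper (harg ξ) (hhan _ (harg ξ))
    rw [Circle.exp_arg] at this
    rwa [mem_ofPred_eq, closedNormalForm_zero hk0]
  -- Compactness of the circle gives a uniform width `δ`.
  obtain ⟨u, v, -, hvo, hu, hv, huv⟩ := generalized_tube_lemma isCompact_univ
    (isCompact_singleton (x := (0 : ℝ))) (hVo.inter hWo) hKW
  obtain ⟨δ, hδ, hδv⟩ := Metric.isOpen_iff.1 hvo 0 (hv rfl)
  have hcyl : (univ : Set Circle) ×ˢ Ioo (-δ) δ ⊆
      V ∩ {x : Circle × ℝ | AnalyticAt ℂ (descend h) (closedNormalForm k x)} := by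
    rintro ⟨ξ, t⟩ ⟨-, ht⟩
    refine huv ⟨hu (mem_univ _), hδv ?_⟩
    rwa [Real.ball_eq_Ioo, zero_sub, zero_add]
  have hcylo : IsOpen ((univ : Set Circle) ×ˢ Ioo (-δ) δ) := isOpen_univ.prod isOpen_Ioo
  obtain ⟨Φ, hΦs, hΦO, hΦ, hΦZ, hΦloc⟩ := hV _ (fun x hx => (hcyl hx).1) hcylo
  have hsymm : ContMDiffOn 𝓘(ℝ, ℝ × ℝ) ((𝓡 1).prod 𝓘(ℝ, ℝ)) ω Φ.symm Φ.target := by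
    intro z hz
    have hz' := Φ.map_target hz
    rw [hΦs] at hz'
    obtain ⟨E, ⟨-, hE⟩, hxE, hΦE, hsE⟩ := hΦloc _ hz'
    rw [Φ.right_inv hz] at hsE
    have hzE : z ∈ E.target := by
      have := E.map_source hxE
      rwa [← hΦE.self_of_nhds, Φ.right_inv hz] at this
    exact ((hE.contMDiffAt (E.open_target.mem_nhds hzE)).congr_of_eventuallyEq
      hsE).contMDiffWithinAt
  refine ⟨δ, Φ, hδ, hΦs, hΦO, ?_, hsymm, ?_, ?_, ?_⟩
  · intro x hx
    rw [hΦs] at hx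
    obtain ⟨E, ⟨hE, -⟩, hxE, hΦE, -⟩ := hΦloc x hx
    exact ((hE.contMDiffAt (E.open_source.mem_nhds hxE)).congr_of_eventuallyEq
      hΦE).contMDiffWithinAt
  · apply Subset.antisymm
    · rintro _ ⟨⟨ξ, t⟩, ⟨-, rfl⟩, rfl⟩
      obtain ⟨τ, hτ, e⟩ := hsurj _ (harg ξ)
      rw [hΦ, hF ξ τ hτ e]
      exact hcm _
    · rw [← hcΓ]
      rintro _ ⟨ξ, rfl⟩
      set τ := Complex.arg ξ with hτ
      have hτm := harg ξ
      have hm : -Real.pi ∈ Icc (-Real.pi) Real.pi := ⟨le_rfl, by linarith⟩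
      have hp : Real.pi ∈ Icc (-Real.pi) Real.pi := ⟨by linarith, le_rfl⟩
      have hl := hσm hm (Ioc_subset_Icc_self hτm) hτm.1
      have hr := hσm.monotoneOn (Ioc_subset_Icc_self hτm) hp hτm.2
      rw [← hτ, hσ₀] at hl
      rw [← hτ, hσ₁] at hr
      refine ⟨(Circle.exp ((σ τ - β) / α), 0), ⟨mem_univ _, rfl⟩, ?_⟩
      rw [hΦ, hF _ τ hτm, Circle.exp_arg]
      rw [Circle.arg_exp (by rw [lt_div_iff₀ hα]; linarith) (by rw [div_le_iff₀ hα]; linarith)]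
      field_simp
      ring
  · rintro x ⟨-, hx⟩
    have hx' : angular x ∈ (univ : Set Circle) ×ˢ Ioo (-δ) δ := ⟨mem_univ _, hx⟩
    refine wedge_eq_zero_of_holomorphic (h := descend h)
      (AnalyticAt.differentiableAt (hcyl hx').2) (differentiable_closedNormalForm_angular k x) ?_
    filter_upwards [(isOpen_Ioo.preimage continuous_snd).mem_nhds hx] with z hz
    exact hΦZ _ ⟨mem_univ _, hz⟩
  · intro x hx
    have hx' := Φ.map_target hx
    rw [hΦs] at hx'
    refine apply_eq_zero_of_holomorphic (h := descend h)
      (AnalyticAt.differentiableAt (hcyl hx').2) ?_ ?_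
    · have h1 : ContMDiffAt 𝓘(ℝ, ℝ × ℝ) 𝓘(ℝ, ℂ) ω (fun z => closedNormalForm k (Φ.symm z)) x :=
        ContMDiffAt.comp (I' := (𝓡 1).prod 𝓘(ℝ, ℝ)) x (contMDiff_closedNormalForm k).contMDiffAt
          (hsymm.contMDiffAt (Φ.open_target.mem_nhds hx))
      exact h1.contDiffAt.differentiableAt (by simp)
    · filter_upwards [Φ.open_target.mem_nhds hx] with z hz
      have hz' := Φ.map_target hz
      rw [hΦs] at hz'
      have := hΦZ _ hz'
      rwa [Φ.right_inv hz] at this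

end ClosedNormalForm

end PlanarStructure

end

open PlanarStructure in
theorem mainTheorem7 (O : Set (ℝ × ℝ)) (Z : ℝ × ℝ → ℂ) (hZ : IsHypocomplex O Z) :
    -- normal form along an arc `G` from `p` to `q` in a component `Γ` of the regular part
    (∀ (Γ G : Set (ℝ × ℝ)) (p q : ℝ × ℝ) (k : ℕ),
      (∃ x ∈ (vectorFieldOf Z).regularCharSet O,
        Γ = connectedComponentIn ((vectorFieldOf Z).regularCharSet O) x) →
      p ≠ q → IsArc G p q → G ⊆ Γ →
      (∀ x ∈ G, (vectorFieldOf Z).HasTypeAt x k) →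
      ∃ (ε δ : ℝ) (Φ : OpenPartialHomeomorph (ℝ × ℝ) (ℝ × ℝ)),
        0 < ε ∧ 0 < δ ∧
        Φ.source = rectangle ε δ ∧ Φ.target ⊆ O ∧
        AnalyticOnNhd ℝ Φ Φ.source ∧ AnalyticOnNhd ℝ Φ.symm Φ.target ∧
        Φ (-1, 0) = p ∧ Φ (1, 0) = q ∧ Φ '' (Set.Icc (-1) 1 ×ˢ {0}) = G ∧
        (∀ x ∈ rectangle ε δ, wedge (fun z => Z (Φ z)) (arcNormalForm k) x = 0) ∧
        (∀ x ∈ Φ.target,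
          (vectorFieldOf Z).apply (fun z => arcNormalForm k (Φ.symm z)) x = 0)) ∧
    -- normal form along a closed curve `Γ` in the regular part
    (∀ (Γ : Set (ℝ × ℝ)) (k : ℕ),
      IsClosedCurve Γ → Γ ⊆ (vectorFieldOf Z).regularCharSet O →
      (∀ x ∈ Γ, (vectorFieldOf Z).HasTypeAt x k) →
      ∃ (δ : ℝ) (Φ : OpenPartialHomeomorph (Circle × ℝ) (ℝ × ℝ)),
        0 < δ ∧
        Φ.source = Set.univ ×ˢ Set.Ioo (-δ) δ ∧ Φ.target ⊆ O ∧
        ContMDiffOn ((𝓡 1).prod 𝓘(ℝ, ℝ)) 𝓘(ℝ, ℝ × ℝ) ω Φ Φ.source ∧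
        ContMDiffOn 𝓘(ℝ, ℝ × ℝ) ((𝓡 1).prod 𝓘(ℝ, ℝ)) ω Φ.symm Φ.target ∧
        Φ '' (Set.univ ×ˢ {0}) = Γ ∧
        (∀ x ∈ (Set.univ ×ˢ Set.Ioo (-δ) δ : Set (ℝ × ℝ)),
          wedge (fun z => Z (Φ (angular z))) (fun z => closedNormalForm k (angular z)) x = 0) ∧
        (∀ x ∈ Φ.target,
          (vectorFieldOf Z).apply (fun z => closedNormalForm k (Φ.symm z)) x = 0)) := by
  exact ⟨fun Γ G p q k ⟨_, _, hΓ⟩ _ hG hGΓ hk => exists_arc_normalForm hZ hG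
      (hGΓ.trans (hΓ ▸ connectedComponentIn_subset _ _)) hk,
    fun Γ k hΓ hΓr hk => exists_closed_normalForm hZ hΓ hΓr hk⟩
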